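/- \textbf{Theorem (lazily re-randomized ACB).} \emph{Setting.} Let $d\ge 1$, $A\ge 1$, $T\ge 2$, $\delta\in(0,1)$ and $\sigma,W,B>0$. A linear bandit has the fixed action set $\mathcal A=\{x_1,\dots,x_A\}\subset\mathbb R^d$ with $\|x_b\|^2\le B$, and a parameter $\theta^*\in\mathbb R^d$ with $\|\theta^*\|\le W$. Playing $a_t\in\mathcal A$ in round $t$ yields the reward $r_t=\langle a_t,\theta^*\rangle+\varepsilon_t$, where $(\varepsilon_t)$ is a martingale difference sequence which is conditionally $\sigma$-subgaussian given everything that precedes it (including $a_t$ and the random targets drawn up to round $t$). The regret is $R(T)=\sum_{t=1}^T\big(\max_{a\in\mathcal A}\langle a,\theta^*\rangle-\langle a_t,\theta^*\rangle\big)$. \emph{Algorithm.} Given $M,\lambda,\beta,\gamma$, put $a_{-i+1}=\sqrt\lambda\,e_i$ for $i=1,\dots,d$ and start with a counter equal to $0$. In round $t$, if the counter is $0$: let $\hat\theta_t$ minimize $\sum_{i=1}^{t-1}(\langle a_i,\theta\rangle-r_i)^2+\lambda\|\theta\|^2$; draw fresh independent targets $y^{(j)}_{s}\sim\mathcal N(0,1)$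 for $j\in[M]$, $-d+1\le s\le t-1$, independent of the past (a \emph{re-randomization}); let $w^{(j)}_t$ minimize $\sum_{s=-d+1}^{t-1}(\langle a_{s},w\rangle-y^{(j)}_{s})^2$; put $\mathrm{bonus}_t(a)=\beta\max_{j\in[M]}|\langle a,w_t^{(j)}\rangle|$; choose $a_t\in\arg\max_{a\in\mathcal A}\langle a,\hat\theta_t\rangle+\mathrm{bonus}_t(a)$; and set the counter to $\lceil\gamma/\mathrm{bonus}_t(a_t)^2\rceil$ ($=\infty$ if the bonus is $0$). If the counter is not $0$, put $a_t=a_{t-1}$. At the end of every round, decrease the counter by $1$. \emph{Claim.} Write $\log^+z=\max\{1,\log z\}$. For every $\kappa\ge 1$ there is a constant $C>0$, depending only on $\kappa$, such that in every such setting the algorithm with \[M=\lceil\kappa\log(AT/\delta)\rceil,\quad \lambda=\frac{\sigma^2}{W^2},\quad \beta=\Big(\sqrt\lambda\,W+\sqrt2\,\sigma\sqrt{d\log\big(1+\tfrac{TB}{\lambda d}\big)+\log(T/\delta)}\Big)\sqrt{\frac{2}{\pi\log2}},\quad \gamma=\frac{\beta^2\pi\log 2}{2}\] satisfies the following, where $\Lambda$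 is $\log^+\!\big(\tfrac{TBW^2}{\sigma^2d}\big)$ or, provided that $B\ge1$, also $\log^+\!\big(\tfrac{TBW}{\sigma d}\big)$. With probability at least $1-\delta$, both \begin{itemize} \item the number of re-randomizations in rounds $1,\dots,T$ is at most $C\,d\,\Lambda\,\log(AT/\delta)$, and \item if $T\ge BW^2/\sigma^2$, and if moreover $\delta\ge T^{-1/4}$ or $\kappa\ge 2/\log 2$, then $R(T)\le C\,\sigma d\sqrt{T\log A}\,\log(T/\delta)\,\Lambda$. \end{itemize} In particular, $\kappa=1$, that is $M=\lceil\log(AT/\delta)\rceil$, is allowed for both bounds when $\delta\ge T^{-1/4}$, and for the bound on the number of re-randomizations always. -/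

import Mathlib

open MeasureTheory ProbabilityTheory

noncomputable section

/-- The logarithm truncated from below at `1`. -/
def logPlus (z : ℝ) : ℝ := max 1 (Real.log z)

/-- The ridge-regression objective at the start of round `t`, for the played feature vectors
`a 1, …, a (t - 1)` and the observed rewards `r 1, …, r (t - 1)`. -/
def ridgeLoss {d : ℕ} (lam : ℝ) (a : ℕ → EuclideanSpace ℝ (Fin d)) (r : ℕ → ℝ) (t : ℕ)
    (θ : EuclideanSpace ℝ (Fin d)) : ℝ :=
  ∑ i ∈ Finset.Ico 1 t, (inner ℝ (a i) θ - r i) ^ 2 + lam * ‖θ‖ ^ 2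

/-- The least-squares objective of one ensemble member at the start of round `t`. The target
`y (Sum.inl i)` belongs to the warm-start feature `√lam • e_i`, and `y (Sum.inr i)` to the
feature vector played in round `i`. -/
def ensembleLoss {d : ℕ} (lam : ℝ) (a : ℕ → EuclideanSpace ℝ (Fin d)) (t : ℕ)
    (y : Fin d ⊕ ℕ → ℝ) (w : EuclideanSpace ℝ (Fin d)) : ℝ :=
  ∑ i : Fin d,
      (inner ℝ (Real.sqrt lam • EuclideanSpace.single i (1 : ℝ)) w - y (Sum.inl i)) ^ 2 +
    ∑ i ∈ Finset.Ico 1 t, (inner ℝ (a i) w - y (Sum.inr i)) ^ 2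

/-- The bonus of a feature vector: `β` times the largest absolute prediction in the ensemble. -/
def acbBonus {d M : ℕ} (β : ℝ) (w : Fin M → EuclideanSpace ℝ (Fin d))
    (v : EuclideanSpace ℝ (Fin d)) : ℝ :=
  β * ⨆ j : Fin M, |inner ℝ v (w j)|

/-- The number of rounds `⌈γ / b ^ 2⌉` for which an action of bonus `b` is played
(infinite when `b = 0`). -/
def phaseLength (γ b : ℝ) : ℕ∞ :=
  if b = 0 then ⊤ else ((⌈γ / b ^ 2⌉₊ : ℕ) : ℕ∞)

/-- Conditionally on `m`, the random variable `X` is `σ`-subgaussian. -/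
def CondSubgaussian {Ω : Type*} [MeasurableSpace Ω] (P : Measure Ω) (m : MeasurableSpace Ω)
    (X : Ω → ℝ) (σ : ℝ) : Prop :=
  (∀ s : ℝ, Integrable (fun ω => Real.exp (s * X ω)) P) ∧
    ∀ s : ℝ, P[fun ω => Real.exp (s * X ω) | m] ≤ᵐ[P] fun _ => Real.exp (s ^ 2 * σ ^ 2 / 2)

/-- The σ-algebra generated by a batch of random targets. -/
@[reducible] def targetSigma {Ω : Type*} {d M : ℕ} (y : Fin M → Fin d ⊕ ℕ → Ω → ℝ) : MeasurableSpace Ω :=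
  ⨆ j, ⨆ i, MeasurableSpace.comap (y j i) inferInstance

/-- An execution, over rounds `1, …, T`, of the lazily re-randomized anti-concentrated confidence
bound algorithm with ensemble size `M` and parameters `lam`, `β`, `γ`, on the linear bandit with
fixed feature vectors `x b` (`b : Fin A`), parameter `θstar` and `σ`-subgaussian
martingale-difference noise. Ties in the maximization are broken arbitrarily. -/
structure LazyACBRun {Ω : Type*} [mΩ : MeasurableSpace Ω] (P : Measure Ω) {d A : ℕ}
    (x : Fin A → EuclideanSpace ℝ (Fin d)) (θstar : EuclideanSpace ℝ (Fin d))
    (σ : ℝ) (M : ℕ) (lam β γ : ℝ) (T : ℕ) where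
  /-- `ℱ t` is the information available at the start of round `t`. -/
  ℱ : Filtration ℕ mΩ
  /-- The noise in the reward of round `t`. -/
  ε : ℕ → Ω → ℝ
  /-- `y t` is the batch of fresh targets for round `t`; it is looked at only if the algorithm
  re-randomizes in that round. -/
  y : ℕ → Fin M → Fin d ⊕ ℕ → Ω → ℝ
  /-- The action played in round `t`. -/
  act : ℕ → Ω → Fin A
  /-- The reward estimator; constrained in the rounds with an update only. -/
  thetaHat : ℕ → Ω → EuclideanSpace ℝ (Fin d)
  /-- The ensemble; constrained in the rounds with an update only. -/
  w : ℕ → Fin M → Ω → EuclideanSpace ℝ (Fin d)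
  /-- The countdown at the start of round `t`: the algorithm updates and re-randomizes in
  round `t` exactly if it is `0`. -/
  counter : ℕ → Ω → ℕ∞
  noise_measurable : ∀ t ∈ Finset.Icc 1 T, Measurable[ℱ (t + 1)] (ε t)
  noise_condExp : ∀ t ∈ Finset.Icc 1 T, P[ε t | ℱ t ⊔ targetSigma (y t)] =ᵐ[P] 0
  noise_subgaussian : ∀ t ∈ Finset.Icc 1 T,
    CondSubgaussian P (ℱ t ⊔ targetSigma (y t)) (ε t) σ
  target_measurable : ∀ t ∈ Finset.Icc 1 T, ∀ j i, Measurable[ℱ (t + 1)] (y t j i)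
  target_law : ∀ t ∈ Finset.Icc 1 T, ∀ j i, P.map (y t j i) = gaussianReal 0 1
  target_iIndep : ∀ t ∈ Finset.Icc 1 T,
    iIndepFun (fun p : Fin M × (Fin d ⊕ ℕ) => y t p.1 p.2) P
  target_fresh : ∀ t ∈ Finset.Icc 1 T, Indep (ℱ t) (targetSigma (y t)) P
  act_measurable : ∀ t ∈ Finset.Icc 1 T, Measurable[ℱ t ⊔ targetSigma (y t)] (act t)
  counter_init : ∀ ω, counter 1 ω = 0
  thetaHat_argmin : ∀ t ∈ Finset.Icc 1 T, ∀ ω, counter t ω = 0 →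
    IsMinOn (ridgeLoss lam (fun i => x (act i ω))
      (fun i => inner ℝ (x (act i ω)) θstar + ε i ω) t) Set.univ (thetaHat t ω)
  w_argmin : ∀ t ∈ Finset.Icc 1 T, ∀ ω, counter t ω = 0 → ∀ j,
    IsMinOn (ensembleLoss lam (fun i => x (act i ω)) t (fun i => y t j i ω)) Set.univ (w t j ω)
  act_argmax : ∀ t ∈ Finset.Icc 1 T, ∀ ω, counter t ω = 0 → ∀ b : Fin A,
    inner ℝ (x b) (thetaHat t ω) + acbBonus β (fun j => w t j ω) (x b) ≤
      inner ℝ (x (act t ω)) (thetaHat t ω) + acbBonus β (fun j => w t j ω) (x (act t ω))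
  act_keep : ∀ t ∈ Finset.Icc 1 T, ∀ ω, counter t ω ≠ 0 → act t ω = act (t - 1) ω
  counter_update : ∀ t ∈ Finset.Icc 1 T, ∀ ω, counter t ω = 0 →
    counter (t + 1) ω = phaseLength γ (acbBonus β (fun j => w t j ω) (x (act t ω))) - 1
  counter_keep : ∀ t ∈ Finset.Icc 1 T, ∀ ω, counter t ω ≠ 0 →
    counter (t + 1) ω = counter t ω - 1

/-- The regret over `T` rounds. -/
def LazyACBRun.regret {Ω : Type*} [MeasurableSpace Ω] {P : Measure Ω} {d A : ℕ}
    {x : Fin A → EuclideanSpace ℝ (Fin d)} {θstar : EuclideanSpace ℝ (Fin d)}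
    {σ : ℝ} {M : ℕ} {lam β γ : ℝ} {T : ℕ} (R : LazyACBRun P x θstar σ M lam β γ T) (ω : Ω) : ℝ :=
  ∑ t ∈ Finset.Icc 1 T,
    ((⨆ b : Fin A, inner ℝ (x b) θstar) - inner ℝ (x (R.act t ω)) θstar)

/-- The number of rounds in which the random targets are re-sampled. -/
def LazyACBRun.resampleCount {Ω : Type*} [MeasurableSpace Ω] {P : Measure Ω} {d A : ℕ}
    {x : Fin A → EuclideanSpace ℝ (Fin d)} {θstar : EuclideanSpace ℝ (Fin d)}
    {σ : ℝ} {M : ℕ} {lam β γ : ℝ} {T : ℕ} (R : LazyACBRun P x θstar σ M lam β γ T) (ω : Ω) : ℕ :=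
  {t : ℕ | t ∈ Finset.Icc 1 T ∧ R.counter t ω = 0}.ncard

end

/-! Let V be the regularized design matrix at the start of a round and call ⟨a, V⁻¹a⟩ the width of
an action a. Thanks to the warm-start features, an ensemble prediction at v is a linear combination
of the fresh targets whose squared weights sum to exactly ⟨v, V⁻¹v⟩ (`sum_targetWeight_sq`). Given
the past, the predictions at v are therefore M independent centred Gaussians with that variance.
Freshness of the targets, and the fact that a finite action set has finitely many histories, make
this rigorous (`measure_inter_history_le`).

Counting. Outside an event of small probability no prediction exceeds z standard deviations, with z²
of order log(AT/δ). A completed phase of n rounds has n ≥ γ / bonus², so n times its width is at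
least (π log 2 / 2) / z² ≥ 1 / z². As its action is constant, log det V grows by log(1 + n · width)
≥ 1 / (2z²) during the phase, whereas it grows by at most E = d log(1 + TB/(λd)) in total. Hence
there are at most 1 + 2z²E re-randomizations. Only the upper bound on the predictions enters, so any
κ ≥ 1 will do.

Regret. The self-normalized martingale inequality (Gaussian mixtures and Ville's inequality) gives a
confidence radius for the ridge estimate. If some ensemble member is at least r standard deviations
from 0 at the best action, with βr above that radius, then the gap of the chosen action is at most a
constant times its bonus (`gap_le_bonus`). Cauchy–Schwarz over the rounds finishes the bound, since
a phase contributes length · bonus² ≤ γ + bonus². Phases of width at least 1 are treated apart: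
there are at most 2E of them, and anti-concentration bounds their length (`regret_le`).

Optimism is the delicate point (`exists_radius`), and it is needed for the best action in
re-randomization rounds only. For κ ≥ 2/log 2, the level r = √(π log 2 / 2) fails with probability
at most 2^(-M/2), which survives a union over T rounds. For smaller κ, the assumption δ ≥ T^(-1/4)
leaves the factor √2 in β unused, and r can be shrunk by 0.72, with failure probability at most
exp(-0.59 M). The union then runs over re-randomizations only. A second potential, counting plays
per action, bounds their number by A times a polylogarithm; together with the bound T this is
roughly √(AT), which (AT/δ)^(-0.59) beats. Horizons below a constant multiple of dΛ satisfy the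
regret bound trivially. -/

section LazyACB

open Matrix

/-- The regularized design matrix `lam • 1 + ∑ aᵢ aᵢᵀ` of the vectors `a 1, …, a (t - 1)`. -/
def designMatrix {d : ℕ} (lam : ℝ) (a : ℕ → Fin d → ℝ) (t : ℕ) : Matrix (Fin d) (Fin d) ℝ :=
  lam • 1 + ∑ i ∈ Finset.Ico 1 t, vecMulVec (a i) (a i)

/-- The squared norm of `v` with respect to `V⁻¹`. -/
noncomputable def invNormSq {d : ℕ} (V : Matrix (Fin d) (Fin d) ℝ) (v : Fin d → ℝ) : ℝ := v ⬝ᵥ (V⁻¹ *ᵥ v)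

/-! ### Design matrices, elliptical potential and least squares -/

section LinearAlgebra

variable {d : ℕ} {V : Matrix (Fin d) (Fin d) ℝ}

theorem designMatrix_succ (lam : ℝ) (a : ℕ → Fin d → ℝ) {t : ℕ} (ht : 1 ≤ t) :
    designMatrix lam a (t + 1) = designMatrix lam a t + vecMulVec (a t) (a t) := by
  rw [designMatrix, designMatrix, Finset.sum_Ico_succ_top ht, add_assoc]

theorem designMatrix_one (lam : ℝ) (a : ℕ → Fin d → ℝ) : designMatrix lam a 1 = lam • 1 := by
  simp [designMatrix]

theorem designMatrix_congr (lam : ℝ) {a a' : ℕ → Fin d → ℝ} {t : ℕ}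
    (h : ∀ i ∈ Finset.Ico 1 t, a i = a' i) : designMatrix lam a t = designMatrix lam a' t := by
  rw [designMatrix, designMatrix]
  congr 1
  exact Finset.sum_congr rfl fun i hi => by rw [h i hi]

theorem dotProduct_designMatrix_mulVec (lam : ℝ) (a : ℕ → Fin d → ℝ) (t : ℕ) (v w : Fin d → ℝ) :
    v ⬝ᵥ (designMatrix lam a t *ᵥ w) =
      lam * (v ⬝ᵥ w) + ∑ i ∈ Finset.Ico 1 t, (a i ⬝ᵥ v) * (a i ⬝ᵥ w) := by
  rw [designMatrix, add_mulVec, dotProduct_add, smul_mulVec, one_mulVec, dotProduct_smul,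
    smul_eq_mul, sum_mulVec, dotProduct_sum]
  congr 1
  refine Finset.sum_congr rfl fun i _ => ?_
  rw [vecMulVec_mulVec, dotProduct_comm v]
  simp [mul_comm]

theorem posDef_designMatrix {lam : ℝ} (hlam : 0 < lam) (a : ℕ → Fin d → ℝ) (t : ℕ) :
    (designMatrix lam a t).PosDef := by
  refine Matrix.PosDef.add_posSemidef (PosDef.one.smul hlam) ?_
  refine posSemidef_sum _ fun i _ => ?_
  simpa using posSemidef_vecMulVec_self_star (a i)

theorem Matrix.PosDef.isUnit_det_real (hV : V.PosDef) : IsUnit V.det :=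
  isUnit_iff_ne_zero.2 hV.det_pos.ne'

theorem Matrix.PosDef.mulVec_inv_mulVec (hV : V.PosDef) (v : Fin d → ℝ) :
    V *ᵥ (V⁻¹ *ᵥ v) = v := by
  rw [mulVec_mulVec, mul_nonsing_inv _ hV.isUnit_det_real, one_mulVec]

theorem Matrix.PosDef.inv_mulVec_mulVec (hV : V.PosDef) (v : Fin d → ℝ) :
    V⁻¹ *ᵥ (V *ᵥ v) = v := by
  rw [mulVec_mulVec, nonsing_inv_mul _ hV.isUnit_det_real, one_mulVec]

theorem Matrix.PosDef.dotProduct_inv_comm (hV : V.PosDef) (v w : Fin d → ℝ) :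
    v ⬝ᵥ (V⁻¹ *ᵥ w) = w ⬝ᵥ (V⁻¹ *ᵥ v) := by
  have h : (V⁻¹)ᵀ = V⁻¹ := by simpa using hV.inv.isHermitian.eq
  rw [dotProduct_mulVec, ← mulVec_transpose, h, dotProduct_comm]

theorem invNormSq_nonneg (hV : V.PosDef) (v : Fin d → ℝ) : 0 ≤ invNormSq V v := by
  simpa [invNormSq] using hV.inv.posSemidef.dotProduct_mulVec_nonneg v

theorem invNormSq_smul_add (hV : V.PosDef) (τ : ℝ) (v w : Fin d → ℝ) :
    invNormSq V (v + τ • w) =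
      invNormSq V v + 2 * τ * (v ⬝ᵥ (V⁻¹ *ᵥ w)) + τ ^ 2 * invNormSq V w := by
  simp only [invNormSq, mulVec_add, mulVec_smul, add_dotProduct, dotProduct_add, smul_dotProduct,
    dotProduct_smul, smul_eq_mul]
  rw [hV.dotProduct_inv_comm w v]
  ring

theorem sq_dotProduct_inv_le (hV : V.PosDef) (v w : Fin d → ℝ) :
    (v ⬝ᵥ (V⁻¹ *ᵥ w)) ^ 2 ≤ invNormSq V v * invNormSq V w := by
  have h := discrim_le_zero (a := invNormSq V w) (b := 2 * (v ⬝ᵥ (V⁻¹ *ᵥ w)))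
    (c := invNormSq V v) (fun τ => by
      have := invNormSq_nonneg hV (v + τ • w)
      rw [invNormSq_smul_add hV] at this
      linarith)
  rw [discrim] at h
  nlinarith

theorem abs_dotProduct_inv_le (hV : V.PosDef) (v w : Fin d → ℝ) :
    |v ⬝ᵥ (V⁻¹ *ᵥ w)| ≤ √(invNormSq V v) * √(invNormSq V w) := by
  rw [← Real.sqrt_mul (invNormSq_nonneg hV v)]
  exact Real.abs_le_sqrt (sq_dotProduct_inv_le hV v w)

theorem det_add_smul_vecMulVec (hV : V.PosDef) (c : ℝ) (v : Fin d → ℝ) :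
    (V + c • vecMulVec v v).det = V.det * (1 + c * invNormSq V v) := by
  have h := det_add_replicateCol_mul_replicateRow (ι := Unit) hV.isUnit_det_real (c • v) v
  rw [← vecMulVec_eq] at h
  rw [← smul_vecMulVec, h]
  congr 1
  rw [det_unique]
  simp [invNormSq, Matrix.mul_apply, dotProduct, mulVec, replicateCol, replicateRow, Finset.mul_sum,
    Finset.sum_mul]
  rw [Finset.sum_comm]
  refine Finset.sum_congr rfl fun i _ => Finset.sum_congr rfl fun j _ => by ring

theorem posDef_add_smul_vecMulVec (hV : V.PosDef) {c : ℝ} (hc : 0 ≤ c) (v : Fin d → ℝ) :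
    (V + c • vecMulVec v v).PosDef := by
  refine hV.add_posSemidef (PosSemidef.smul ?_ hc)
  simpa using posSemidef_vecMulVec_self_star v

/-- The Sherman–Morrison formula, evaluated as a quadratic form. -/
theorem invNormSq_add_vecMulVec (hV : V.PosDef) (a v : Fin d → ℝ) :
    invNormSq (V + vecMulVec a a) v =
      invNormSq V v - (a ⬝ᵥ (V⁻¹ *ᵥ v)) ^ 2 / (1 + invNormSq V a) := by
  have hV' : (V + vecMulVec a a).PosDef := by
    simpa using posDef_add_smul_vecMulVec hV zero_le_one a
  have hu : 0 < 1 + invNormSq V a := by linarith [invNormSq_nonneg hV a]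
  set c := (a ⬝ᵥ (V⁻¹ *ᵥ v)) / (1 + invNormSq V a) with hc
  -- The right-hand side is checked to solve the updated linear system, which avoids computing the
  -- inverse matrix.
  have key : (V + vecMulVec a a)⁻¹ *ᵥ v = V⁻¹ *ᵥ (v - c • a) := by
    have h2 : (V + vecMulVec a a) *ᵥ (V⁻¹ *ᵥ (v - c • a)) = v := by
      rw [add_mulVec, hV.mulVec_inv_mulVec, vecMulVec_mulVec, mulVec_sub, dotProduct_sub,
        mulVec_smul, dotProduct_smul]
      have : (a ⬝ᵥ (V⁻¹ *ᵥ v)) = c * (1 + a ⬝ᵥ (V⁻¹ *ᵥ a)) := by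
        exact (div_mul_cancel₀ _ hu.ne').symm
      rw [this]
      ext i
      simp
      ring
    conv_lhs => rw [← h2]
    rw [hV'.inv_mulVec_mulVec]
  rw [invNormSq, key, mulVec_sub, dotProduct_sub, mulVec_smul, dotProduct_smul,
    hV.dotProduct_inv_comm v a, smul_eq_mul, hc, ← invNormSq]
  ring

/-- With w = V⁻¹v and q = ⟨v, w⟩, expanding q = ⟨w, Vw⟩ and keeping only the summands with `a i = v`
gives q ≥ λ|w|² + n q². Cauchy–Schwarz q² ≤ |v|²|w|² then eliminates w. This is what drives the
per-action count in `resampleCount_sub_one_mul_le_card`. -/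
theorem mul_invNormSq_le {lam : ℝ} (hlam : 0 < lam) (a : ℕ → Fin d → ℝ) (t : ℕ) (v : Fin d → ℝ) :
    (lam + ({i ∈ Finset.Ico 1 t | a i = v}.card : ℝ) * (v ⬝ᵥ v)) *
      invNormSq (designMatrix lam a t) v ≤ v ⬝ᵥ v := by
  have hV := posDef_designMatrix hlam a t
  set V := designMatrix lam a t
  set w := V⁻¹ *ᵥ v
  set n : ℝ := ({i ∈ Finset.Ico 1 t | a i = v}.card : ℝ)
  have hn : 0 ≤ n := by positivity
  have hu0 : 0 ≤ v ⬝ᵥ w := invNormSq_nonneg hV v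
  have h1 : v ⬝ᵥ w = lam * (w ⬝ᵥ w) + ∑ i ∈ Finset.Ico 1 t, (a i ⬝ᵥ w) * (a i ⬝ᵥ w) := by
    rw [← dotProduct_designMatrix_mulVec, hV.mulVec_inv_mulVec, dotProduct_comm]
  have h2 : n * (v ⬝ᵥ w) ^ 2 ≤ ∑ i ∈ Finset.Ico 1 t, (a i ⬝ᵥ w) * (a i ⬝ᵥ w) := by
    calc n * (v ⬝ᵥ w) ^ 2 = ∑ i ∈ Finset.Ico 1 t with a i = v, (a i ⬝ᵥ w) * (a i ⬝ᵥ w) := by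
          rw [Finset.sum_congr rfl (g := fun _ => (v ⬝ᵥ w) ^ 2)]
          · simp [n]
          · intro i hi
            rw [(Finset.mem_filter.1 hi).2, sq]
      _ ≤ _ := Finset.sum_le_sum_of_subset_of_nonneg (Finset.filter_subset _ _)
          fun i _ _ => mul_self_nonneg _
  have h3 : (v ⬝ᵥ w) ^ 2 ≤ (v ⬝ᵥ v) * (w ⬝ᵥ w) := by
    simp only [dotProduct]
    simpa [sq] using Finset.sum_mul_sq_le_sq_mul_sq Finset.univ v w
  have hvv : 0 ≤ v ⬝ᵥ v := by simpa using dotProduct_star_self_nonneg v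
  change (lam + n * (v ⬝ᵥ v)) * (v ⬝ᵥ w) ≤ v ⬝ᵥ v
  rcases hu0.eq_or_lt with h0 | hpos
  · rw [← h0, mul_zero]; exact hvv
  · have h4 : lam * (v ⬝ᵥ w) ^ 2 ≤ lam * ((v ⬝ᵥ v) * (w ⬝ᵥ w)) := by gcongr
    have h5 : (v ⬝ᵥ v) * (n * (v ⬝ᵥ w) ^ 2) ≤ (v ⬝ᵥ v) * (v ⬝ᵥ w - lam * (w ⬝ᵥ w)) := by
      gcongr; linarith
    refine le_of_mul_le_mul_right ?_ hpos
    nlinarith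

theorem invNormSq_designMatrix_le {lam : ℝ} (hlam : 0 < lam) (a : ℕ → Fin d → ℝ) (t : ℕ)
    (v : Fin d → ℝ) : invNormSq (designMatrix lam a t) v ≤ (v ⬝ᵥ v) / lam := by
  have h := mul_invNormSq_le hlam a t v
  have hvv : 0 ≤ v ⬝ᵥ v := by simpa using dotProduct_star_self_nonneg v
  have h0 := invNormSq_nonneg (posDef_designMatrix hlam a t) v
  rw [le_div_iff₀ hlam]
  have : 0 ≤ ({i ∈ Finset.Ico 1 t | a i = v}.card : ℝ) * (v ⬝ᵥ v) := by positivity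
  nlinarith

/-- The inequality of arithmetic and geometric means for the eigenvalues. -/
theorem Matrix.PosDef.det_le_trace_div_pow (hd : 0 < d) (hV : V.PosDef) :
    V.det ≤ (V.trace / d) ^ d := by
  have hd' : (0 : ℝ) < d := by exact_mod_cast hd
  have hdet := hV.isHermitian.det_eq_prod_eigenvalues
  have htr := hV.isHermitian.trace_eq_sum_eigenvalues
  simp only [RCLike.ofReal_real_eq_id, id] at hdet htr
  have hpos := hV.eigenvalues_pos
  have amgm := Real.geom_mean_le_arith_mean_weighted Finset.univ (fun _ => (d : ℝ)⁻¹)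
    hV.isHermitian.eigenvalues (fun _ _ => by positivity)
    (by simp [hd'.ne']) (fun i _ => (hpos i).le)
  rw [Real.finsetProd_rpow _ _ (fun i _ => (hpos i).le), ← Finset.mul_sum, ← htr, ← hdet] at amgm
  have := pow_le_pow_left₀ (by positivity [hV.det_pos]) amgm d
  rw [← Real.rpow_natCast, ← Real.rpow_mul hV.det_pos.le, inv_mul_cancel₀ hd'.ne',
    Real.rpow_one] at this
  rwa [div_eq_inv_mul]

theorem trace_designMatrix (lam : ℝ) (a : ℕ → Fin d → ℝ) (t : ℕ) :
    (designMatrix lam a t).trace = lam * d + ∑ i ∈ Finset.Ico 1 t, a i ⬝ᵥ a i := by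
  simp [designMatrix, trace_add, trace_sum, trace_smul, trace_vecMulVec]

/-- The logarithm of the determinant of `V / lam`. -/
noncomputable def logDetRatio (lam : ℝ) (V : Matrix (Fin d) (Fin d) ℝ) : ℝ := Real.log V.det - d * Real.log lam

theorem logDetRatio_designMatrix_one {lam : ℝ} (a : ℕ → Fin d → ℝ) :
    logDetRatio lam (designMatrix lam a 1) = 0 := by
  simp [logDetRatio, designMatrix_one, Real.log_pow]

theorem logDetRatio_add_smul_vecMulVec (lam : ℝ) (hV : V.PosDef) {c : ℝ} (hc : 0 ≤ c)
    (v : Fin d → ℝ) :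
    logDetRatio lam (V + c • vecMulVec v v) =
      logDetRatio lam V + Real.log (1 + c * invNormSq V v) := by
  have h1 : 0 < 1 + c * invNormSq V v := by
    have := mul_nonneg hc (invNormSq_nonneg hV v); linarith
  rw [logDetRatio, logDetRatio, det_add_smul_vecMulVec hV, Real.log_mul hV.det_pos.ne' h1.ne']
  ring

theorem logDetRatio_designMatrix_succ {lam : ℝ} (hlam : 0 < lam) (a : ℕ → Fin d → ℝ) {t : ℕ}
    (ht : 1 ≤ t) :
    logDetRatio lam (designMatrix lam a (t + 1)) = logDetRatio lam (designMatrix lam a t) +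
      Real.log (1 + invNormSq (designMatrix lam a t) (a t)) := by
  have := logDetRatio_add_smul_vecMulVec lam (posDef_designMatrix hlam a t) zero_le_one (a t)
  rwa [one_smul, one_mul, ← designMatrix_succ lam a ht] at this

theorem logDetRatio_designMatrix_eq_sum {lam : ℝ} (hlam : 0 < lam) (a : ℕ → Fin d → ℝ) {t : ℕ}
    (ht : 1 ≤ t) :
    logDetRatio lam (designMatrix lam a t) =
      ∑ i ∈ Finset.Ico 1 t, Real.log (1 + invNormSq (designMatrix lam a i) (a i)) := by
  induction t, ht using Nat.le_induction with
  | base => simp [logDetRatio_designMatrix_one]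
  | succ t ht ih => rw [logDetRatio_designMatrix_succ hlam a ht, ih, Finset.sum_Ico_succ_top ht]

theorem logDetRatio_designMatrix_le {lam B : ℝ} {T t : ℕ} (hd : 0 < d) (hlam : 0 < lam)
    (a : ℕ → Fin d → ℝ) (hB0 : 0 ≤ B) (hB : ∀ i, a i ⬝ᵥ a i ≤ B) (ht : t ≤ T + 1) :
    logDetRatio lam (designMatrix lam a t) ≤ d * Real.log (1 + T * B / (lam * d)) := by
  have hd' : (0 : ℝ) < d := by exact_mod_cast hd
  have hV := posDef_designMatrix hlam a t
  have h1 := hV.det_le_trace_div_pow hd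
  have h2 : (designMatrix lam a t).trace / d ≤ lam * (1 + T * B / (lam * d)) := by
    rw [trace_designMatrix]
    have : ∑ i ∈ Finset.Ico 1 t, a i ⬝ᵥ a i ≤ T * B := by
      calc _ ≤ ∑ i ∈ Finset.Ico 1 t, B := Finset.sum_le_sum fun i _ => hB i
        _ = ((t - 1 : ℕ) : ℝ) * B := by simp
        _ ≤ T * B := by gcongr; omega
    rw [div_le_iff₀ hd']
    have e : lam * (1 + T * B / (lam * d)) * d = lam * d + T * B := by field_simp
    rw [e]; linarith
  have h0 : 0 ≤ (designMatrix lam a t).trace / d := by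
    have := hV.posSemidef.trace_nonneg; positivity
  have hpos : 0 < 1 + T * B / (lam * d) := by positivity
  have h3 := Real.log_le_log hV.det_pos (h1.trans (pow_le_pow_left₀ h0 h2 d))
  rw [Real.log_pow, Real.log_mul hlam.ne' hpos.ne'] at h3
  rw [logDetRatio]
  linarith

/-- The first-order condition for a finite least-squares objective. -/
theorem sum_residual_mul_eq_zero {E ι : Type*} [AddCommGroup E] [Module ℝ E] (s : Finset ι)
    (f : ι → E →ₗ[ℝ] ℝ) (c : ι → ℝ) (w : E)
    (hw : IsMinOn (fun w => ∑ i ∈ s, (f i w - c i) ^ 2) Set.univ w) (v : E) :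
    ∑ i ∈ s, (f i w - c i) * f i v = 0 := by
  -- Along w + τv the objective increases by a nonnegative quadratic in τ without constant term, so
  -- its linear coefficient has nonpositive square.
  have h := discrim_le_zero (a := ∑ i ∈ s, (f i v) ^ 2) (b := 2 * ∑ i ∈ s, (f i w - c i) * f i v)
    (c := 0) (fun τ => by
      have h1 : ∑ i ∈ s, (f i w - c i) ^ 2 ≤ ∑ i ∈ s, (f i (w + τ • v) - c i) ^ 2 :=
        isMinOn_iff.1 hw (w + τ • v) (Set.mem_univ _)
      have h2 : ∑ i ∈ s, (f i (w + τ • v) - c i) ^ 2 = ∑ i ∈ s, (f i w - c i) ^ 2 +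
          2 * τ * ∑ i ∈ s, (f i w - c i) * f i v + τ ^ 2 * ∑ i ∈ s, (f i v) ^ 2 := by
        rw [Finset.mul_sum, Finset.mul_sum, ← Finset.sum_add_distrib, ← Finset.sum_add_distrib]
        refine Finset.sum_congr rfl fun i _ => ?_
        rw [map_add, map_smul, smul_eq_mul]; ring
      nlinarith)
  rw [discrim] at h
  nlinarith [sq_nonneg (∑ i ∈ s, (f i w - c i) * f i v)]

end LinearAlgebra

/-! ### Small-ball and tail estimates for Gaussian targets -/

section Gaussian

/-- The probability that a standard Gaussian has absolute value less than `c`. -/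
noncomputable def gaussBall (c : ℝ) : ℝ := (gaussianReal 0 1).real {x | |x| < c}

theorem gaussBall_nonneg (c : ℝ) : 0 ≤ gaussBall c := measureReal_nonneg

theorem gaussBall_le_integral {c : ℝ} (hc : 0 ≤ c) {f : ℝ → ℝ} (hf : Continuous f)
    (h : ∀ x, Real.exp (-x ^ 2 / 2) ≤ f x) :
    gaussBall c ≤ (√(2 * Real.pi))⁻¹ * ∫ x in (-c)..c, f x := by
  have hset : {x : ℝ | |x| < c} = Set.Ioo (-c) c := by ext x; simp [abs_lt]
  rw [gaussBall, hset, measureReal_def, gaussianReal_apply_eq_integral _ one_ne_zero,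
    ENNReal.toReal_ofReal (integral_nonneg fun x => gaussianPDFReal_nonneg _ _ _),
    ← integral_Ioc_eq_integral_Ioo, ← intervalIntegral.integral_of_le (by linarith),
    ← intervalIntegral.integral_const_mul]
  refine intervalIntegral.integral_mono_on (by linarith)
    (integrable_gaussianPDFReal 0 1).intervalIntegrable
    ((continuous_const.mul hf).intervalIntegrable _ _) fun x _ => ?_
  have := h x
  rw [gaussianPDFReal]
  simp only [NNReal.coe_one, mul_one, sub_zero]
  gcongr

theorem inv_sqrt_two_pi_le : (√(2 * Real.pi))⁻¹ ≤ 0.39895 := by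
  have h : (2.5066 : ℝ) ≤ √(2 * Real.pi) := by
    apply Real.le_sqrt_of_sq_le
    nlinarith [Real.pi_gt_d6]
  calc (√(2 * Real.pi))⁻¹ ≤ (2.5066 : ℝ)⁻¹ := by gcongr
    _ ≤ _ := by norm_num

theorem gaussBall_le_self {c : ℝ} (hc : 0 ≤ c) : gaussBall c ≤ c := by
  refine (gaussBall_le_integral hc (f := fun _ => 1) continuous_const fun x => ?_).trans ?_
  · rw [Real.exp_le_one_iff]; nlinarith [sq_nonneg x]
  · rw [intervalIntegral.integral_const]
    simp only [smul_eq_mul, mul_one]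
    nlinarith [inv_sqrt_two_pi_le]

theorem exp_neg_half_sq_le (x : ℝ) : Real.exp (-x ^ 2 / 2) ≤ 1 - x ^ 2 / 2 + x ^ 4 / 8 := by
  have key : ∀ y : ℝ, 0 ≤ y → Real.exp (-y) ≤ 1 - y + y ^ 2 / 2 := by
    intro y hy
    have h := Real.quadratic_le_exp_of_nonneg hy
    -- The product exceeds 1, so the lower Taylor bound for exp y inverts to an upper bound for
    -- exp(-y).
    have h2 : (1 - y + y ^ 2 / 2) * (1 + y + y ^ 2 / 2) = 1 + y ^ 4 / 4 := by ring
    have h3 : 0 < 1 - y + y ^ 2 / 2 := by nlinarith [sq_nonneg (y - 1)]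
    rw [Real.exp_neg, inv_le_comm₀ (Real.exp_pos y) h3]
    refine le_trans ?_ h
    rw [inv_le_iff_one_le_mul₀' h3, h2]
    nlinarith [pow_nonneg hy 4]
  have := key (x ^ 2 / 2) (by positivity)
  calc Real.exp (-x ^ 2 / 2) = Real.exp (-(x ^ 2 / 2)) := by ring_nf
    _ ≤ _ := this
    _ = _ := by ring

theorem gaussBall_le {c : ℝ} (hc : 0 ≤ c) :
    gaussBall c ≤ 0.7979 * (c - c ^ 3 / 6 + c ^ 5 / 40) := by
  refine (gaussBall_le_integral hc (f := fun x => 1 - x ^ 2 / 2 + x ^ 4 / 8) (by fun_prop)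
    exp_neg_half_sq_le).trans ?_
  have h : ∫ x in (-c)..c, (1 - x ^ 2 / 2 + x ^ 4 / 8) = 2 * (c - c ^ 3 / 6 + c ^ 5 / 40) := by
    rw [intervalIntegral.integral_add (Continuous.intervalIntegrable (by fun_prop) _ _)
      (Continuous.intervalIntegrable (by fun_prop) _ _),
      intervalIntegral.integral_sub (Continuous.intervalIntegrable (by fun_prop) _ _)
      (Continuous.intervalIntegrable (by fun_prop) _ _)]
    simp only [intervalIntegral.integral_div, integral_pow, intervalIntegral.integral_const]
    simp
    ring
  have hnn : 0 ≤ c - c ^ 3 / 6 + c ^ 5 / 40 := by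
    have : c - c ^ 3 / 6 + c ^ 5 / 40 = c * (1 - c ^ 2 / 6 + c ^ 4 / 40) := by ring
    rw [this]
    have : 0 ≤ 1 - c ^ 2 / 6 + c ^ 4 / 40 := by nlinarith [sq_nonneg (c ^ 2 - 10 / 3)]
    positivity
  rw [h]
  nlinarith [inv_sqrt_two_pi_le]

theorem gaussianReal_abs_ge_le {c : ℝ} (hc : 0 ≤ c) :
    (gaussianReal 0 1).real {x | c ≤ |x|} ≤ 2 * Real.exp (-c ^ 2 / 2) := by
  have h1 := measure_ge_le_exp_mul_mgf (μ := gaussianReal 0 1) (X := id) c hc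
    (by simpa using integrable_exp_mul_gaussianReal c)
  have h2 := measure_le_le_exp_mul_mgf (μ := gaussianReal 0 1) (X := id) (-c) (t := -c)
    (by linarith) (by simpa using integrable_exp_mul_gaussianReal (-c))
  rw [mgf_id_gaussianReal] at h1 h2
  have e : ∀ a : ℝ, Real.exp (-a * a) * Real.exp (0 * a + (1 : NNReal) * a ^ 2 / 2) =
      Real.exp (-a ^ 2 / 2) := by
    intro a; rw [← Real.exp_add]; congr 1; simp; ring
  have hset : {x : ℝ | c ≤ |x|} ⊆ {x | c ≤ id x} ∪ {x | id x ≤ -c} := by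
    intro x hx
    rcases le_abs.1 (show c ≤ |x| from hx) with h | h
    · exact Or.inl h
    · exact Or.inr (by simp only [Set.mem_ofPred_eq, id]; linarith)
  calc _ ≤ (gaussianReal 0 1).real ({x | c ≤ id x} ∪ {x | id x ≤ -c}) := measureReal_mono hset
    _ ≤ _ := measureReal_union_le _ _
    _ ≤ Real.exp (-c ^ 2 / 2) + Real.exp (-c ^ 2 / 2) := by
        refine add_le_add (h1.trans_eq (e c)) (h2.trans_eq ?_)
        rw [e (-c)]; simp
    _ = _ := by ring

variable {Ω ι : Type*} [MeasurableSpace Ω] {P : Measure Ω}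

theorem map_sum_mul_eq_gaussianReal [IsProbabilityMeasure P] {y : ι → Ω → ℝ}
    (hy : iIndepFun y P) (hm : ∀ i, Measurable (y i)) (hlaw : ∀ i, P.map (y i) = gaussianReal 0 1)
    (s : Finset ι) (c : ι → ℝ) :
    P.map (fun ω => ∑ i ∈ s, c i * y i ω) = gaussianReal 0 (∑ i ∈ s, c i ^ 2).toNNReal := by
  classical
  induction s using Finset.induction_on with
  | empty => simp [gaussianReal_zero_var, Measure.map_const]
  | insert i s hi ih =>
    have hind : iIndepFun (fun i ω => c i * y i ω) P :=
      hy.comp (fun i x => c i * x) fun i => measurable_const_mul _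
    have hmeas : ∀ i, Measurable (fun ω => c i * y i ω) := fun i => (hm i).const_mul _
    have h1 := (hind.indepFun_finsetSum_of_notMem hmeas hi).symm
    have h2 : P.map (fun ω => c i * y i ω) = gaussianReal 0 (c i ^ 2).toNNReal := by
      have := gaussianReal_const_mul ⟨(hm i).aemeasurable, hlaw i⟩ (c i)
      have h3 := this.map_eq
      rw [mul_zero, mul_one] at h3
      rw [h3]
      congr 1
      ext
      simp [sq_nonneg]
    have h4 : (∑ i ∈ s, fun ω => c i * y i ω) = fun ω => ∑ i ∈ s, c i * y i ω := by
      ext ω; simp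
    rw [h4] at h1
    have h5 := gaussianReal_add_gaussianReal_of_indepFun h1 h2 ih
    rw [Finset.sum_insert hi, Real.toNNReal_add (sq_nonneg _)
      (Finset.sum_nonneg fun _ _ => sq_nonneg _), ← add_zero (0 : ℝ), ← h5]
    congr 1
    ext ω
    simp [Finset.sum_insert hi]

theorem measureReal_abs_sum_eq [IsProbabilityMeasure P] {y : ι → Ω → ℝ}
    (hy : iIndepFun y P) (hm : ∀ i, Measurable (y i)) (hlaw : ∀ i, P.map (y i) = gaussianReal 0 1)
    (s : Finset ι) (c : ι → ℝ) (hc : 0 < ∑ i ∈ s, c i ^ 2) {S : Set ℝ} (hS : MeasurableSet S) :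
    P.real {ω | |∑ i ∈ s, c i * y i ω| / √(∑ i ∈ s, c i ^ 2) ∈ S} =
      (gaussianReal 0 1).real {x | |x| ∈ S} := by
  set v := ∑ i ∈ s, c i ^ 2
  have hX : Measurable (fun ω => ∑ i ∈ s, c i * y i ω) :=
    Finset.measurable_sum _ fun i _ => (hm i).const_mul _
  have h := gaussianReal_div_const (P := P)
    ⟨hX.aemeasurable, map_sum_mul_eq_gaussianReal hy hm hlaw s c⟩ √v
  have h2 := h.map_eq
  have h3 : NNReal.mk (√v ^ 2) (sq_nonneg _) = v.toNNReal := by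
    ext
    rw [NNReal.coe_mk, Real.sq_sqrt hc.le, Real.coe_toNNReal _ hc.le]
  rw [zero_div, h3, div_self (Real.toNNReal_pos.2 hc).ne'] at h2
  rw [← h2, map_measureReal_apply (hX.div_const _) (show MeasurableSet {x : ℝ | |x| ∈ S} from
    measurable_norm hS)]
  congr 1
  ext ω
  simp [abs_div, abs_of_nonneg (Real.sqrt_nonneg v)]

/-- Each member's sum is a centred Gaussian with standard deviation √(∑ c²), and different members
use disjoint groups of independent targets. -/
theorem measureReal_forall_abs_sum_lt [IsProbabilityMeasure P] {M : ℕ} {y : Fin M → ι → Ω → ℝ}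
    (hy : iIndepFun (fun p : Fin M × ι => y p.1 p.2) P) (hm : ∀ j i, Measurable (y j i))
    (hlaw : ∀ j i, P.map (y j i) = gaussianReal 0 1)
    (s : Finset ι) (c : ι → ℝ) (hc : 0 < ∑ i ∈ s, c i ^ 2) (r : ℝ) :
    P.real {ω | ∀ j, |∑ i ∈ s, c i * y j i ω| < r * √(∑ i ∈ s, c i ^ 2)} = gaussBall r ^ M := by
  classical
  set v := ∑ i ∈ s, c i ^ 2
  have hsq : 0 < √v := Real.sqrt_pos.2 hc
  let E : Fin M → Set Ω := fun j => {ω | |∑ i ∈ s, c i * y j i ω| < r * √v}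
  have hE : ∀ j, P.real (E j) = gaussBall r := by
    intro j
    have hyj : iIndepFun (y j) P := hy.precomp (g := fun i => (j, i)) fun a b h => by simpa using h
    have := measureReal_abs_sum_eq hyj (hm j) (hlaw j) s c hc (measurableSet_Iio (a := r))
    rw [gaussBall]
    change _ = (gaussianReal 0 1).real {x | |x| ∈ Set.Iio r}
    rw [← this]
    congr 1
    ext ω
    simp only [Set.mem_Iio, E, Set.mem_ofPred_eq]
    exact (div_lt_iff₀ hsq).symm
  have hEm : ∀ j, ∀ S : Set (Fin M × ι), (∀ i, (j, i) ∈ S) →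
      MeasurableSet[⨆ p ∈ S, MeasurableSpace.comap (y p.1 p.2) inferInstance] (E j) := by
    intro j S hS
    have h : Measurable[⨆ p ∈ S, MeasurableSpace.comap (y p.1 p.2) inferInstance]
        (fun ω => |∑ i ∈ s, c i * y j i ω|) := by
      refine measurable_norm.comp (f := fun ω => ∑ i ∈ s, c i * y j i ω) (Finset.measurable_sum _ fun i _ => Measurable.const_mul ?_ _)
      exact (comap_measurable (y j i)).mono
        (le_iSup₂_of_le (f := fun (p : Fin M × ι) (_ : p ∈ S) =>
          MeasurableSpace.comap (y p.1 p.2) inferInstance) (j, i) (hS i) le_rfl) le_rfl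
    exact h measurableSet_Iio
  -- Disjoint groups of an independent family generate independent σ-algebras, so each induction
  -- step splits off one factor.
  have main : ∀ t : Finset (Fin M), P.real {ω | ∀ j ∈ t, ω ∈ E j} = gaussBall r ^ t.card := by
    intro t
    induction t using Finset.induction_on with
    | empty => simp
    | insert j t hj ih =>
      have hind := indep_iSup_of_disjoint (S := {p : Fin M × ι | p.1 ∈ t}) (T := {p | p.1 = j})
        (m := fun p : Fin M × ι => MeasurableSpace.comap (y p.1 p.2) inferInstance)
        (fun p => (hm p.1 p.2).comap_le) hy.iIndep
        (Set.disjoint_left.2 fun p hp hp' => hj (by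
          simp only [Set.mem_ofPred_eq] at hp hp'; rwa [← hp']))
      have h1 := (Indep_iff _ _ _).1 hind {ω | ∀ j ∈ t, ω ∈ E j} (E j) (by
          have : {ω | ∀ j ∈ t, ω ∈ E j} = ⋂ j ∈ t, E j := by ext; simp
          rw [this]
          exact Finset.measurableSet_biInter _ fun j hj => hEm j _ fun i => hj)
        (hEm j _ fun i => rfl)
      have h2 : {ω | ∀ j' ∈ insert j t, ω ∈ E j'} = {ω | ∀ j ∈ t, ω ∈ E j} ∩ E j := by
        ext ω; simp [and_comm]
      rw [h2, measureReal_def, h1, ENNReal.toReal_mul, ← measureReal_def, ← measureReal_def, ih,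
        hE, Finset.card_insert_of_notMem hj, pow_succ]
  simpa [E] using main Finset.univ

end Gaussian

/-! ### Measurability of matrix expressions -/

section Measurability

variable {Ω : Type*} {m : MeasurableSpace Ω} {d : ℕ}

theorem measurable_det_of_entries {A : Ω → Matrix (Fin d) (Fin d) ℝ}
    (h : ∀ i j, Measurable[m] fun ω => A ω i j) : Measurable[m] fun ω => (A ω).det := by
  simp only [Matrix.det_apply']
  exact Finset.measurable_sum _ fun p _ =>
    Measurable.const_mul (Finset.measurable_prod _ fun i _ => h _ _) _

theorem measurable_inv_entry {A : Ω → Matrix (Fin d) (Fin d) ℝ}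
    (h : ∀ i j, Measurable[m] fun ω => A ω i j) (i j : Fin d) :
    Measurable[m] fun ω => (A ω)⁻¹ i j := by
  simp only [Matrix.inv_def, Ring.inverse_eq_inv', Matrix.smul_apply, smul_eq_mul,
    Matrix.adjugate_apply]
  refine (measurable_det_of_entries h).inv.mul (measurable_det_of_entries fun k l => ?_)
  simp only [Matrix.updateRow_apply]
  split_ifs
  · exact measurable_const
  · exact h k l

theorem measurable_dotProduct_of_entries {v w : Ω → Fin d → ℝ}
    (hv : ∀ i, Measurable[m] fun ω => v ω i) (hw : ∀ i, Measurable[m] fun ω => w ω i) :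
    Measurable[m] fun ω => v ω ⬝ᵥ w ω :=
  Finset.measurable_sum _ fun i _ => (hv i).mul (hw i)

theorem measurable_designMatrix_entry (lam : ℝ) {a : ℕ → Ω → Fin d → ℝ} {t : ℕ}
    (ha : ∀ i ∈ Finset.Ico 1 t, ∀ k, Measurable[m] fun ω => a i ω k) (k l : Fin d) :
    Measurable[m] fun ω => designMatrix lam (fun i => a i ω) t k l := by
  simp only [designMatrix, Matrix.add_apply, Matrix.sum_apply, vecMulVec_apply]
  exact Measurable.const_add (Finset.measurable_sum _ fun i hi => (ha i hi k).mul (ha i hi l)) _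

theorem measurable_inv_mulVec_entry {A : Ω → Matrix (Fin d) (Fin d) ℝ} {v : Ω → Fin d → ℝ}
    (hA : ∀ i j, Measurable[m] fun ω => A ω i j) (hv : ∀ i, Measurable[m] fun ω => v ω i)
    (i : Fin d) : Measurable[m] fun ω => ((A ω)⁻¹ *ᵥ v ω) i :=
  measurable_dotProduct_of_entries (fun j => measurable_inv_entry hA i j) hv

theorem measurable_invNormSq {A : Ω → Matrix (Fin d) (Fin d) ℝ} {v : Ω → Fin d → ℝ}
    (hA : ∀ i j, Measurable[m] fun ω => A ω i j) (hv : ∀ i, Measurable[m] fun ω => v ω i) :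
    Measurable[m] fun ω => invNormSq (A ω) (v ω) :=
  measurable_dotProduct_of_entries hv (measurable_inv_mulVec_entry hA hv)

end Measurability

/-! ### Conditionally subgaussian noise with predictable multipliers -/

section Subgaussian

theorem exists_seq_measurable_finite_range {Ω : Type*} {m : MeasurableSpace Ω} {η : Ω → ℝ}
    (hη : Measurable η) :
    ∃ fs : ℕ → Ω → ℝ, (∀ n, Measurable (fs n)) ∧ (∀ n, (Set.range (fs n)).Finite) ∧
      ∀ ω, Filter.Tendsto (fun n => fs n ω) Filter.atTop (nhds (η ω)) :=
  ⟨fun n => hη.stronglyMeasurable.approx n, fun _ => SimpleFunc.measurable _,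
    fun _ => SimpleFunc.finite_range _, fun ω => hη.stronglyMeasurable.tendsto_approx ω⟩

variable {Ω : Type*} {m : MeasurableSpace Ω} [mΩ : MeasurableSpace Ω] {P : Measure Ω}
  [IsProbabilityMeasure P] {X : Ω → ℝ} {σ : ℝ}

theorem CondSubgaussian.setLIntegral_exp_le (hX : CondSubgaussian P m X σ) (hm : m ≤ mΩ) (s : ℝ)
    {G : Set Ω} (hG : MeasurableSet[m] G) :
    ∫⁻ ω in G, ENNReal.ofReal (Real.exp (s * X ω - s ^ 2 * σ ^ 2 / 2)) ∂P ≤ P G := by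
  have hint := hX.1 s
  have h1 : ∫ ω in G, Real.exp (s * X ω) ∂P ≤ Real.exp (s ^ 2 * σ ^ 2 / 2) * P.real G := by
    rw [← setIntegral_condExp hm hint hG]
    calc _ ≤ ∫ ω in G, Real.exp (s ^ 2 * σ ^ 2 / 2) ∂P :=
          setIntegral_mono_ae integrable_condExp.integrableOn (integrable_const _).integrableOn
            (hX.2 s)
      _ = _ := by simp [mul_comm]
  have h2 : ∀ ω, Real.exp (s * X ω - s ^ 2 * σ ^ 2 / 2) =
      Real.exp (-(s ^ 2 * σ ^ 2 / 2)) * Real.exp (s * X ω) := fun ω => by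
    rw [← Real.exp_add]; ring_nf
  simp only [h2]
  rw [← ofReal_integral_eq_lintegral_ofReal (hint.const_mul _).integrableOn
    (Filter.Eventually.of_forall fun ω => by positivity), integral_const_mul, ← ofReal_measureReal]
  refine ENNReal.ofReal_le_ofReal ?_
  calc _ ≤ Real.exp (-(s ^ 2 * σ ^ 2 / 2)) * (Real.exp (s ^ 2 * σ ^ 2 / 2) * P.real G) := by gcongr
    _ = _ := by rw [← mul_assoc, ← Real.exp_add]; simp

/-- On `m` the measure with density exp(sX - s²σ²/2) is dominated by `P`; domination on sets passes
to integrals of nonnegative `m`-measurable functions. -/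
theorem CondSubgaussian.lintegral_mul_exp_const_le (hX : CondSubgaussian P m X σ) (hm : m ≤ mΩ)
    (hXm : Measurable X) (s : ℝ) {g : Ω → ENNReal} (hg : Measurable[m] g) :
    ∫⁻ ω, g ω * ENNReal.ofReal (Real.exp (s * X ω - s ^ 2 * σ ^ 2 / 2)) ∂P ≤ ∫⁻ ω, g ω ∂P := by
  set f : Ω → ENNReal := fun ω => ENNReal.ofReal (Real.exp (s * X ω - s ^ 2 * σ ^ 2 / 2))
  have hf : Measurable f := by fun_prop
  have hle : (P.withDensity f).trim hm ≤ P.trim hm := by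
    refine Measure.le_iff.2 fun G hG => ?_
    rw [trim_measurableSet_eq hm hG, trim_measurableSet_eq hm hG, withDensity_apply _ (hm _ hG)]
    exact hX.setLIntegral_exp_le hm s hG
  calc ∫⁻ ω, g ω * f ω ∂P = ∫⁻ ω, g ω ∂(P.withDensity f) := by
        rw [lintegral_withDensity_eq_lintegral_mul _ hf (hg.mono hm le_rfl)]
        simp [mul_comm]
    _ = ∫⁻ ω, g ω ∂((P.withDensity f).trim hm) := (lintegral_trim hm hg).symm
    _ ≤ ∫⁻ ω, g ω ∂(P.trim hm) := lintegral_mono' hle le_rfl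
    _ = _ := lintegral_trim hm hg

/-- A multiplier with finitely many values is constant on each of finitely many events of `m`, which
can be absorbed into `g`. -/
theorem CondSubgaussian.lintegral_mul_exp_finite_le (hX : CondSubgaussian P m X σ) (hm : m ≤ mΩ)
    (hXm : Measurable X) {f : Ω → ℝ} (hf : Measurable[m] f) (hfin : (Set.range f).Finite)
    {g : Ω → ENNReal} (hg : Measurable[m] g) :
    ∫⁻ ω, g ω * ENNReal.ofReal (Real.exp (f ω * X ω - f ω ^ 2 * σ ^ 2 / 2)) ∂P
      ≤ ∫⁻ ω, g ω ∂P := by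
  have hgm : ∀ v, Measurable[m] ((f ⁻¹' {v}).indicator g) := fun v =>
    hg.indicator (hf (measurableSet_singleton v))
  have hmem : ∀ ω, f ω ∈ hfin.toFinset := fun ω => by simp
  have hother : ∀ ω v, v ≠ f ω → (f ⁻¹' {v}).indicator g ω = 0 := fun ω v hv =>
    Set.indicator_of_notMem (fun h => hv (by simpa using h.symm)) _
  calc _ = ∫⁻ ω, ∑ v ∈ hfin.toFinset, (f ⁻¹' {v}).indicator g ω *
        ENNReal.ofReal (Real.exp (v * X ω - v ^ 2 * σ ^ 2 / 2)) ∂P := by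
        refine lintegral_congr fun ω => ?_
        rw [Finset.sum_eq_single_of_mem (f ω) (hmem ω) fun v _ hv => by rw [hother ω v hv, zero_mul]]
        simp
    _ = ∑ v ∈ hfin.toFinset, ∫⁻ ω, (f ⁻¹' {v}).indicator g ω *
        ENNReal.ofReal (Real.exp (v * X ω - v ^ 2 * σ ^ 2 / 2)) ∂P := by
        refine lintegral_finsetSum _ fun v _ => ((hgm v).mono hm le_rfl).mul (by fun_prop)
    _ ≤ ∑ v ∈ hfin.toFinset, ∫⁻ ω, (f ⁻¹' {v}).indicator g ω ∂P :=
        Finset.sum_le_sum fun v _ => hX.lintegral_mul_exp_const_le hm hXm v (hgm v)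
    _ = ∫⁻ ω, ∑ v ∈ hfin.toFinset, (f ⁻¹' {v}).indicator g ω ∂P :=
        (lintegral_finsetSum _ fun v _ => (hgm v).mono hm le_rfl).symm
    _ = _ := by
        refine lintegral_congr fun ω => ?_
        rw [Finset.sum_eq_single_of_mem (f ω) (hmem ω) fun v _ hv => hother ω v hv]
        simp

/-- Fatou's lemma passes from finite-valued approximations of the multiplier to the general case. -/
theorem CondSubgaussian.lintegral_mul_exp_le (hX : CondSubgaussian P m X σ) (hm : m ≤ mΩ)
    (hXm : Measurable X) {η : Ω → ℝ} (hη : Measurable[m] η) {g : Ω → ENNReal}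
    (hg : Measurable[m] g) :
    ∫⁻ ω, g ω * ENNReal.ofReal (Real.exp (η ω * X ω - η ω ^ 2 * σ ^ 2 / 2)) ∂P
      ≤ ∫⁻ ω, g ω ∂P := by
  obtain ⟨fs, hfs, hfin, hfl⟩ := exists_seq_measurable_finite_range hη
  have hlim : ∀ ω, Filter.Tendsto (fun n => g ω * ENNReal.ofReal
      (Real.exp (fs n ω * X ω - fs n ω ^ 2 * σ ^ 2 / 2))) Filter.atTop
      (nhds (g ω * ENNReal.ofReal (Real.exp (η ω * X ω - η ω ^ 2 * σ ^ 2 / 2)))) := by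
    intro ω
    have hc : Continuous fun y : ℝ => ENNReal.ofReal (Real.exp (y * X ω - y ^ 2 * σ ^ 2 / 2)) :=
      ENNReal.continuous_ofReal.comp (by fun_prop)
    exact ENNReal.Tendsto.const_mul ((hc.tendsto _).comp (hfl ω))
      (Or.inl (by simp [Real.exp_pos]))
  calc _ = ∫⁻ ω, Filter.liminf (fun n => g ω * ENNReal.ofReal
      (Real.exp (fs n ω * X ω - fs n ω ^ 2 * σ ^ 2 / 2))) Filter.atTop ∂P :=
        lintegral_congr fun ω => (hlim ω).liminf_eq.symm
    _ ≤ Filter.liminf (fun n => ∫⁻ ω, g ω * ENNReal.ofReal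
      (Real.exp (fs n ω * X ω - fs n ω ^ 2 * σ ^ 2 / 2)) ∂P) Filter.atTop :=
        lintegral_liminf_le fun n => by
          have hn : Measurable (fs n) := (hfs n).mono hm le_rfl
          have hg' : Measurable g := hg.mono hm le_rfl
          fun_prop
    _ ≤ _ := Filter.liminf_le_of_le (by isBoundedDefault) fun b hb => by
        obtain ⟨n, hn⟩ := hb.exists
        exact hn.trans (hX.lintegral_mul_exp_finite_le hm hXm (hfs n) (hfin n) hg)

/-- Completing the square turns the integrand into a constant times the density of a Gaussian with
variance 1 / (1 + u). -/
theorem lintegral_gaussianReal_exp_quadratic {u : ℝ} (hu : 0 ≤ u) (h e : ℝ) :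
    ∫⁻ ξ, ENNReal.ofReal (Real.exp ((h + √u * ξ) * e - (h + √u * ξ) ^ 2 / 2)) ∂(gaussianReal 0 1) =
      ENNReal.ofReal ((√(1 + u))⁻¹ *
        Real.exp ((2 * h * e + u * e ^ 2 - h ^ 2) / (2 * (1 + u)))) := by
  have hu1 : 0 < 1 + u := by linarith
  set v : NNReal := ⟨(1 + u)⁻¹, by positivity⟩ with hv
  have hvr : (v : ℝ) = (1 + u)⁻¹ := rfl
  have hv0 : v ≠ 0 := fun h0 => by
    have : (v : ℝ) = 0 := by rw [h0]; rfl
    rw [hvr] at this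
    exact (inv_pos.2 hu1).ne' this
  set μ := √u * (e - h) / (1 + u) with hμ
  have hsq : √u ^ 2 = u := Real.sq_sqrt hu
  have key : ∀ ξ, gaussianPDFReal 0 1 ξ *
      Real.exp ((h + √u * ξ) * e - (h + √u * ξ) ^ 2 / 2) =
      ((√(1 + u))⁻¹ * Real.exp ((2 * h * e + u * e ^ 2 - h ^ 2) / (2 * (1 + u)))) *
        gaussianPDFReal μ v ξ := by
    intro ξ
    rw [gaussianPDFReal, gaussianPDFReal, hvr]
    have e1 : √(2 * Real.pi * (1 + u)⁻¹) = √(2 * Real.pi) * (√(1 + u))⁻¹ := by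
      rw [Real.sqrt_mul (by positivity), Real.sqrt_inv]
    have hs : √(1 + u) ≠ 0 := (Real.sqrt_pos.2 hu1).ne'
    rw [e1, mul_inv, inv_inv]
    have e2 : Real.exp (-(ξ - 0) ^ 2 / (2 * ((1 : NNReal) : ℝ))) *
        Real.exp ((h + √u * ξ) * e - (h + √u * ξ) ^ 2 / 2) =
        Real.exp ((2 * h * e + u * e ^ 2 - h ^ 2) / (2 * (1 + u))) *
          Real.exp (-(ξ - μ) ^ 2 / (2 * (1 + u)⁻¹)) := by
      rw [← Real.exp_add, ← Real.exp_add]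
      congr 1
      rw [hμ]
      simp only [NNReal.coe_one]
      field_simp
      ring_nf
      rw [hsq]
      ring
    simp only [NNReal.coe_one, mul_one] at e2 ⊢
    calc _ = (√(2 * Real.pi))⁻¹ * (Real.exp (-(ξ - 0) ^ 2 / 2) *
        Real.exp ((h + √u * ξ) * e - (h + √u * ξ) ^ 2 / 2)) := by ring
      _ = _ := by rw [e2]; field_simp
  rw [gaussianReal_of_var_ne_zero _ one_ne_zero, lintegral_withDensity_eq_lintegral_mul _
    (measurable_gaussianPDF 0 1) (by fun_prop)]
  calc _ = ∫⁻ ξ, ENNReal.ofReal ((√(1 + u))⁻¹ *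
        Real.exp ((2 * h * e + u * e ^ 2 - h ^ 2) / (2 * (1 + u)))) * gaussianPDF μ v ξ := by
        refine lintegral_congr fun ξ => ?_
        rw [Pi.mul_apply, gaussianPDF, gaussianPDF, ← ENNReal.ofReal_mul
          (gaussianPDFReal_nonneg _ _ _), ← ENNReal.ofReal_mul (by positivity), key]
    _ = _ := by
        rw [lintegral_const_mul _ (measurable_gaussianPDF _ _), lintegral_gaussianPDF_eq_one _ hv0,
          mul_one]

/-- One step of the method of mixtures: the multiplier (h + √u ξ)/σ is averaged over a standard
Gaussian ξ. The mixture is only one-dimensional, because a single new direction matters per round.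
-/
theorem CondSubgaussian.lintegral_mul_exp_quadratic_le (hσ : 0 < σ) (hX : CondSubgaussian P m X σ)
    (hm : m ≤ mΩ) (hXm : Measurable X) {h u : Ω → ℝ} (hh : Measurable[m] h)
    (hum : Measurable[m] u) (hu : ∀ ω, 0 ≤ u ω) {g : Ω → ENNReal} (hg : Measurable[m] g) :
    ∫⁻ ω, g ω * ENNReal.ofReal ((√(1 + u ω))⁻¹ * Real.exp
      ((2 * h ω * (X ω / σ) + u ω * (X ω / σ) ^ 2 - h ω ^ 2) / (2 * (1 + u ω)))) ∂P
      ≤ ∫⁻ ω, g ω ∂P := by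
  have hh' : Measurable h := hh.mono hm le_rfl
  have hum' : Measurable u := hum.mono hm le_rfl
  have hg' : Measurable g := hg.mono hm le_rfl
  calc _ = ∫⁻ ω, ∫⁻ ξ, g ω * ENNReal.ofReal (Real.exp ((h ω + √(u ω) * ξ) * (X ω / σ) -
        (h ω + √(u ω) * ξ) ^ 2 / 2)) ∂(gaussianReal 0 1) ∂P := by
        refine lintegral_congr fun ω => ?_
        rw [lintegral_const_mul _ (by fun_prop), lintegral_gaussianReal_exp_quadratic (hu ω)]
    _ = ∫⁻ ξ, ∫⁻ ω, g ω * ENNReal.ofReal (Real.exp ((h ω + √(u ω) * ξ) * (X ω / σ) -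
        (h ω + √(u ω) * ξ) ^ 2 / 2)) ∂P ∂(gaussianReal 0 1) := by
        refine lintegral_lintegral_swap (Measurable.aemeasurable ?_)
        fun_prop
    _ ≤ ∫⁻ ξ, ∫⁻ ω, g ω ∂P ∂(gaussianReal 0 1) := by
        refine lintegral_mono fun ξ => ?_
        have hη : Measurable[m] fun ω => (h ω + √(u ω) * ξ) / σ := by fun_prop
        refine le_trans (le_of_eq (lintegral_congr fun ω => ?_))
          (hX.lintegral_mul_exp_le hm hXm hη hg)
        congr 3
        field_simp
    _ = _ := by simp

end Subgaussian

/-! ### Maximal inequality -/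

section Ville

variable {Ω : Type*} [mΩ : MeasurableSpace Ω] {P : Measure Ω}

/-- Ville's maximal inequality for a nonnegative supermartingale over finitely many rounds. -/
theorem mul_measure_exists_ge_le {ℱ : Filtration ℕ mΩ} {Z : ℕ → Ω → ENNReal} {T : ℕ}
    (hT : 1 ≤ T) (hZ : ∀ t ∈ Finset.Icc 1 T, Measurable[ℱ t] (Z t))
    (hstep : ∀ t, 1 ≤ t → t < T → ∀ G, MeasurableSet[ℱ t] G →
      ∫⁻ ω in G, Z (t + 1) ω ∂P ≤ ∫⁻ ω in G, Z t ω ∂P) (c : ENNReal) :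
    c * P {ω | ∃ t ∈ Finset.Icc 1 T, c ≤ Z t ω} ≤ ∫⁻ ω, Z 1 ω ∂P := by
  let A : ℕ → Set Ω := fun n => {ω | ∃ t ∈ Finset.Icc 1 n, c ≤ Z t ω}
  have hge : ∀ n ∈ Finset.Icc 1 T, MeasurableSet[ℱ n] {ω | c ≤ Z n ω} := fun n hn =>
    hZ n hn measurableSet_Ici
  have hA : ∀ n, n ≤ T → MeasurableSet[ℱ n] (A n) := by
    intro n hn
    have : A n = ⋃ t ∈ Finset.Icc 1 n, {ω | c ≤ Z t ω} := by ext; simp [A]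
    rw [this]
    refine Finset.measurableSet_biUnion _ fun t ht => ?_
    rw [Finset.mem_Icc] at ht
    exact ℱ.mono ht.2 _ (hge t (Finset.mem_Icc.2 ⟨ht.1, ht.2.trans hn⟩))
  have markov : ∀ n ∈ Finset.Icc 1 T, ∀ G, MeasurableSet G →
      c * P (G ∩ {ω | c ≤ Z n ω}) + ∫⁻ ω in G ∩ {ω | c ≤ Z n ω}ᶜ, Z n ω ∂P ≤
        ∫⁻ ω in G, Z n ω ∂P := by
    intro n hn G hG
    have hm := ℱ.le n _ (hge n hn)
    rw [← lintegral_inter_add_sdiff (Z n) G hm, ← Set.sdiff_eq]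
    gcongr
    exact (setLIntegral_const (G ∩ {ω | c ≤ Z n ω}) c).symm.trans_le
      (setLIntegral_mono' (hG.inter hm) fun ω hω => hω.2)
  -- This bounds the mean of the stopped process: paths that have reached the level are charged `c`,
  -- the others their current value.
  have main : ∀ n, 1 ≤ n → n ≤ T →
      c * P (A n) + ∫⁻ ω in (A n)ᶜ, Z n ω ∂P ≤ ∫⁻ ω, Z 1 ω ∂P := by
    intro n h1
    induction n, h1 using Nat.le_induction with
    | base =>
      intro h
      have := markov 1 (by simp [h]) Set.univ MeasurableSet.univ
      have e : A 1 = {ω | c ≤ Z 1 ω} := by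
        ext ω
        simp only [A, Finset.Icc_self, Finset.mem_singleton, exists_eq_left, Set.mem_ofPred_eq]
      rw [e]
      simpa using this
    | succ n h1 ih =>
      intro hn
      have ih := ih (by omega)
      have hAn := hA n (by omega)
      have h2 := markov (n + 1) (Finset.mem_Icc.2 ⟨by omega, hn⟩) _ (ℱ.le n _ hAn).compl
      have e1 : A (n + 1) = A n ∪ ((A n)ᶜ ∩ {ω | c ≤ Z (n + 1) ω}) := by
        ext ω
        simp only [A, Set.mem_union, Set.mem_inter_iff, Set.mem_compl_iff, Set.mem_ofPred_eq,
          Finset.mem_Icc]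
        constructor
        · rintro ⟨t, ht, h⟩
          by_cases h' : ∃ t, (1 ≤ t ∧ t ≤ n) ∧ c ≤ Z t ω
          · exact Or.inl h'
          · refine Or.inr ⟨h', ?_⟩
            have : t = n + 1 := by
              by_contra hne
              exact h' ⟨t, ⟨ht.1, by omega⟩, h⟩
            rwa [← this]
        · rintro (⟨t, ht, h⟩ | ⟨-, h⟩)
          · exact ⟨t, ⟨ht.1, by omega⟩, h⟩
          · exact ⟨n + 1, ⟨by omega, le_rfl⟩, h⟩
      have e2 : (A (n + 1))ᶜ = (A n)ᶜ ∩ {ω | c ≤ Z (n + 1) ω}ᶜ := by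
        rw [e1]; ext ω; simp only [Set.mem_compl_iff, Set.mem_union, Set.mem_inter_iff]; tauto
      calc _ ≤ c * (P (A n) + P ((A n)ᶜ ∩ {ω | c ≤ Z (n + 1) ω})) +
            ∫⁻ ω in (A n)ᶜ ∩ {ω | c ≤ Z (n + 1) ω}ᶜ, Z (n + 1) ω ∂P := by
            rw [e2, e1]; gcongr; exact measure_union_le _ _
        _ = c * P (A n) + (c * P ((A n)ᶜ ∩ {ω | c ≤ Z (n + 1) ω}) +
            ∫⁻ ω in (A n)ᶜ ∩ {ω | c ≤ Z (n + 1) ω}ᶜ, Z (n + 1) ω ∂P) := by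
            rw [mul_add, add_assoc]
        _ ≤ c * P (A n) + ∫⁻ ω in (A n)ᶜ, Z n ω ∂P := by
            gcongr
            exact h2.trans (hstep n h1 (by omega) _ hAn.compl)
        _ ≤ _ := ih
  exact le_trans le_self_add (main T hT le_rfl)

end Ville

/-! ### Self-normalized martingale bound -/

section SelfNormalized

variable {Ω : Type*} [mΩ : MeasurableSpace Ω] {P : Measure Ω} [IsProbabilityMeasure P] {d : ℕ}

/-- Sherman–Morrison and the rank-one determinant formula exhibit the one-round factor of the
supermartingale in exactly the form controlled by `CondSubgaussian.lintegral_mul_exp_quadratic_le`.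
-/
theorem invNormSq_succ_div_sub_logDetRatio {V : Matrix (Fin d) (Fin d) ℝ} (hV : V.PosDef)
    {σ : ℝ} (hσ : 0 < σ) (lam : ℝ) (a S : Fin d → ℝ) (ε : ℝ) :
    Real.exp (invNormSq (V + vecMulVec a a) (S + ε • a) / (2 * σ ^ 2) -
        logDetRatio lam (V + vecMulVec a a) / 2) =
      Real.exp (invNormSq V S / (2 * σ ^ 2) - logDetRatio lam V / 2) *
        ((√(1 + invNormSq V a))⁻¹ *
          Real.exp ((2 * (a ⬝ᵥ (V⁻¹ *ᵥ S) / σ) * (ε / σ) + invNormSq V a * (ε / σ) ^ 2 -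
            (a ⬝ᵥ (V⁻¹ *ᵥ S) / σ) ^ 2) / (2 * (1 + invNormSq V a)))) := by
  have hu : 0 < 1 + invNormSq V a := by linarith [invNormSq_nonneg hV a]
  have h1 := logDetRatio_add_smul_vecMulVec lam hV zero_le_one a
  rw [one_smul, one_mul] at h1
  have h2 : (√(1 + invNormSq V a))⁻¹ = Real.exp (-(Real.log (1 + invNormSq V a) / 2)) := by
    rw [Real.exp_neg, Real.exp_half, Real.exp_log hu]
  rw [h1, h2, ← Real.exp_add, ← Real.exp_add, invNormSq_add_vecMulVec hV,
    invNormSq_smul_add hV, mulVec_add, mulVec_smul, dotProduct_add, dotProduct_smul,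
    hV.dotProduct_inv_comm S a, smul_eq_mul, ← invNormSq]
  congr 1
  field_simp
  ring

/-- The self-normalized tail inequality for vector-valued martingales. -/
theorem measure_exists_selfNormalized_le {ℱ : Filtration ℕ mΩ} {m : ℕ → MeasurableSpace Ω}
    {a : ℕ → Ω → Fin d → ℝ} {ε : ℕ → Ω → ℝ} {σ lam c : ℝ} {T : ℕ} (hT : 1 ≤ T) (hσ : 0 < σ)
    (hlam : 0 < lam)
    (hle : ∀ t ∈ Finset.Icc 1 T, ℱ t ≤ m t) (hm : ∀ t ∈ Finset.Icc 1 T, m t ≤ mΩ)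
    (ha : ∀ t ∈ Finset.Icc 1 T, ∀ k, Measurable[m t] fun ω => a t ω k)
    (ha' : ∀ t ∈ Finset.Icc 1 T, ∀ k, Measurable[ℱ (t + 1)] fun ω => a t ω k)
    (hε : ∀ t ∈ Finset.Icc 1 T, Measurable[ℱ (t + 1)] (ε t))
    (hsub : ∀ t ∈ Finset.Icc 1 T, CondSubgaussian P (m t) (ε t) σ) :
    P {ω | ∃ t ∈ Finset.Icc 1 T,
      σ ^ 2 * (logDetRatio lam (designMatrix lam (fun i => a i ω) t) + 2 * c) ≤
        invNormSq (designMatrix lam (fun i => a i ω) t) (∑ i ∈ Finset.Ico 1 t, ε i ω • a i ω)} ≤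
      ENNReal.ofReal (Real.exp (-c)) := by
  let V : ℕ → Ω → Matrix (Fin d) (Fin d) ℝ := fun t ω => designMatrix lam (fun i => a i ω) t
  let S : ℕ → Ω → Fin d → ℝ := fun t ω => ∑ i ∈ Finset.Ico 1 t, ε i ω • a i ω
  let Z : ℕ → Ω → ENNReal := fun t ω => ENNReal.ofReal
    (Real.exp (invNormSq (V t ω) (S t ω) / (2 * σ ^ 2) - logDetRatio lam (V t ω) / 2))
  have hpast : ∀ t ≤ T, ∀ i ∈ Finset.Ico 1 t, ∀ k, Measurable[ℱ t] fun ω => a i ω k := by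
    intro t ht i hi k
    rw [Finset.mem_Ico] at hi
    exact (ha' i (Finset.mem_Icc.2 ⟨hi.1, by omega⟩) k).mono (ℱ.mono (by omega)) le_rfl
  have hVm : ∀ t ≤ T, ∀ k l, Measurable[ℱ t] fun ω => V t ω k l := fun t ht k l =>
    measurable_designMatrix_entry lam (hpast t ht) k l
  have hSm : ∀ t ≤ T, ∀ k, Measurable[ℱ t] fun ω => S t ω k := by
    intro t ht k
    simp only [S, Finset.sum_apply, Pi.smul_apply, smul_eq_mul]
    refine Finset.measurable_sum _ fun i hi => ?_
    refine Measurable.mul ?_ (hpast t ht i hi k)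
    rw [Finset.mem_Ico] at hi
    exact (hε i (Finset.mem_Icc.2 ⟨hi.1, by omega⟩)).mono (ℱ.mono (by omega)) le_rfl
  have hZm : ∀ t ≤ T, Measurable[ℱ t] (Z t) := by
    intro t ht
    refine ENNReal.measurable_ofReal.comp (Real.measurable_exp.comp ?_)
    refine ((measurable_invNormSq (hVm t ht) (hSm t ht)).div_const _).sub (Measurable.div_const ?_ _)
    exact (Real.measurable_log.comp (measurable_det_of_entries (hVm t ht))).sub_const _
  have hstep : ∀ t, 1 ≤ t → t < T → ∀ G, MeasurableSet[ℱ t] G →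
      ∫⁻ ω in G, Z (t + 1) ω ∂P ≤ ∫⁻ ω in G, Z t ω ∂P := by
    intro t h1 htT G hG
    have ht : t ∈ Finset.Icc 1 T := Finset.mem_Icc.2 ⟨h1, htT.le⟩
    have hmt := hle t ht
    have hVt := fun k l => (hVm t htT.le k l).mono hmt le_rfl
    have hSt := fun k => (hSm t htT.le k).mono hmt le_rfl
    -- The current direction is known only given `m t`, while `Z t` is already `ℱ t`-measurable;
    -- hence the step conditions on the larger σ-algebra.
    have hh : Measurable[m t] fun ω => a t ω ⬝ᵥ ((V t ω)⁻¹ *ᵥ S t ω) / σ :=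
      (measurable_dotProduct_of_entries (ha t ht)
        (measurable_inv_mulVec_entry hVt hSt)).div_const _
    have key := (hsub t ht).lintegral_mul_exp_quadratic_le hσ (hm t ht)
      ((hε t ht).mono (ℱ.le _) le_rfl) hh (measurable_invNormSq hVt (ha t ht))
      (fun ω => invNormSq_nonneg (posDef_designMatrix hlam _ _) _)
      (((hZm t htT.le).mono hmt le_rfl).indicator (hmt _ hG))
    rw [← lintegral_indicator (ℱ.le t _ hG), ← lintegral_indicator (ℱ.le t _ hG)]
    refine le_trans (le_of_eq (lintegral_congr fun ω => ?_)) key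
    by_cases hω : ω ∈ G
    · rw [Set.indicator_of_mem hω, Set.indicator_of_mem hω]
      simp only [Z]
      rw [← ENNReal.ofReal_mul (Real.exp_pos _).le, ← invNormSq_succ_div_sub_logDetRatio
        (posDef_designMatrix hlam _ _) hσ]
      simp only [V, S]
      rw [designMatrix_succ lam _ h1, Finset.sum_Ico_succ_top h1]
    · rw [Set.indicator_of_notMem hω, Set.indicator_of_notMem hω, zero_mul]
  have ville := mul_measure_exists_ge_le (P := P) hT
    (fun t ht => hZm t (Finset.mem_Icc.1 ht).2) hstep (ENNReal.ofReal (Real.exp c))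
  have h1 : ∫⁻ ω, Z 1 ω ∂P = 1 := by
    simp [Z, V, S, logDetRatio_designMatrix_one, invNormSq]
  rw [h1] at ville
  have hsub' : {ω | ∃ t ∈ Finset.Icc 1 T, σ ^ 2 * (logDetRatio lam (V t ω) + 2 * c) ≤
      invNormSq (V t ω) (S t ω)} ⊆
      {ω | ∃ t ∈ Finset.Icc 1 T, ENNReal.ofReal (Real.exp c) ≤ Z t ω} := by
    rintro ω ⟨t, ht, h⟩
    refine ⟨t, ht, ENNReal.ofReal_le_ofReal (Real.exp_le_exp.2 ?_)⟩
    have h3 : (logDetRatio lam (V t ω) + 2 * c) / 2 ≤ invNormSq (V t ω) (S t ω) / (2 * σ ^ 2) := by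
      rw [div_le_div_iff₀ (by norm_num) (by positivity)]
      nlinarith
    linarith
  refine (measure_mono hsub').trans ?_
  rw [Real.exp_neg, ENNReal.ofReal_inv_of_pos (Real.exp_pos c)]
  rwa [ENNReal.le_inv_iff_mul_le, mul_comm]

end SelfNormalized

/-! ### Least-squares predictions as linear functions of the targets -/

section LeastSquares

variable {d : ℕ}

theorem EuclideanSpace.inner_eq_dotProduct (v w : EuclideanSpace ℝ (Fin d)) :
    inner ℝ v w = v.ofLp ⬝ᵥ w.ofLp := by
  rw [EuclideanSpace.inner_eq_star_dotProduct, dotProduct_comm]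
  simp

theorem EuclideanSpace.norm_sq_eq_dotProduct (v : EuclideanSpace ℝ (Fin d)) :
    ‖v‖ ^ 2 = v.ofLp ⬝ᵥ v.ofLp := by
  rw [← EuclideanSpace.inner_eq_dotProduct, real_inner_self_eq_norm_sq]

/-- The indices of the targets that enter the least-squares fit at the start of round `t`. -/
def targetIndices (d t : ℕ) : Finset (Fin d ⊕ ℕ) := Finset.univ.disjSum (Finset.Ico 1 t)

/-- The weights of the targets in the least-squares prediction at `v`. -/
noncomputable def targetWeight (lam : ℝ) (a : ℕ → Fin d → ℝ) (t : ℕ) (v : Fin d → ℝ) :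
    Fin d ⊕ ℕ → ℝ :=
  Sum.elim (fun i => √lam * ((designMatrix lam a t)⁻¹ *ᵥ v) i)
    (fun s => a s ⬝ᵥ ((designMatrix lam a t)⁻¹ *ᵥ v))

theorem sum_targetIndices (t : ℕ) (f : Fin d ⊕ ℕ → ℝ) :
    ∑ p ∈ targetIndices d t, f p = ∑ i, f (Sum.inl i) + ∑ s ∈ Finset.Ico 1 t, f (Sum.inr s) := by
  rw [targetIndices, Finset.sum_disjSum]

/-- With u = V⁻¹v the sum is λ|u|² + ∑ ⟨a s, u⟩² = ⟨u, Vu⟩. This identifies the variance of an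
ensemble prediction with the width. -/
theorem sum_targetWeight_sq {lam : ℝ} (hlam : 0 < lam) (a : ℕ → Fin d → ℝ) (t : ℕ)
    (v : Fin d → ℝ) :
    ∑ p ∈ targetIndices d t, targetWeight lam a t v p ^ 2 = invNormSq (designMatrix lam a t) v := by
  have hV := posDef_designMatrix hlam a t
  set u := (designMatrix lam a t)⁻¹ *ᵥ v with hu
  have h := dotProduct_designMatrix_mulVec lam a t u u
  rw [hu, hV.mulVec_inv_mulVec, ← hu] at h
  rw [sum_targetIndices, invNormSq, dotProduct_comm, ← hu, h]
  simp only [targetWeight, Sum.elim_inl, Sum.elim_inr, mul_pow, Real.sq_sqrt hlam.le,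
    ← Finset.mul_sum, ← hu]
  congr 1
  · simp [dotProduct, sq]
  · exact Finset.sum_congr rfl fun i _ => sq _

theorem targetWeight_congr (lam : ℝ) {a a' : ℕ → Fin d → ℝ} {t : ℕ}
    (h : ∀ i ∈ Finset.Ico 1 t, a i = a' i) (v : Fin d → ℝ) {p : Fin d ⊕ ℕ}
    (hp : p ∈ targetIndices d t) : targetWeight lam a t v p = targetWeight lam a' t v p := by
  rcases p with i | s
  · simp only [targetWeight, Sum.elim_inl, designMatrix_congr lam h]
  · have hs : s ∈ Finset.Ico 1 t := by simpa [targetIndices] using hp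
    simp only [targetWeight, Sum.elim_inr, designMatrix_congr lam h, h s hs]

/-- The normal equations, tested against the direction V⁻¹v. -/
theorem dotProduct_eq_of_isMinOn_ensembleLoss {lam : ℝ} (hlam : 0 < lam)
    (a : ℕ → EuclideanSpace ℝ (Fin d)) (t : ℕ) (y : Fin d ⊕ ℕ → ℝ) {w : EuclideanSpace ℝ (Fin d)}
    (hw : IsMinOn (ensembleLoss lam a t y) Set.univ w) (v : Fin d → ℝ) :
    v ⬝ᵥ w.ofLp =
      ∑ p ∈ targetIndices d t, targetWeight lam (fun i => (a i).ofLp) t v p * y p := by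
  set V := designMatrix lam (fun i => (a i).ofLp) t with hVdef
  have hV : V.PosDef := posDef_designMatrix hlam _ t
  let g : Fin d ⊕ ℕ → EuclideanSpace ℝ (Fin d) :=
    Sum.elim (fun i => √lam • EuclideanSpace.single i (1 : ℝ)) a
  have hloss : ensembleLoss lam a t y = fun w => ∑ p ∈ targetIndices d t,
      ((innerₛₗ ℝ (g p)) w - y p) ^ 2 := by
    ext w
    rw [sum_targetIndices]
    rfl
  rw [hloss] at hw
  have h := sum_residual_mul_eq_zero (targetIndices d t) (fun p => innerₛₗ ℝ (g p)) y w hw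
    (WithLp.toLp 2 (V⁻¹ *ᵥ v))
  have hg : ∀ p, innerₛₗ ℝ (g p) (WithLp.toLp 2 (V⁻¹ *ᵥ v)) =
      targetWeight lam (fun i => (a i).ofLp) t v p := by
    rintro (i | s)
    · simp [g, targetWeight, EuclideanSpace.inner_single_left, V]
    · simp [g, targetWeight, EuclideanSpace.inner_eq_dotProduct, V]
  simp only [hg, sub_mul, Finset.sum_sub_distrib] at h
  have h2 : ∑ p ∈ targetIndices d t, innerₛₗ ℝ (g p) w *
      targetWeight lam (fun i => (a i).ofLp) t v p = v ⬝ᵥ w.ofLp := by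
    have h3 := dotProduct_designMatrix_mulVec lam (fun i => (a i).ofLp) t w.ofLp (V⁻¹ *ᵥ v)
    rw [← hVdef, hV.mulVec_inv_mulVec] at h3
    rw [dotProduct_comm, h3, sum_targetIndices]
    congr 1
    · simp only [g, Sum.elim_inl, targetWeight, dotProduct, Finset.mul_sum]
      refine Finset.sum_congr rfl fun i _ => ?_
      simp only [innerₛₗ_apply_apply, inner_smul_left, EuclideanSpace.inner_single_left]
      have := Real.mul_self_sqrt hlam.le
      simp only [map_one, one_mul, conj_trivial, ← hVdef]
      linear_combination (w.ofLp i * (V⁻¹ *ᵥ v) i) * this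
    · refine Finset.sum_congr rfl fun s _ => ?_
      simp [g, targetWeight, EuclideanSpace.inner_eq_dotProduct, V]
  rw [h2] at h
  rw [sub_eq_zero.1 h]
  exact Finset.sum_congr rfl fun p _ => mul_comm _ _

/-- The penalty is the squared loss of the warm-start features with target 0, so ridge regression is
covered by the same formula. -/
theorem ridgeLoss_eq_ensembleLoss {lam : ℝ} (hlam : 0 < lam) (a : ℕ → EuclideanSpace ℝ (Fin d))
    (r : ℕ → ℝ) (t : ℕ) : ridgeLoss lam a r t = ensembleLoss lam a t (Sum.elim 0 r) := by
  ext θ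
  rw [ridgeLoss, ensembleLoss, add_comm]
  congr 1
  simp [inner_smul_left, EuclideanSpace.inner_single_left, mul_pow, Real.sq_sqrt hlam.le,
    ← Finset.mul_sum, EuclideanSpace.norm_sq_eq]

/-- With S = ∑ ε i • a i, the error at v is ⟨v, V⁻¹S⟩ - λ⟨v, V⁻¹θstar⟩; both terms are estimated by
Cauchy–Schwarz in the V⁻¹ norm. -/
theorem abs_dotProduct_ridge_sub_le {lam : ℝ} (hlam : 0 < lam)
    (a : ℕ → EuclideanSpace ℝ (Fin d)) (θstar : EuclideanSpace ℝ (Fin d)) (ε : ℕ → ℝ) (t : ℕ)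
    {θ : EuclideanSpace ℝ (Fin d)}
    (hθ : IsMinOn (ridgeLoss lam a (fun i => inner ℝ (a i) θstar + ε i) t) Set.univ θ)
    (v : Fin d → ℝ) :
    |v ⬝ᵥ θ.ofLp - v ⬝ᵥ θstar.ofLp| ≤
      (√lam * ‖θstar‖ + √(invNormSq (designMatrix lam (fun i => (a i).ofLp) t)
        (∑ i ∈ Finset.Ico 1 t, ε i • (a i).ofLp))) *
      √(invNormSq (designMatrix lam (fun i => (a i).ofLp) t) v) := by
  set V := designMatrix lam (fun i => (a i).ofLp) t with hVdef
  set S := ∑ i ∈ Finset.Ico 1 t, ε i • (a i).ofLp with hS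
  have hV : V.PosDef := posDef_designMatrix hlam _ t
  rw [ridgeLoss_eq_ensembleLoss hlam] at hθ
  have h := dotProduct_eq_of_isMinOn_ensembleLoss hlam a t _ hθ v
  have h3 := dotProduct_designMatrix_mulVec lam (fun i => (a i).ofLp) t θstar.ofLp (V⁻¹ *ᵥ v)
  rw [← hVdef, hV.mulVec_inv_mulVec] at h3
  have h4 : v ⬝ᵥ (V⁻¹ *ᵥ S) = ∑ i ∈ Finset.Ico 1 t, ε i * ((a i).ofLp ⬝ᵥ (V⁻¹ *ᵥ v)) := by
    rw [hV.dotProduct_inv_comm, hS, sum_dotProduct]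
    simp [smul_dotProduct]
  have h5 : v ⬝ᵥ θ.ofLp - v ⬝ᵥ θstar.ofLp =
      v ⬝ᵥ (V⁻¹ *ᵥ S) - lam * (v ⬝ᵥ (V⁻¹ *ᵥ θstar.ofLp)) := by
    rw [h, sum_targetIndices, hV.dotProduct_inv_comm v θstar.ofLp, dotProduct_comm v θstar.ofLp,
      h3, h4]
    simp only [targetWeight, Sum.elim_inl, Sum.elim_inr, Pi.zero_apply, mul_zero,
      Finset.sum_const_zero, zero_add, EuclideanSpace.inner_eq_dotProduct, mul_add,
      Finset.sum_add_distrib, ← hVdef]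
    have e1 : ∑ i ∈ Finset.Ico 1 t, ((a i).ofLp ⬝ᵥ (V⁻¹ *ᵥ v)) * ((a i).ofLp ⬝ᵥ θstar.ofLp) =
        ∑ i ∈ Finset.Ico 1 t, ((a i).ofLp ⬝ᵥ θstar.ofLp) * ((a i).ofLp ⬝ᵥ (V⁻¹ *ᵥ v)) :=
      Finset.sum_congr rfl fun _ _ => mul_comm _ _
    have e2 : ∑ i ∈ Finset.Ico 1 t, ((a i).ofLp ⬝ᵥ (V⁻¹ *ᵥ v)) * ε i =
        ∑ i ∈ Finset.Ico 1 t, ε i * ((a i).ofLp ⬝ᵥ (V⁻¹ *ᵥ v)) :=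
      Finset.sum_congr rfl fun _ _ => mul_comm _ _
    rw [e1, e2]
    ring
  have h6 := abs_dotProduct_inv_le hV v S
  have h7 := abs_dotProduct_inv_le hV v θstar.ofLp
  have h8 : lam * √(invNormSq V θstar.ofLp) ≤ √lam * ‖θstar‖ := by
    have := invNormSq_designMatrix_le hlam (fun i => (a i).ofLp) t θstar.ofLp
    rw [← EuclideanSpace.norm_sq_eq_dotProduct, ← hVdef] at this
    have h9 := Real.sqrt_le_sqrt this
    rw [Real.sqrt_div (sq_nonneg _), Real.sqrt_sq (norm_nonneg _)] at h9
    have hs : 0 < √lam := Real.sqrt_pos.2 hlam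
    calc lam * √(invNormSq V θstar.ofLp) ≤ lam * (‖θstar‖ / √lam) := by gcongr
      _ = √lam * ‖θstar‖ := by
        rw [mul_div_assoc', div_eq_iff hs.ne']
        rw [mul_right_comm, Real.mul_self_sqrt hlam.le]
  rw [h5]
  calc _ ≤ |v ⬝ᵥ (V⁻¹ *ᵥ S)| + |lam * (v ⬝ᵥ (V⁻¹ *ᵥ θstar.ofLp))| := abs_sub _ _
    _ ≤ √(invNormSq V v) * √(invNormSq V S) +
        lam * (√(invNormSq V v) * √(invNormSq V θstar.ofLp)) := by
        rw [abs_mul, abs_of_pos hlam]; gcongr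
    _ = (lam * √(invNormSq V θstar.ofLp) + √(invNormSq V S)) * √(invNormSq V v) := by ring
    _ ≤ _ := by gcongr

end LeastSquares

/-! ### Probabilities of the bad events of a run -/

theorem measurable_coord_comp {Ω : Type*} {m : MeasurableSpace Ω} {d A : ℕ}
    (x : Fin A → EuclideanSpace ℝ (Fin d)) {f : Ω → Fin A} (hf : Measurable f) (k : Fin d) :
    Measurable fun ω => (x (f ω)).ofLp k :=
  (Measurable.of_discrete (f := fun b => (x b).ofLp k)).comp hf

namespace LazyACBRun

variable {Ω : Type*} [mΩ : MeasurableSpace Ω] {P : Measure Ω} {d A : ℕ}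
  {x : Fin A → EuclideanSpace ℝ (Fin d)} {θstar : EuclideanSpace ℝ (Fin d)}
  {σ : ℝ} {M : ℕ} {lam β γ : ℝ} {T : ℕ} (R : LazyACBRun P x θstar σ M lam β γ T)

/-- The regularized design matrix at the start of round `t`. -/
noncomputable def design (t : ℕ) (ω : Ω) : Matrix (Fin d) (Fin d) ℝ :=
  designMatrix lam (fun i => (x (R.act i ω)).ofLp) t

/-- The prediction at `v` of the ensemble member `j` that is fitted to the targets of round `t`. -/
noncomputable def pred (t : ℕ) (j : Fin M) (v : Fin d → ℝ) (ω : Ω) : ℝ :=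
  ∑ p ∈ targetIndices d t,
    targetWeight lam (fun i => (x (R.act i ω)).ofLp) t v p * R.y t j p ω

theorem posDef_design (hlam : 0 < lam) (t : ℕ) (ω : Ω) : (R.design t ω).PosDef :=
  posDef_designMatrix hlam _ t

theorem acbBonus_eq (hlam : 0 < lam) {t : ℕ} (ht : t ∈ Finset.Icc 1 T) {ω : Ω}
    (h0 : R.counter t ω = 0) (b : Fin A) :
    acbBonus β (fun j => R.w t j ω) (x b) = β * ⨆ j, |R.pred t j (x b).ofLp ω| := by
  rw [acbBonus]
  congr 2
  ext j
  rw [EuclideanSpace.inner_eq_dotProduct,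
    dotProduct_eq_of_isMinOn_ensembleLoss hlam _ t _ (R.w_argmin t ht ω h0 j)]
  rfl

theorem targetSigma_le {t : ℕ} (ht : t ∈ Finset.Icc 1 T) : targetSigma (R.y t) ≤ R.ℱ (t + 1) :=
  iSup_le fun j => iSup_le fun i => (R.target_measurable t ht j i).comap_le

theorem sup_targetSigma_le {t : ℕ} (ht : t ∈ Finset.Icc 1 T) :
    R.ℱ t ⊔ targetSigma (R.y t) ≤ R.ℱ (t + 1) :=
  sup_le (R.ℱ.mono t.le_succ) (R.targetSigma_le ht)

theorem measurable_act_of_lt {i t : ℕ} (hi : i ∈ Finset.Icc 1 T) (hit : i < t) :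
    Measurable[R.ℱ t] (R.act i) :=
  ((R.act_measurable i hi).mono (R.sup_targetSigma_le hi) le_rfl).mono (R.ℱ.mono hit) le_rfl

theorem measurable_design {t : ℕ} (ht : t ≤ T + 1) (k l : Fin d) :
    Measurable[R.ℱ t] fun ω => R.design t ω k l := by
  refine measurable_designMatrix_entry lam (a := fun i ω => (x (R.act i ω)).ofLp)
    (fun i hi k => ?_) k l
  rw [Finset.mem_Ico] at hi
  exact measurable_coord_comp x (R.measurable_act_of_lt (Finset.mem_Icc.2 ⟨hi.1, by omega⟩) hi.2) k

theorem measurable_pred {t : ℕ} (ht : t ∈ Finset.Icc 1 T) (j : Fin M) {v : Ω → Fin d → ℝ}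
    (hv : ∀ k, Measurable[R.ℱ (t + 1)] fun ω => v ω k) :
    Measurable[R.ℱ (t + 1)] fun ω => R.pred t j (v ω) ω := by
  have htT := (Finset.mem_Icc.1 ht).2
  refine Finset.measurable_sum _ fun p hp => Measurable.mul ?_ (R.target_measurable t ht j p)
  have hV := fun k l => (R.measurable_design (by omega : t ≤ T + 1) k l).mono
    (R.ℱ.mono t.le_succ) le_rfl
  rcases p with i | s
  · exact (measurable_inv_mulVec_entry hV hv i).const_mul _
  · have hs : s ∈ Finset.Ico 1 t := by simpa [targetIndices] using hp
    rw [Finset.mem_Ico] at hs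
    exact measurable_dotProduct_of_entries
      (measurable_coord_comp x (R.measurable_act_of_lt (Finset.mem_Icc.2 ⟨hs.1, by omega⟩)
        (by omega)))
      (measurable_inv_mulVec_entry hV hv)

theorem measurable_phaseLength (γ : ℝ) : Measurable (phaseLength γ) := by
  refine Measurable.ite (measurableSet_singleton 0) measurable_const ?_
  exact (Measurable.of_discrete (f := fun n : ℕ => (n : ℕ∞))).comp
    (Nat.measurable_ceil.comp (by fun_prop))

/-- The minimizers `w` are not assumed measurable. The countdown is, because bonuses in
re-randomization rounds can be rewritten through `pred`, an explicit function of actions and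
targets. -/
theorem measurable_counter (hlam : 0 < lam) {t : ℕ} (h1 : 1 ≤ t) (hT : t ≤ T + 1) :
    Measurable[R.ℱ t] (R.counter t) := by
  induction t, h1 using Nat.le_induction with
  | base =>
    have : R.counter 1 = fun _ => 0 := funext R.counter_init
    rw [this]; exact measurable_const
  | succ t h1 ih =>
    have ht : t ∈ Finset.Icc 1 T := Finset.mem_Icc.2 ⟨h1, by omega⟩
    have ih := (ih (by omega)).mono (R.ℱ.mono t.le_succ) le_rfl
    have h : R.counter (t + 1) = fun ω => if R.counter t ω = 0 then
        phaseLength γ (β * ⨆ j, |R.pred t j (x (R.act t ω)).ofLp ω|) - 1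
        else R.counter t ω - 1 := by
      ext1 ω
      split_ifs with h0
      · rw [R.counter_update t ht ω h0, R.acbBonus_eq hlam ht h0]
      · exact R.counter_keep t ht ω h0
    have hsub : Measurable fun n : ℕ∞ => n - 1 := Measurable.of_discrete
    rw [h]
    refine Measurable.ite (ih (measurableSet_singleton 0)) (hsub.comp ?_) (hsub.comp ih)
    refine (measurable_phaseLength γ).comp (Measurable.const_mul (Measurable.iSup fun j => ?_) _)
    exact measurable_norm.comp (f := fun ω => R.pred t j (x (R.act t ω)).ofLp ω)
      (R.measurable_pred ht j (measurable_coord_comp x (R.measurable_act_of_lt ht t.lt_succ_self)))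

/-- On each of the finitely many action histories the event `F` is fixed and depends on the fresh
targets alone, hence is independent of `G` and the history. Summing over histories replaces a
conditional probability. -/
theorem measure_inter_history_le [IsProbabilityMeasure P] {t : ℕ} (ht : t ∈ Finset.Icc 1 T)
    {G : Set Ω} (hG : MeasurableSet[R.ℱ t] G) {p : ENNReal} (F : (ℕ → Fin A) → Set Ω)
    (hF : ∀ a, MeasurableSet[targetSigma (R.y t)] (F a)) (hp : ∀ a, P (F a) ≤ p)
    (hcongr : ∀ a a', (∀ i ∈ Finset.Ico 1 t, a i = a' i) → F a = F a') :
    P (G ∩ {ω | ω ∈ F fun i => R.act i ω}) ≤ p * P G := by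
  obtain ⟨ω₀⟩ : Nonempty Ω := nonempty_of_isProbabilityMeasure P
  have htT := Finset.mem_Icc.1 ht
  let hist : Ω → (Finset.Ico 1 t → Fin A) := fun ω i => R.act i ω
  -- The value outside rounds 1, …, t - 1 is arbitrary; `hcongr` makes it irrelevant.
  let e : (Finset.Ico 1 t → Fin A) → ℕ → Fin A := fun h i =>
    if hi : i ∈ Finset.Ico 1 t then h ⟨i, hi⟩ else R.act 0 ω₀
  have hhist : Measurable[R.ℱ t] hist := by
    refine @measurable_pi_lambda _ _ _ (R.ℱ t) _ hist fun i => ?_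
    have hi := Finset.mem_Ico.1 i.2
    exact R.measurable_act_of_lt (Finset.mem_Icc.2 ⟨hi.1, by omega⟩) hi.2
  have hset : ∀ h, MeasurableSet[R.ℱ t] (hist ⁻¹' {h}) := fun h =>
    hhist (measurableSet_singleton h)
  have hFe : ∀ ω, F (fun i => R.act i ω) = F (e (hist ω)) := fun ω =>
    hcongr _ _ fun i hi => by simp only [e, hi, dif_pos, hist]
  have hsub : G ∩ {ω | ω ∈ F fun i => R.act i ω} ⊆
      ⋃ h ∈ (Finset.univ : Finset (Finset.Ico 1 t → Fin A)), (G ∩ hist ⁻¹' {h}) ∩ F (e h) := by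
    rintro ω ⟨hω, hω'⟩
    simp only [Set.mem_iUnion, Finset.mem_univ, exists_true_left]
    exact ⟨hist ω, ⟨hω, rfl⟩, by rw [← hFe]; exact hω'⟩
  calc _ ≤ P (⋃ h ∈ (Finset.univ : Finset (Finset.Ico 1 t → Fin A)),
        (G ∩ hist ⁻¹' {h}) ∩ F (e h)) := measure_mono hsub
    _ ≤ ∑ h, P ((G ∩ hist ⁻¹' {h}) ∩ F (e h)) := measure_biUnion_finset_le _ _
    _ = ∑ h, P (G ∩ hist ⁻¹' {h}) * P (F (e h)) := Finset.sum_congr rfl fun h _ =>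
        (Indep_iff _ _ _).1 (R.target_fresh t ht) _ _ (hG.inter (hset h)) (hF _)
    _ ≤ ∑ h, P (G ∩ hist ⁻¹' {h}) * p := Finset.sum_le_sum fun h _ => by gcongr; exact hp _
    _ = p * ∑ h, P.restrict G (hist ⁻¹' {h}) := by
        rw [← Finset.sum_mul, mul_comm]
        congr 1
        refine Finset.sum_congr rfl fun h _ => ?_
        rw [Measure.restrict_apply (R.ℱ.le t _ (hset h)), Set.inter_comm]
    _ = p * P G := by
        rw [sum_measure_preimage_singleton _ fun h _ => R.ℱ.le t _ (hset h)]
        simp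

theorem measurable_sum_target {t : ℕ} (j : Fin M) (c : Fin d ⊕ ℕ → ℝ) :
    Measurable[targetSigma (R.y t)] fun ω => |∑ p ∈ targetIndices d t, c p * R.y t j p ω| := by
  refine measurable_norm.comp (f := fun ω => ∑ p ∈ targetIndices d t, c p * R.y t j p ω)
    (Finset.measurable_sum _ fun p _ => Measurable.const_mul ?_ _)
  exact (comap_measurable (R.y t j p)).mono
    (le_iSup₂_of_le (f := fun j p => MeasurableSpace.comap (R.y t j p) inferInstance) j p le_rfl)
    le_rfl

theorem measurable_y {t : ℕ} (ht : t ∈ Finset.Icc 1 T) (j : Fin M) (p : Fin d ⊕ ℕ) :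
    Measurable (R.y t j p) := (R.target_measurable t ht j p).mono (R.ℱ.le _) le_rfl

theorem measure_inter_pred_lt_le [IsProbabilityMeasure P] (hlam : 0 < lam) (hM : 0 < M) {t : ℕ}
    (ht : t ∈ Finset.Icc 1 T) {G : Set Ω} (hG : MeasurableSet[R.ℱ t] G) (v : Fin d → ℝ) (r : ℝ) :
    P (G ∩ {ω | ∀ j, |R.pred t j v ω| < r * √(invNormSq (R.design t ω) v)}) ≤
      ENNReal.ofReal (gaussBall r ^ M) * P G := by
  refine R.measure_inter_history_le ht hG (fun a => {ω | ∀ j, |∑ p ∈ targetIndices d t,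
    targetWeight lam (fun i => (x (a i)).ofLp) t v p * R.y t j p ω| <
      r * √(invNormSq (designMatrix lam (fun i => (x (a i)).ofLp) t) v)}) ?_ ?_ ?_
  · intro a
    rw [Set.ofPred_forall]
    exact MeasurableSet.iInter fun j => R.measurable_sum_target j _ measurableSet_Iio
  · intro a
    rw [← sum_targetWeight_sq hlam]
    rcases (Finset.sum_nonneg fun p _ => sq_nonneg _ : 0 ≤ ∑ p ∈ targetIndices d t,
      targetWeight lam (fun i => (x (a i)).ofLp) t v p ^ 2).eq_or_lt with h0 | h0
    -- At zero width the strict inequality fails for every member, and `0 < M` provides one.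
    · rw [← h0]
      have : {ω | ∀ j, |∑ p ∈ targetIndices d t,
          targetWeight lam (fun i => (x (a i)).ofLp) t v p * R.y t j p ω| < r * √0} = ∅ := by
        ext ω
        simp only [Real.sqrt_zero, mul_zero, Set.mem_empty_iff_false, iff_false]
        exact fun h => absurd (h ⟨0, hM⟩) (not_lt.2 (abs_nonneg _))
      rw [this]; simp
    · rw [← measureReal_forall_abs_sum_lt (R.target_iIndep t ht) (R.measurable_y ht)
        (R.target_law t ht) (targetIndices d t) _ h0 r, ofReal_measureReal]
  · intro a a' h
    have h' : ∀ i ∈ Finset.Ico 1 t, (x (a i)).ofLp = (x (a' i)).ofLp := fun i hi => by rw [h i hi]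
    ext ω
    simp only [designMatrix_congr lam h', Set.mem_ofPred_eq]
    refine forall_congr' fun j => ?_
    rw [Finset.sum_congr rfl fun p hp => by rw [targetWeight_congr lam h' v hp]]

theorem measure_pred_gt_le [IsProbabilityMeasure P] (hlam : 0 < lam) {t : ℕ}
    (ht : t ∈ Finset.Icc 1 T) (j : Fin M) (v : Fin d → ℝ) {r : ℝ} (hr : 0 ≤ r) :
    P {ω | r * √(invNormSq (R.design t ω) v) < |R.pred t j v ω|} ≤
      ENNReal.ofReal (2 * Real.exp (-r ^ 2 / 2)) := by
  have key := R.measure_inter_history_le (p := ENNReal.ofReal (2 * Real.exp (-r ^ 2 / 2))) ht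
    (G := Set.univ) MeasurableSet.univ (fun a => {ω |
      r * √(invNormSq (designMatrix lam (fun i => (x (a i)).ofLp) t) v) < |∑ p ∈ targetIndices d t,
    targetWeight lam (fun i => (x (a i)).ofLp) t v p * R.y t j p ω|}) ?_ ?_ ?_
  · rw [Set.univ_inter, measure_univ, mul_one] at key
    exact key
  · exact fun a => R.measurable_sum_target j _ measurableSet_Ioi
  · intro a
    rw [← sum_targetWeight_sq hlam]
    set s := ∑ p ∈ targetIndices d t, targetWeight lam (fun i => (x (a i)).ofLp) t v p ^ 2 with hs
    rcases (Finset.sum_nonneg fun p _ => sq_nonneg _ : 0 ≤ s).eq_or_lt with h0 | h0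
    · have hz := (Finset.sum_eq_zero_iff_of_nonneg fun p _ => sq_nonneg _).1 (hs.symm.trans h0.symm)
      have : {ω | r * √s < |∑ p ∈ targetIndices d t,
          targetWeight lam (fun i => (x (a i)).ofLp) t v p * R.y t j p ω|} = ∅ := by
        ext ω
        have h1 : ∑ p ∈ targetIndices d t,
            targetWeight lam (fun i => (x (a i)).ofLp) t v p * R.y t j p ω = 0 :=
          Finset.sum_eq_zero fun p hp => by rw [pow_eq_zero_iff two_ne_zero |>.1 (hz p hp), zero_mul]
        simp only [h1, abs_zero, Set.mem_ofPred_eq, Set.mem_empty_iff_false, iff_false, not_lt]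
        positivity
      rw [this]; simp
    · have hyj : iIndepFun (R.y t j) P :=
        (R.target_iIndep t ht).precomp (g := fun i => (j, i)) fun a b h => by simpa using h
      have h1 := measureReal_abs_sum_eq hyj (R.measurable_y ht j) (R.target_law t ht j)
        (targetIndices d t) _ h0 (measurableSet_Ici (a := r))
      have h2 := gaussianReal_abs_ge_le hr
      have h3 : {ω | r * √s < |∑ p ∈ targetIndices d t,
          targetWeight lam (fun i => (x (a i)).ofLp) t v p * R.y t j p ω|} ⊆
          {ω | |∑ p ∈ targetIndices d t,
          targetWeight lam (fun i => (x (a i)).ofLp) t v p * R.y t j p ω| / √s ∈ Set.Ici r} := by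
        intro ω hω
        exact (le_div_iff₀ (Real.sqrt_pos.2 h0)).2 (le_of_lt hω)
      refine (measure_mono h3).trans ?_
      rw [← ofReal_measureReal]
      exact ENNReal.ofReal_le_ofReal (h1.trans_le h2)
  · intro a a' h
    have h' : ∀ i ∈ Finset.Ico 1 t, (x (a i)).ofLp = (x (a' i)).ofLp := fun i hi => by rw [h i hi]
    ext ω
    simp only [designMatrix_congr lam h', Set.mem_ofPred_eq]
    rw [Finset.sum_congr rfl fun p hp => by rw [targetWeight_congr lam h' v hp]]

/-- The number of rounds before round `t` in which the targets are re-sampled. -/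
noncomputable def resamplesBefore (t : ℕ) (ω : Ω) : ℕ :=
  {s ∈ Finset.Ico 1 t | R.counter s ω = 0}.card

theorem measurable_resamplesBefore (hlam : 0 < lam) {t : ℕ} (hT : t ≤ T + 1) :
    Measurable[R.ℱ t] (R.resamplesBefore t) := by
  classical
  have : R.resamplesBefore t = fun ω => ∑ s ∈ Finset.Ico 1 t, if R.counter s ω = 0 then 1 else 0 := by
    ext ω; simp [resamplesBefore]
  rw [this]
  refine Finset.measurable_sum _ fun s hs => ?_
  rw [Finset.mem_Ico] at hs
  refine Measurable.ite ?_ measurable_const measurable_const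
  exact ((R.measurable_counter hlam hs.1 (by omega)).mono (R.ℱ.mono hs.2.le) le_rfl)
    (measurableSet_singleton 0)

theorem card_filter_resamplesBefore_lt_le (K : ℕ) (ω : Ω) :
    {t ∈ Finset.Icc 1 T | R.counter t ω = 0 ∧ R.resamplesBefore t ω < K}.card ≤ K := by
  classical
  refine (Finset.card_le_card_of_injOn (fun t => R.resamplesBefore t ω) (t := Finset.range K)
    (fun t ht => ?_) ?_).trans_eq (Finset.card_range K)
  · simp only [Finset.coe_filter, Set.mem_ofPred_eq] at ht
    simpa using ht.2.2
  · have hlt : ∀ t t', t ∈ Finset.Icc 1 T → R.counter t ω = 0 → t < t' →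
        R.resamplesBefore t ω < R.resamplesBefore t' ω := by
      intro t t' ht h0 htt'
      refine Finset.card_lt_card (Finset.ssubset_iff_of_subset ?_ |>.2 ⟨t, ?_, ?_⟩)
      · exact Finset.filter_subset_filter _ (Finset.Ico_subset_Ico_right htt'.le)
      · simp only [Finset.mem_filter, Finset.mem_Ico]
        exact ⟨⟨(Finset.mem_Icc.1 ht).1, htt'⟩, h0⟩
      · simp
    intro t ht t' ht' h
    simp only [Finset.coe_filter, Set.mem_ofPred_eq] at ht ht'
    rcases lt_trichotomy t t' with h' | h' | h'
    · exact absurd h (hlt t t' ht.1 ht.2.1 h').ne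
    · exact h'
    · exact absurd h (hlt t' t ht'.1 ht'.2.1 h').ne'

/-- Whether round t is among the first `K` re-randomizations is decided before its targets are
drawn. The failure probabilities thus add up to the small-ball probability times the expected number
of such rounds, giving a factor `K` instead of the horizon. -/
theorem measure_exists_resample_pred_lt_le [IsProbabilityMeasure P] (hlam : 0 < lam) (hM : 0 < M)
    (K : ℕ) (v : Fin d → ℝ) (r : ℝ) :
    P {ω | ∃ t ∈ Finset.Icc 1 T, (R.counter t ω = 0 ∧ R.resamplesBefore t ω < K) ∧
      ∀ j, |R.pred t j v ω| < r * √(invNormSq (R.design t ω) v)} ≤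
      ENNReal.ofReal (K * gaussBall r ^ M) := by
  classical
  let G : ℕ → Set Ω := fun t => {ω | R.counter t ω = 0 ∧ R.resamplesBefore t ω < K}
  have hG : ∀ t ∈ Finset.Icc 1 T, MeasurableSet[R.ℱ t] (G t) := by
    intro t ht
    rw [Finset.mem_Icc] at ht
    exact (R.measurable_counter hlam ht.1 (by omega) (measurableSet_singleton 0)).inter
      (R.measurable_resamplesBefore hlam (by omega) measurableSet_Iio)
  have hsum : ∑ t ∈ Finset.Icc 1 T, P (G t) ≤ K := by
    calc _ = ∑ t ∈ Finset.Icc 1 T, ∫⁻ ω, (G t).indicator 1 ω ∂P :=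
          Finset.sum_congr rfl fun t ht => (lintegral_indicator_one (R.ℱ.le t _ (hG t ht))).symm
      _ = ∫⁻ ω, ∑ t ∈ Finset.Icc 1 T, (G t).indicator 1 ω ∂P :=
          (lintegral_finsetSum _ fun t ht =>
            measurable_one.indicator (R.ℱ.le t _ (hG t ht))).symm
      _ ≤ ∫⁻ _, (K : ENNReal) ∂P := by
          refine lintegral_mono fun ω => ?_
          have : ∑ t ∈ Finset.Icc 1 T, (G t).indicator (1 : Ω → ENNReal) ω =
              ({t ∈ Finset.Icc 1 T | R.counter t ω = 0 ∧ R.resamplesBefore t ω < K}.card :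
                ENNReal) := by
            simp [Set.indicator_apply, G]
          rw [this]
          exact Nat.cast_le.2 (R.card_filter_resamplesBefore_lt_le K ω)
      _ = K := by simp
  calc _ ≤ P (⋃ t ∈ Finset.Icc 1 T, G t ∩
        {ω | ∀ j, |R.pred t j v ω| < r * √(invNormSq (R.design t ω) v)}) := by
        refine measure_mono ?_
        rintro ω ⟨t, ht, h⟩
        exact Set.mem_biUnion ht h
    _ ≤ ∑ t ∈ Finset.Icc 1 T, P (G t ∩
        {ω | ∀ j, |R.pred t j v ω| < r * √(invNormSq (R.design t ω) v)}) :=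
        measure_biUnion_finset_le _ _
    _ ≤ ∑ t ∈ Finset.Icc 1 T, ENNReal.ofReal (gaussBall r ^ M) * P (G t) :=
        Finset.sum_le_sum fun t ht => R.measure_inter_pred_lt_le hlam hM ht (hG t ht) v r
    _ ≤ ENNReal.ofReal (gaussBall r ^ M) * K := by rw [← Finset.mul_sum]; gcongr
    _ = _ := by
        rw [ENNReal.ofReal_mul (by positivity), ENNReal.ofReal_natCast, mul_comm]

theorem measure_exists_pred_lt_le [IsProbabilityMeasure P] (hlam : 0 < lam) (hM : 0 < M) (r : ℝ) :
    P {ω | ∃ t ∈ Finset.Icc 1 T, ∃ b : Fin A,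
      ∀ j, |R.pred t j (x b).ofLp ω| < r * √(invNormSq (R.design t ω) (x b).ofLp)} ≤
      ENNReal.ofReal (T * A * gaussBall r ^ M) := by
  calc _ ≤ P (⋃ q ∈ Finset.Icc 1 T ×ˢ (Finset.univ : Finset (Fin A)), {ω |
        ∀ j, |R.pred q.1 j (x q.2).ofLp ω| < r * √(invNormSq (R.design q.1 ω) (x q.2).ofLp)}) := by
        refine measure_mono ?_
        rintro ω ⟨t, ht, b, h⟩
        exact Set.mem_biUnion (x := (t, b)) (by simpa using ht) h
    _ ≤ ∑ q ∈ Finset.Icc 1 T ×ˢ (Finset.univ : Finset (Fin A)), P {ω |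
        ∀ j, |R.pred q.1 j (x q.2).ofLp ω| < r * √(invNormSq (R.design q.1 ω) (x q.2).ofLp)} :=
        measure_biUnion_finset_le _ _
    _ ≤ ∑ q ∈ Finset.Icc 1 T ×ˢ (Finset.univ : Finset (Fin A)),
        ENNReal.ofReal (gaussBall r ^ M) := by
        refine Finset.sum_le_sum fun q hq => ?_
        have := R.measure_inter_pred_lt_le hlam hM (Finset.mem_product.1 hq).1
          (G := Set.univ) MeasurableSet.univ (x q.2).ofLp r
        simpa using this
    _ = _ := by
        rw [ENNReal.ofReal_mul (by positivity), ENNReal.ofReal_mul (by positivity)]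
        simp

theorem measure_exists_pred_gt_le [IsProbabilityMeasure P] (hlam : 0 < lam) {r : ℝ} (hr : 0 ≤ r) :
    P {ω | ∃ t ∈ Finset.Icc 1 T, ∃ b : Fin A, ∃ j,
      r * √(invNormSq (R.design t ω) (x b).ofLp) < |R.pred t j (x b).ofLp ω|} ≤
      ENNReal.ofReal (T * A * M * (2 * Real.exp (-r ^ 2 / 2))) := by
  calc _ ≤ P (⋃ q ∈ Finset.Icc 1 T ×ˢ (Finset.univ : Finset (Fin A × Fin M)), {ω |
        r * √(invNormSq (R.design q.1 ω) (x q.2.1).ofLp) <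
          |R.pred q.1 q.2.2 (x q.2.1).ofLp ω|}) := by
        refine measure_mono ?_
        rintro ω ⟨t, ht, b, j, h⟩
        exact Set.mem_biUnion (x := (t, b, j)) (by simpa using ht) h
    _ ≤ ∑ q ∈ Finset.Icc 1 T ×ˢ (Finset.univ : Finset (Fin A × Fin M)), P {ω |
        r * √(invNormSq (R.design q.1 ω) (x q.2.1).ofLp) <
          |R.pred q.1 q.2.2 (x q.2.1).ofLp ω|} := measure_biUnion_finset_le _ _
    _ ≤ ∑ q ∈ Finset.Icc 1 T ×ˢ (Finset.univ : Finset (Fin A × Fin M)),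
        ENNReal.ofReal (2 * Real.exp (-r ^ 2 / 2)) :=
        Finset.sum_le_sum fun q hq =>
          R.measure_pred_gt_le hlam (Finset.mem_product.1 hq).1 q.2.2 _ hr
    _ = _ := by
        rw [ENNReal.ofReal_mul (by positivity), ENNReal.ofReal_mul (by positivity),
          ENNReal.ofReal_mul (by positivity)]
        simp [mul_assoc]

theorem measure_exists_noise_ge_le [IsProbabilityMeasure P] (hlam : 0 < lam) (hσ : 0 < σ)
    (hT : 1 ≤ T) (c : ℝ) :
    P {ω | ∃ t ∈ Finset.Icc 1 T, σ ^ 2 * (logDetRatio lam (R.design t ω) + 2 * c) ≤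
      invNormSq (R.design t ω) (∑ i ∈ Finset.Ico 1 t, R.ε i ω • (x (R.act i ω)).ofLp)} ≤
      ENNReal.ofReal (Real.exp (-c)) :=
  measure_exists_selfNormalized_le (ℱ := R.ℱ) (m := fun t => R.ℱ t ⊔ targetSigma (R.y t))
    (a := fun i ω => (x (R.act i ω)).ofLp) hT hσ hlam (fun _ _ => le_sup_left)
    (fun _ ht => (R.sup_targetSigma_le ht).trans (R.ℱ.le _))
    (fun t ht => measurable_coord_comp x (R.act_measurable t ht))
    (fun t ht => measurable_coord_comp x (R.measurable_act_of_lt ht t.lt_succ_self))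
    R.noise_measurable R.noise_subgaussian

end LazyACBRun

/-! ### Phases, the number of re-randomizations, and the regret -/

theorem designMatrix_eq_add_of_const {d : ℕ} (lam : ℝ) {a : ℕ → Fin d → ℝ} {s u : ℕ} (hs : 1 ≤ s)
    (hsu : s ≤ u) {v : Fin d → ℝ} (h : ∀ k, s ≤ k → k < u → a k = v) :
    designMatrix lam a u = designMatrix lam a s + ((u - s : ℕ) : ℝ) • vecMulVec v v := by
  rw [designMatrix, designMatrix, ← Finset.sum_Ico_consecutive _ hs hsu, add_assoc]
  congr 2
  rw [Finset.sum_congr rfl (g := fun _ => vecMulVec v v)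
    fun k hk => by rw [h k (Finset.mem_Ico.1 hk).1 (Finset.mem_Ico.1 hk).2]]
  simp [Nat.cast_smul_eq_nsmul]

theorem phaseLength_le_iff {γ b : ℝ} {n : ℕ} :
    phaseLength γ b ≤ n ↔ b ≠ 0 ∧ ⌈γ / b ^ 2⌉₊ ≤ n := by
  rw [phaseLength]
  split_ifs with h
  · simp [h]
  · simp [h]

namespace LazyACBRun

variable {Ω : Type*} [mΩ : MeasurableSpace Ω] {P : Measure Ω} {d A : ℕ}
  {x : Fin A → EuclideanSpace ℝ (Fin d)} {θstar : EuclideanSpace ℝ (Fin d)}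
  {σ : ℝ} {M : ℕ} {lam β γ : ℝ} {T : ℕ} (R : LazyACBRun P x θstar σ M lam β γ T)

/-- The bonus of the action played in round `t`, for the targets of that round. -/
noncomputable def bonus (t : ℕ) (ω : Ω) : ℝ :=
  β * ⨆ j, |R.pred t j (x (R.act t ω)).ofLp ω|

/-- The potential `⟨a, V⁻¹ a⟩` of the action played in round `t`. -/
noncomputable def width (t : ℕ) (ω : Ω) : ℝ :=
  invNormSq (R.design t ω) (x (R.act t ω)).ofLp

/-- The phase that contains round `u - 1` starts in round `s`. -/
structure IsPhase (ω : Ω) (s u : ℕ) : Prop where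
  mem : s ∈ Finset.Icc 1 T
  lt : s < u
  counter_eq_zero : R.counter s ω = 0
  act_eq : ∀ k, s ≤ k → k < u → R.act k ω = R.act s ω
  counter_ne_zero : ∀ k, s < k → k < u → R.counter k ω ≠ 0
  lt_phaseLength : ∀ k, s < k → k < u → ((k - s : ℕ) : ℕ∞) < phaseLength γ (R.bonus s ω)
  counter_eq : R.counter u ω = phaseLength γ (R.bonus s ω) - ((u - s : ℕ) : ℕ∞)

theorem counter_succ_of_eq_zero (hlam : 0 < lam) {t : ℕ} (ht : t ∈ Finset.Icc 1 T) {ω : Ω}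
    (h0 : R.counter t ω = 0) : R.counter (t + 1) ω = phaseLength γ (R.bonus t ω) - 1 := by
  rw [R.counter_update t ht ω h0, R.acbBonus_eq hlam ht h0]; rfl

theorem isPhase_succ_of_eq_zero (hlam : 0 < lam) {t : ℕ} (ht : t ∈ Finset.Icc 1 T) {ω : Ω}
    (h0 : R.counter t ω = 0) : R.IsPhase ω t (t + 1) where
  mem := ht
  lt := t.lt_succ_self
  counter_eq_zero := h0
  act_eq k h1 h2 := by rw [show k = t by omega]
  counter_ne_zero k h1 h2 := by omega
  lt_phaseLength k h1 h2 := by omega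
  counter_eq := by rw [R.counter_succ_of_eq_zero hlam ht h0]; simp

theorem exists_isPhase (hlam : 0 < lam) (ω : Ω) {u : ℕ} (h1 : 1 ≤ u) (hT : u ≤ T) :
    ∃ s, R.IsPhase ω s (u + 1) := by
  induction u, h1 using Nat.le_induction with
  | base => exact ⟨1, R.isPhase_succ_of_eq_zero hlam (by simp [hT]) (R.counter_init ω)⟩
  | succ u h1 ih =>
    obtain ⟨s, hs⟩ := ih (by omega)
    have hu : u + 1 ∈ Finset.Icc 1 T := Finset.mem_Icc.2 ⟨by omega, hT⟩
    by_cases h0 : R.counter (u + 1) ω = 0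
    · exact ⟨u + 1, R.isPhase_succ_of_eq_zero hlam hu h0⟩
    have hsu := hs.lt
    refine ⟨s, hs.mem, by omega, hs.counter_eq_zero, ?_, ?_, ?_, ?_⟩
    · intro k hk1 hk2
      rcases (Nat.lt_succ_iff.1 hk2).lt_or_eq with h | h
      · exact hs.act_eq k hk1 h
      · rw [h, R.act_keep _ hu ω h0]
        exact hs.act_eq u (by omega) (by omega)
    · intro k hk1 hk2
      rcases (Nat.lt_succ_iff.1 hk2).lt_or_eq with h | h
      · exact hs.counter_ne_zero k hk1 h
      · rwa [h]
    · intro k hk1 hk2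
      rcases (Nat.lt_succ_iff.1 hk2).lt_or_eq with h | h
      · exact hs.lt_phaseLength k hk1 h
      · rw [h]
        rw [hs.counter_eq] at h0
        exact tsub_pos_iff_lt.1 (pos_iff_ne_zero.2 h0)
    · rw [R.counter_keep _ hu ω h0, hs.counter_eq, tsub_tsub]
      congr 1
      norm_cast
      omega

variable {R}

theorem IsPhase.resamplesBefore_eq {ω : Ω} {s u : ℕ} (h : R.IsPhase ω s u) :
    R.resamplesBefore u ω = R.resamplesBefore s ω + 1 := by
  have hs := (Finset.mem_Icc.1 h.mem).1
  have hlt := h.lt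
  have : {k ∈ Finset.Ico 1 u | R.counter k ω = 0} =
      insert s {k ∈ Finset.Ico 1 s | R.counter k ω = 0} := by
    ext k
    simp only [Finset.mem_filter, Finset.mem_Ico, Finset.mem_insert]
    constructor
    · rintro ⟨⟨h1, h2⟩, h3⟩
      rcases lt_trichotomy k s with h' | h' | h'
      · exact Or.inr ⟨⟨h1, h'⟩, h3⟩
      · exact Or.inl h'
      · exact absurd h3 (h.counter_ne_zero k h' h2)
    · rintro (rfl | ⟨⟨h1, h2⟩, h3⟩)
      · exact ⟨⟨hs, hlt⟩, h.counter_eq_zero⟩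
      · exact ⟨⟨h1, by omega⟩, h3⟩
  rw [resamplesBefore, this, Finset.card_insert_of_notMem (by simp), resamplesBefore]

theorem IsPhase.logDetRatio_eq {ω : Ω} {s u : ℕ} (h : R.IsPhase ω s u) (hlam : 0 < lam) :
    logDetRatio lam (R.design u ω) =
      logDetRatio lam (R.design s ω) + Real.log (1 + ((u - s : ℕ) : ℝ) * R.width s ω) := by
  have hs := (Finset.mem_Icc.1 h.mem).1
  have key := designMatrix_eq_add_of_const lam (a := fun i => (x (R.act i ω)).ofLp) hs h.lt.le
    (v := (x (R.act s ω)).ofLp) (fun k h1 h2 => by rw [h.act_eq k h1 h2])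
  rw [design, key, logDetRatio_add_smul_vecMulVec lam (posDef_designMatrix hlam _ _)
    (Nat.cast_nonneg _)]
  rfl

/-- A completed phase consumes a fixed amount of elliptical potential. -/
theorem IsPhase.le_length_mul_width {ω : Ω} {s u : ℕ} (h : R.IsPhase ω s u) {z : ℝ}
    (hβ : 0 < β) (hz : 0 < z) (hlam : 0 < lam)
    (hup : |R.bonus s ω| ≤ β * (z * √(R.width s ω))) (hu : R.counter u ω = 0) :
    γ / (β ^ 2 * z ^ 2) ≤ ((u - s : ℕ) : ℝ) * R.width s ω := by
  have h0 := h.counter_eq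
  -- A vanishing countdown means that the whole phase length has elapsed; in particular it is finite
  -- and the bonus is nonzero.
  rw [hu, eq_comm, tsub_eq_zero_iff_le, phaseLength_le_iff] at h0
  have hb : 0 < R.bonus s ω ^ 2 := by have := h0.1; positivity
  have hq : 0 ≤ R.width s ω := invNormSq_nonneg (R.posDef_design hlam s ω) _
  have h1 : γ ≤ ((u - s : ℕ) : ℝ) * R.bonus s ω ^ 2 := by
    rw [← div_le_iff₀ hb]
    exact (Nat.le_ceil _).trans (by exact_mod_cast h0.2)
  have h2 : R.bonus s ω ^ 2 ≤ β ^ 2 * z ^ 2 * R.width s ω := by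
    calc _ = |R.bonus s ω| ^ 2 := (sq_abs _).symm
      _ ≤ (β * (z * √(R.width s ω))) ^ 2 := by gcongr
      _ = _ := by rw [mul_pow, mul_pow, Real.sq_sqrt hq]; ring
  rw [div_le_iff₀ (by positivity)]
  calc γ ≤ ((u - s : ℕ) : ℝ) * R.bonus s ω ^ 2 := h1
    _ ≤ ((u - s : ℕ) : ℝ) * (β ^ 2 * z ^ 2 * R.width s ω) := by gcongr
    _ = _ := by ring

variable (R)

theorem resampleCount_eq (ω : Ω) : R.resampleCount ω = R.resamplesBefore (T + 1) ω := by
  rw [resampleCount, resamplesBefore, ← Set.ncard_coe_finset]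
  congr 1
  ext t
  simp

/-- The number of completed phases is bounded by any potential that each of them increases. -/
theorem resampleCount_sub_one_mul_le (hlam : 0 < lam) (hT : 1 ≤ T) (ω : Ω) {Φ : ℕ → ℝ} {η Φmax : ℝ}
    (h1 : 0 ≤ Φ 1) (hmax : ∀ t ∈ Finset.Icc 1 T, Φ t ≤ Φmax)
    (hstep : ∀ s u, R.IsPhase ω s u → u ≤ T → R.counter u ω = 0 → Φ s + η ≤ Φ u) :
    ((R.resampleCount ω : ℝ) - 1) * η ≤ Φmax := by
  have main : ∀ u, 1 ≤ u → u ≤ T → R.counter u ω = 0 → (R.resamplesBefore u ω : ℝ) * η ≤ Φ u := by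
    intro u
    induction u using Nat.strong_induction_on with
    | _ u ih =>
      intro hu1 huT hu0
      rcases hu1.eq_or_lt with rfl | hlt
      · simpa [resamplesBefore] using h1
      · obtain ⟨s, hs⟩ := R.exists_isPhase hlam ω (u := u - 1) (by omega) (by omega)
        rw [Nat.sub_add_cancel (by omega)] at hs
        have h := ih s hs.lt (Finset.mem_Icc.1 hs.mem).1 (Finset.mem_Icc.1 hs.mem).2
          hs.counter_eq_zero
        have h' := hstep s u hs huT hu0
        rw [hs.resamplesBefore_eq]
        push_cast
        linarith
  -- The last phase may be cut off by the horizon, which costs the 1 in the statement.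
  obtain ⟨s, hs⟩ := R.exists_isPhase hlam ω hT le_rfl
  have hsT := Finset.mem_Icc.1 hs.mem
  rw [R.resampleCount_eq, hs.resamplesBefore_eq]
  push_cast
  rw [add_sub_cancel_right]
  exact (main s hsT.1 hsT.2 hs.counter_eq_zero).trans (hmax s hs.mem)

theorem abs_bonus_le (hβ : 0 < β) {t : ℕ} {ω : Ω} {z : ℝ} (hz : 0 ≤ z)
    (h : ∀ j, |R.pred t j (x (R.act t ω)).ofLp ω| ≤ z * √(R.width t ω)) :
    |R.bonus t ω| ≤ β * (z * √(R.width t ω)) := by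
  have h0 : 0 ≤ ⨆ j, |R.pred t j (x (R.act t ω)).ofLp ω| := Real.iSup_nonneg fun j => abs_nonneg _
  rw [bonus, abs_of_nonneg (by positivity)]
  gcongr
  exact Real.iSup_le h (by positivity)

theorem logDetRatio_design_le {B : ℝ} (hd : 0 < d) (hlam : 0 < lam) (hB0 : 0 ≤ B)
    (hB : ∀ b, ‖x b‖ ^ 2 ≤ B) {t : ℕ} (ht : t ≤ T + 1) (ω : Ω) :
    logDetRatio lam (R.design t ω) ≤ d * Real.log (1 + T * B / (lam * d)) :=
  logDetRatio_designMatrix_le hd hlam _ hB0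
    (fun i => by rw [← EuclideanSpace.norm_sq_eq_dotProduct]; exact hB _) ht

theorem resampleCount_sub_one_mul_le_logDet {B z : ℝ} (hd : 0 < d) (hlam : 0 < lam) (hT : 1 ≤ T)
    (hβ : 0 < β) (hγ : 0 < γ) (hz : 0 < z) (hB0 : 0 ≤ B) (hB : ∀ b, ‖x b‖ ^ 2 ≤ B) {ω : Ω}
    (hup : ∀ t ∈ Finset.Icc 1 T, ∀ b j,
      |R.pred t j (x b).ofLp ω| ≤ z * √(invNormSq (R.design t ω) (x b).ofLp)) :
    ((R.resampleCount ω : ℝ) - 1) * Real.log (1 + γ / (β ^ 2 * z ^ 2)) ≤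
      d * Real.log (1 + T * B / (lam * d)) := by
  refine R.resampleCount_sub_one_mul_le hlam hT ω (Φ := fun t => logDetRatio lam (R.design t ω))
    (logDetRatio_designMatrix_one _).ge
    (fun t ht => R.logDetRatio_design_le hd hlam hB0 hB (by have := (Finset.mem_Icc.1 ht).2; omega) ω)
    fun s u h hu hu0 => ?_
  rw [h.logDetRatio_eq hlam]
  have := h.le_length_mul_width hβ hz hlam (R.abs_bonus_le hβ hz.le fun j => hup s h.mem _ j) hu0
  gcongr

/-- The potential is the sum over actions b of log(1 + n_b |x b|²/λ), n_b being the number of plays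
of b. It plays the role of log det with A in place of d, and is what makes the union bound for small
κ affordable. -/
theorem resampleCount_sub_one_mul_le_card {B z : ℝ} (hlam : 0 < lam) (hT : 1 ≤ T)
    (hβ : 0 < β) (hγ : 0 < γ) (hz : 0 < z) (hB : ∀ b, ‖x b‖ ^ 2 ≤ B) {ω : Ω}
    (hup : ∀ t ∈ Finset.Icc 1 T, ∀ b j,
      |R.pred t j (x b).ofLp ω| ≤ z * √(invNormSq (R.design t ω) (x b).ofLp)) :
    ((R.resampleCount ω : ℝ) - 1) * Real.log (1 + γ / (β ^ 2 * z ^ 2)) ≤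
      A * Real.log (1 + T * (B / lam)) := by
  let n : Fin A → ℕ → ℝ := fun b t => ({i ∈ Finset.Ico 1 t | R.act i ω = b}.card : ℝ)
  let y : Fin A → ℝ := fun b => ((x b).ofLp ⬝ᵥ (x b).ofLp) / lam
  have hy0 : ∀ b, 0 ≤ y b := fun b => by
    simp only [y]; rw [← EuclideanSpace.norm_sq_eq_dotProduct]; positivity
  have hn0 : ∀ b t, 0 ≤ n b t := fun b t => Nat.cast_nonneg _
  have hmono : ∀ b s u, s ≤ u → n b s ≤ n b u := fun b s u h =>
    Nat.cast_le.2 (Finset.card_le_card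
      (Finset.filter_subset_filter _ (Finset.Ico_subset_Ico_right h)))
  have hpos : ∀ b t, 0 < 1 + n b t * y b := fun b t => by
    have := mul_nonneg (hn0 b t) (hy0 b); linarith
  refine R.resampleCount_sub_one_mul_le hlam hT ω
    (Φ := fun t => ∑ b, Real.log (1 + n b t * y b)) ?_ ?_ ?_
  · simp [n]
  · intro t ht
    have htT := (Finset.mem_Icc.1 ht).2
    calc _ ≤ ∑ _b : Fin A, Real.log (1 + T * (B / lam)) := by
          refine Finset.sum_le_sum fun b _ => Real.log_le_log (hpos b t) ?_
          have h1 : n b t ≤ T := by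
            refine Nat.cast_le.2 ((Finset.card_filter_le _ _).trans ?_)
            rw [Nat.card_Ico]; omega
          have h2 : y b ≤ B / lam := by
            simp only [y]; rw [← EuclideanSpace.norm_sq_eq_dotProduct]; gcongr; exact hB b
          have := hy0 b
          gcongr
      _ = _ := by simp
  · intro s u h hu hu0
    have hρ := h.le_length_mul_width hβ hz hlam
      (R.abs_bonus_le hβ hz.le fun j => hup s h.mem _ j) hu0
    have hρ0 : 0 < γ / (β ^ 2 * z ^ 2) := by positivity
    set ρ := γ / (β ^ 2 * z ^ 2)
    set b₀ := R.act s ω with hb₀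
    have hq : 0 ≤ R.width s ω := invNormSq_nonneg (R.posDef_design hlam s ω) _
    have h1 : (1 + n b₀ s * y b₀) * R.width s ω ≤ y b₀ := by
      have h2 := mul_invNormSq_le hlam (fun i => (x (R.act i ω)).ofLp) s (x b₀).ofLp
      have h3 : n b₀ s ≤ ({i ∈ Finset.Ico 1 s | (x (R.act i ω)).ofLp = (x b₀).ofLp}.card : ℝ) := by
        refine Nat.cast_le.2 (Finset.card_le_card fun i hi => ?_)
        simp only [Finset.mem_filter] at hi ⊢
        exact ⟨hi.1, by rw [hi.2]⟩
      have h4 : (x b₀).ofLp ⬝ᵥ (x b₀).ofLp = lam * y b₀ := by simp only [y]; field_simp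
      change (_ + _ * _) * R.width s ω ≤ _ at h2
      rw [h4] at h2
      have h5 : n b₀ s * (lam * y b₀) * R.width s ω ≤
          ({i ∈ Finset.Ico 1 s | (x (R.act i ω)).ofLp = (x b₀).ofLp}.card : ℝ) *
            (lam * y b₀) * R.width s ω := by
        have := hy0 b₀
        gcongr
      refine le_of_mul_le_mul_left ?_ hlam
      nlinarith
    have hcard : n b₀ u = n b₀ s + ((u - s : ℕ) : ℝ) := by
      have hs1 := (Finset.mem_Icc.1 h.mem).1
      have h6 : {i ∈ Finset.Ico 1 u | R.act i ω = b₀} =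
          {i ∈ Finset.Ico 1 s | R.act i ω = b₀} ∪ Finset.Ico s u := by
        rw [← Finset.Ico_union_Ico_eq_Ico hs1 h.lt.le, Finset.filter_union]
        congr 1
        exact Finset.filter_true_of_mem fun k hk =>
          h.act_eq k (Finset.mem_Ico.1 hk).1 (Finset.mem_Ico.1 hk).2
      have h7 : Disjoint {i ∈ Finset.Ico 1 s | R.act i ω = b₀} (Finset.Ico s u) :=
        (Finset.Ico_disjoint_Ico_consecutive 1 s u).mono_left (Finset.filter_subset _ _)
      simp only [n]
      rw [h6, Finset.card_union_of_disjoint h7, Nat.card_Ico]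
      push_cast
      ring
    -- By `h1` the width is at most y / (1 + n y), so a completed phase multiplies 1 + n y by at
    -- least 1 + ρ.
    have key : Real.log (1 + n b₀ s * y b₀) + Real.log (1 + ρ) ≤ Real.log (1 + n b₀ u * y b₀) := by
      rw [← Real.log_mul (hpos _ _).ne' (by positivity)]
      refine Real.log_le_log (mul_pos (hpos _ _) (by positivity)) ?_
      rw [hcard]
      have h8 : ρ * (1 + n b₀ s * y b₀) ≤ ((u - s : ℕ) : ℝ) * y b₀ := by
        calc _ ≤ (((u - s : ℕ) : ℝ) * R.width s ω) * (1 + n b₀ s * y b₀) := by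
              have := (hpos b₀ s).le; gcongr
          _ = ((u - s : ℕ) : ℝ) * ((1 + n b₀ s * y b₀) * R.width s ω) := by ring
          _ ≤ _ := by gcongr
      nlinarith
    rw [← Finset.add_sum_erase _ _ (Finset.mem_univ b₀),
      ← Finset.add_sum_erase (a := b₀) Finset.univ (fun b => Real.log (1 + n b u * y b))
        (Finset.mem_univ b₀)]
    have hrest : ∑ b ∈ Finset.univ.erase b₀, Real.log (1 + n b s * y b) ≤
        ∑ b ∈ Finset.univ.erase b₀, Real.log (1 + n b u * y b) := by
      refine Finset.sum_le_sum fun b _ => Real.log_le_log (hpos b s) ?_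
      have := hy0 b
      gcongr
      exact hmono b s u h.lt.le
    linarith

theorem sum_log_width_le {B : ℝ} (hd : 0 < d) (hlam : 0 < lam) (hB0 : 0 ≤ B)
    (hB : ∀ b, ‖x b‖ ^ 2 ≤ B) (ω : Ω) {Z : Finset ℕ} (hZ : Z ⊆ Finset.Icc 1 T) :
    ∑ s ∈ Z, Real.log (1 + R.width s ω) ≤ d * Real.log (1 + T * B / (lam * d)) := by
  have hq : ∀ s, 0 ≤ R.width s ω := fun s => invNormSq_nonneg (R.posDef_design hlam s ω) _
  calc _ ≤ ∑ s ∈ Finset.Ico 1 (T + 1), Real.log (1 + R.width s ω) :=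
        Finset.sum_le_sum_of_subset_of_nonneg
          (fun s hs => by have := Finset.mem_Icc.1 (hZ hs); exact Finset.mem_Ico.2 (by omega))
          fun s _ _ => Real.log_nonneg (by linarith [hq s])
    _ = logDetRatio lam (R.design (T + 1) ω) :=
        (logDetRatio_designMatrix_eq_sum hlam (fun i => (x (R.act i ω)).ofLp) (by omega)).symm
    _ ≤ _ := R.logDetRatio_design_le hd hlam hB0 hB le_rfl ω

/-- Every round is charged to the start of its phase. If the width there is at least 1, the gap is
bounded by `D`; the lower bound on the bonus limits the phase length and log det limits the number
of such phases. Otherwise the gap is at most a multiple of the bonus, and Cauchy–Schwarz over rounds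
leaves the sum of length · bonus². -/
theorem regret_le {B D C₁ z c : ℝ} (hd : 0 < d) (hlam : 0 < lam) (hβ : 0 < β)
    (hγ : 0 < γ) (hz : 0 < z) (hc : 0 < c) (hC₁ : 0 ≤ C₁) (hB0 : 0 ≤ B)
    (hB : ∀ b, ‖x b‖ ^ 2 ≤ B) {ω : Ω}
    (hD : ∀ b, (⨆ b : Fin A, inner ℝ (x b) θstar) - inner ℝ (x b) θstar ≤ D) (hD0 : 0 ≤ D)
    (hgap : ∀ t ∈ Finset.Icc 1 T, R.counter t ω = 0 →
      (⨆ b : Fin A, inner ℝ (x b) θstar) - inner ℝ (x (R.act t ω)) θstar ≤ C₁ * R.bonus t ω)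
    (hup : ∀ t ∈ Finset.Icc 1 T, |R.bonus t ω| ≤ β * (z * √(R.width t ω)))
    (hlow : ∀ t ∈ Finset.Icc 1 T, β * (c * √(R.width t ω)) ≤ R.bonus t ω) :
    R.regret ω ≤ D * ((γ / (β ^ 2 * c ^ 2) + 1) * (2 * (d * Real.log (1 + T * B / (lam * d))))) +
      C₁ * √(T * (R.resampleCount ω * γ +
        β ^ 2 * z ^ 2 * (2 * (d * Real.log (1 + T * B / (lam * d)))))) := by
  classical
  set E := d * Real.log (1 + T * B / (lam * d)) with hE
  have hq : ∀ s, 0 ≤ R.width s ω := fun s => invNormSq_nonneg (R.posDef_design hlam s ω) _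
  have hex : ∀ u, ∃ s, u ∈ Finset.Icc 1 T → R.IsPhase ω s (u + 1) := by
    intro u
    by_cases hu : u ∈ Finset.Icc 1 T
    · obtain ⟨s, hs⟩ := R.exists_isPhase hlam ω (Finset.mem_Icc.1 hu).1 (Finset.mem_Icc.1 hu).2
      exact ⟨s, fun _ => hs⟩
    · exact ⟨0, fun h => absurd h hu⟩
  choose τ hτ using hex
  set Z : Finset ℕ := {s ∈ Finset.Icc 1 T | R.counter s ω = 0} with hZdef
  have hZ : Z ⊆ Finset.Icc 1 T := Finset.filter_subset _ _
  have hτZ : ∀ u ∈ Finset.Icc 1 T, τ u ∈ Z := fun u hu =>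
    Finset.mem_filter.2 ⟨(hτ u hu).mem, (hτ u hu).counter_eq_zero⟩
  have hZcard : (Z.card : ℝ) = R.resampleCount ω := by
    rw [R.resampleCount_eq, resamplesBefore]
    rfl
  have hbonus0 : ∀ s ∈ Z, 0 ≤ R.bonus s ω := fun s hs =>
    le_trans (by positivity) (hlow s (hZ hs))
  have hlen : ∀ s ∈ Z, R.bonus s ω ≠ 0 →
      ({u ∈ Finset.Icc 1 T | τ u = s}.card : ℝ) ≤ γ / R.bonus s ω ^ 2 + 1 := by
    intro s hs hb
    have hn : 0 < γ / R.bonus s ω ^ 2 := by positivity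
    have hsub : {u ∈ Finset.Icc 1 T | τ u = s} ⊆ Finset.Ico s (s + ⌈γ / R.bonus s ω ^ 2⌉₊) := by
      intro u hu
      obtain ⟨hu1, hu2⟩ := Finset.mem_filter.1 hu
      have hph := hτ u hu1
      rw [hu2] at hph
      have hlt := hph.lt
      have hpos := Nat.ceil_pos.2 hn
      rw [Finset.mem_Ico]
      refine ⟨by omega, ?_⟩
      rcases (Nat.lt_succ_iff.1 hlt).eq_or_lt with h | h
      · omega
      · have h2 := hph.lt_phaseLength u h u.lt_succ_self
        rw [phaseLength, if_neg hb, Nat.cast_lt] at h2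
        omega
    calc ({u ∈ Finset.Icc 1 T | τ u = s}.card : ℝ) ≤ (⌈γ / R.bonus s ω ^ 2⌉₊ : ℝ) := by
          have := Finset.card_le_card hsub
          rw [Nat.card_Ico, Nat.add_sub_cancel_left] at this
          exact_mod_cast this
      _ ≤ _ := (Nat.ceil_lt_add_one hn.le).le
  have hfib : ∀ f : ℕ → ℝ, ∑ u ∈ Finset.Icc 1 T, f (τ u) =
      ∑ s ∈ Z, ({u ∈ Finset.Icc 1 T | τ u = s}.card : ℝ) * f s := by
    intro f
    rw [← Finset.sum_fiberwise_of_maps_to' hτZ]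
    simp
  -- The two indicators separate phases by their initial width. Below 1, the width is at most 2
  -- log(1 + width); from 1 on, 2 log(1 + width) is at least 1.
  let I₁ : ℕ → ℝ := fun s => if 1 ≤ R.width s ω then 1 else 0
  let I₂ : ℕ → ℝ := fun s => if 1 ≤ R.width s ω then 0 else R.bonus s ω
  have hround : ∀ u ∈ Finset.Icc 1 T,
      (⨆ b : Fin A, inner ℝ (x b) θstar) - inner ℝ (x (R.act u ω)) θstar ≤
        D * I₁ (τ u) + C₁ * I₂ (τ u) := by
    intro u hu
    have hph := hτ u hu
    by_cases h1 : 1 ≤ R.width (τ u) ω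
    · simpa [I₁, I₂, h1] using hD _
    · simp only [I₁, I₂, h1, if_false, mul_zero, zero_add]
      rw [hph.act_eq u (Nat.lt_succ_iff.1 hph.lt) u.lt_succ_self]
      exact hgap _ hph.mem hph.counter_eq_zero
  have hlogw : ∀ s, R.width s ω / (1 + R.width s ω) ≤ Real.log (1 + R.width s ω) := by
    intro s
    have h := Real.one_sub_inv_le_log_of_pos (by linarith [hq s] : 0 < 1 + R.width s ω)
    have h2 : 1 - (1 + R.width s ω)⁻¹ = R.width s ω / (1 + R.width s ω) := by
      have : 1 + R.width s ω ≠ 0 := by linarith [hq s]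
      field_simp
      ring
    rwa [h2] at h
  have hsumlog := R.sum_log_width_le hd hlam hB0 hB ω hZ
  have hS₁ : ∑ u ∈ Finset.Icc 1 T, I₁ (τ u) ≤ (γ / (β ^ 2 * c ^ 2) + 1) * (2 * E) := by
    rw [hfib]
    calc _ ≤ ∑ s ∈ Z, (γ / (β ^ 2 * c ^ 2) + 1) * (2 * Real.log (1 + R.width s ω)) := by
          refine Finset.sum_le_sum fun s hs => ?_
          have hl0 : 0 ≤ Real.log (1 + R.width s ω) := Real.log_nonneg (by linarith [hq s])
          by_cases h1 : 1 ≤ R.width s ω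
          · simp only [I₁, h1, if_true, mul_one]
            have hsq : 1 ≤ √(R.width s ω) := Real.one_le_sqrt.2 h1
            have hb : β * c ≤ R.bonus s ω := by
              refine le_trans ?_ (hlow s (hZ hs))
              have : β * (c * 1) ≤ β * (c * √(R.width s ω)) := by gcongr
              simpa using this
            have hb0 : 0 < R.bonus s ω := lt_of_lt_of_le (by positivity) hb
            have h2 : γ / R.bonus s ω ^ 2 ≤ γ / (β ^ 2 * c ^ 2) := by
              rw [← mul_pow]; gcongr
            have h3 : 1 ≤ 2 * Real.log (1 + R.width s ω) := by
              have := hlogw s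
              have h4 : 1 / 2 ≤ R.width s ω / (1 + R.width s ω) := by
                rw [div_le_div_iff₀ (by norm_num) (by linarith)]; linarith
              linarith
            have h5 := hlen s hs hb0.ne'
            have h6 : 0 < γ / (β ^ 2 * c ^ 2) := by positivity
            nlinarith
          · simp only [I₁, h1, if_false, mul_zero]
            positivity
      _ = (γ / (β ^ 2 * c ^ 2) + 1) * (2 * ∑ s ∈ Z, Real.log (1 + R.width s ω)) := by
          rw [← Finset.mul_sum, ← Finset.mul_sum]
      _ ≤ _ := by gcongr
  have hS₂ : ∑ u ∈ Finset.Icc 1 T, I₂ (τ u) ^ 2 ≤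
      R.resampleCount ω * γ + β ^ 2 * z ^ 2 * (2 * E) := by
    rw [hfib fun s => I₂ s ^ 2]
    calc _ ≤ ∑ s ∈ Z, (γ + β ^ 2 * z ^ 2 * (2 * Real.log (1 + R.width s ω))) := by
          refine Finset.sum_le_sum fun s hs => ?_
          have hl0 : 0 ≤ Real.log (1 + R.width s ω) := Real.log_nonneg (by linarith [hq s])
          have hrhs : 0 ≤ β ^ 2 * z ^ 2 * (2 * Real.log (1 + R.width s ω)) := by positivity
          by_cases h1 : 1 ≤ R.width s ω
          · simp only [I₂, h1, if_true]
            nlinarith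
          · simp only [I₂, h1, if_false]
            by_cases hb : R.bonus s ω = 0
            -- A phase of infinite length has bonus 0 and contributes nothing.
            · rw [hb]; nlinarith
            · have h2 := hlen s hs hb
              have hb2 : 0 < R.bonus s ω ^ 2 := by positivity
              have h3 : R.bonus s ω ^ 2 ≤ β ^ 2 * z ^ 2 * R.width s ω := by
                calc _ = |R.bonus s ω| ^ 2 := (sq_abs _).symm
                  _ ≤ (β * (z * √(R.width s ω))) ^ 2 := by gcongr; exact hup s (hZ hs)
                  _ = _ := by rw [mul_pow, mul_pow, Real.sq_sqrt (hq s)]; ring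
              have h4 : R.width s ω ≤ 2 * Real.log (1 + R.width s ω) := by
                have := hlogw s
                have h5 : R.width s ω / 2 ≤ R.width s ω / (1 + R.width s ω) := by
                  have := hq s
                  have := not_le.1 h1
                  gcongr
                  linarith
                linarith
              -- The extra 1 in the phase length comes from the ceiling; it is the source of the
              -- summand bonus².
              calc _ ≤ (γ / R.bonus s ω ^ 2 + 1) * R.bonus s ω ^ 2 := by gcongr
                _ = γ + R.bonus s ω ^ 2 := by field_simp
                _ ≤ γ + β ^ 2 * z ^ 2 * R.width s ω := by gcongr
                _ ≤ _ := by gcongr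
      _ = Z.card * γ + β ^ 2 * z ^ 2 * (2 * ∑ s ∈ Z, Real.log (1 + R.width s ω)) := by
          rw [Finset.sum_add_distrib, ← Finset.mul_sum, ← Finset.mul_sum]
          simp
      _ ≤ _ := by rw [hZcard]; gcongr
  have hCS : ∑ u ∈ Finset.Icc 1 T, I₂ (τ u) ≤
      √(T * (R.resampleCount ω * γ + β ^ 2 * z ^ 2 * (2 * E))) := by
    refine Real.le_sqrt_of_sq_le ?_
    have h := sq_sum_le_card_mul_sum_sq (s := Finset.Icc 1 T) (f := fun u => I₂ (τ u))
    rw [Nat.card_Icc, Nat.add_sub_cancel] at h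
    exact h.trans (by gcongr)
  calc R.regret ω ≤ ∑ u ∈ Finset.Icc 1 T, (D * I₁ (τ u) + C₁ * I₂ (τ u)) :=
        Finset.sum_le_sum hround
    _ = D * ∑ u ∈ Finset.Icc 1 T, I₁ (τ u) + C₁ * ∑ u ∈ Finset.Icc 1 T, I₂ (τ u) := by
        rw [Finset.sum_add_distrib, Finset.mul_sum, Finset.mul_sum]
    _ ≤ _ := by gcongr

end LazyACBRun

/-! ### Optimism and elementary regret bounds -/

namespace LazyACBRun

variable {Ω : Type*} [mΩ : MeasurableSpace Ω] {P : Measure Ω} {d A : ℕ}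
  {x : Fin A → EuclideanSpace ℝ (Fin d)} {θstar : EuclideanSpace ℝ (Fin d)}
  {σ : ℝ} {M : ℕ} {lam β γ : ℝ} {T : ℕ} (R : LazyACBRun P x θstar σ M lam β γ T)

/-- In a round in which the best action is predicted optimistically, the instantaneous regret is
controlled by the bonus of the chosen action. -/
theorem gap_le_bonus (hlam : 0 < lam) (hβ : 0 < β) {W rad r c : ℝ} (hθ : ‖θstar‖ ≤ W) (hc : 0 < c)
    {t : ℕ} (ht : t ∈ Finset.Icc 1 T) {ω : Ω} (h0 : R.counter t ω = 0) {b₀ : Fin A}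
    (hb₀ : ∀ b, inner ℝ (x b) θstar ≤ inner ℝ (x b₀) θstar)
    (hrad : √lam * W + √(invNormSq (R.design t ω)
      (∑ i ∈ Finset.Ico 1 t, R.ε i ω • (x (R.act i ω)).ofLp)) ≤ rad)
    (hr0 : 0 ≤ r) (hr : rad ≤ β * r)
    (hopt : ∃ j, r * √(invNormSq (R.design t ω) (x b₀).ofLp) ≤ |R.pred t j (x b₀).ofLp ω|)
    (hlow : β * (c * √(R.width t ω)) ≤ R.bonus t ω) :
    (⨆ b : Fin A, inner ℝ (x b) θstar) - inner ℝ (x (R.act t ω)) θstar ≤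
      (1 + r / c) * R.bonus t ω := by
  have : Nonempty (Fin A) := ⟨b₀⟩
  have hsup : (⨆ b : Fin A, inner ℝ (x b) θstar) ≤ inner ℝ (x b₀) θstar := ciSup_le hb₀
  have hconf : ∀ b, |inner ℝ (x b) (R.thetaHat t ω) - inner ℝ (x b) θstar| ≤
      β * r * √(invNormSq (R.design t ω) (x b).ofLp) := by
    intro b
    rw [EuclideanSpace.inner_eq_dotProduct, EuclideanSpace.inner_eq_dotProduct]
    refine (abs_dotProduct_ridge_sub_le hlam _ θstar _ t (R.thetaHat_argmin t ht ω h0) _).trans ?_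
    refine mul_le_mul_of_nonneg_right (le_trans ?_ hr) (Real.sqrt_nonneg _)
    refine le_trans ?_ hrad
    rw [design]
    gcongr
  have hidx := R.act_argmax t ht ω h0 b₀
  rw [R.acbBonus_eq hlam ht h0, R.acbBonus_eq hlam ht h0] at hidx
  change _ ≤ _ + R.bonus t ω at hidx
  have hopt' : β * r * √(invNormSq (R.design t ω) (x b₀).ofLp) ≤
      β * ⨆ j, |R.pred t j (x b₀).ofLp ω| := by
    obtain ⟨j, hj⟩ := hopt
    rw [mul_assoc]
    gcongr
    exact hj.trans (le_ciSup (f := fun j => |R.pred t j (x b₀).ofLp ω|)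
      (Set.finite_range _).bddAbove j)
  have h1 := (abs_le.1 (hconf b₀)).1
  have h2 := (abs_le.1 (hconf (R.act t ω))).2
  have h3 : β * r * √(invNormSq (R.design t ω) (x (R.act t ω)).ofLp) ≤ r / c * R.bonus t ω := by
    calc _ = r / c * (β * (c * √(R.width t ω))) := by rw [width]; field_simp
      _ ≤ _ := by gcongr
  -- Optimism: the true value of the best action is below its index, hence below the index of the
  -- chosen action. Passing back to the true value of the latter costs its confidence width, which
  -- `h3` converts into bonus.
  linarith

theorem resamplesBefore_lt_resampleCount {t : ℕ} (ht : t ∈ Finset.Icc 1 T) {ω : Ω}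
    (h0 : R.counter t ω = 0) : R.resamplesBefore t ω < R.resampleCount ω := by
  rw [R.resampleCount_eq]
  rw [Finset.mem_Icc] at ht
  refine Finset.card_lt_card (Finset.ssubset_iff_of_subset ?_ |>.2 ⟨t, ?_, ?_⟩)
  · exact Finset.filter_subset_filter _ (Finset.Ico_subset_Ico_right (by omega))
  · simp only [Finset.mem_filter, Finset.mem_Ico]
    exact ⟨⟨ht.1, by omega⟩, h0⟩
  · simp

theorem resampleCount_le (ω : Ω) : R.resampleCount ω ≤ T := by
  rw [R.resampleCount_eq]
  refine (Finset.card_filter_le _ _).trans ?_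
  simp

theorem gap_le [NeZero A] {B W : ℝ} (hB : ∀ b, ‖x b‖ ^ 2 ≤ B) (hθ : ‖θstar‖ ≤ W) (b : Fin A) :
    (⨆ b : Fin A, inner ℝ (x b) θstar) - inner ℝ (x b) θstar ≤ 2 * (√B * W) := by
  have h : ∀ b, |inner ℝ (x b) θstar| ≤ √B * W := fun b =>
    (abs_real_inner_le_norm _ _).trans (mul_le_mul (Real.le_sqrt_of_sq_le (hB b)) hθ
      (norm_nonneg _) (Real.sqrt_nonneg _))
  have h1 : (⨆ b : Fin A, inner ℝ (x b) θstar) ≤ √B * W := ciSup_le fun b => (abs_le.1 (h b)).2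
  have h2 := (abs_le.1 (h b)).1
  linarith

theorem regret_le_mul {D : ℝ}
    (hD : ∀ b, (⨆ b : Fin A, inner ℝ (x b) θstar) - inner ℝ (x b) θstar ≤ D) (ω : Ω) :
    R.regret ω ≤ T * D := by
  calc R.regret ω ≤ ∑ t ∈ Finset.Icc 1 T, D := Finset.sum_le_sum fun t _ => hD _
    _ = _ := by simp

theorem regret_eq_zero_of_subsingleton [Subsingleton (Fin A)] (ω : Ω) : R.regret ω = 0 := by
  refine Finset.sum_eq_zero fun t _ => ?_
  have : Nonempty (Fin A) := ⟨R.act t ω⟩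
  rw [ciSup_subsingleton (R.act t ω), sub_self]

end LazyACBRun

/-! ### Numerical estimates -/

section Numerics

theorem gaussBall_mono {c c' : ℝ} (h : c ≤ c') : gaussBall c ≤ gaussBall c' :=
  measureReal_mono fun _ hx => lt_of_lt_of_le hx h

theorem sqrt_pi_mul_log_two_div_two_lt : √(Real.pi * Real.log 2 / 2) < 1.04346 := by
  rw [Real.sqrt_lt' (by norm_num)]
  nlinarith [Real.pi_lt_d6, Real.log_two_lt_d9, Real.pi_gt_d6, Real.log_two_gt_d9]

theorem one_lt_pi_mul_log_two_div_two : 1 < Real.pi * Real.log 2 / 2 := by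
  nlinarith [Real.pi_gt_d6, Real.log_two_gt_d9]

/-- The threshold √(π log 2 / 2) is tied to the normalization of β: each member falls below it with
probability at most 2^(-1/2). -/
theorem gaussBall_sqrt_le : gaussBall √(Real.pi * Real.log 2 / 2) ≤ Real.exp (-(Real.log 2 / 2)) := by
  refine (gaussBall_mono sqrt_pi_mul_log_two_div_two_lt.le).trans
    ((gaussBall_le (by norm_num)).trans ?_)
  rw [Real.exp_neg, Real.exp_half, Real.exp_log (by norm_num)]
  refine le_trans (b := (1.4143 : ℝ)⁻¹) (by norm_num) ?_
  gcongr
  rw [Real.sqrt_le_left (by norm_num)]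
  norm_num

/-- The shrunk threshold for small κ. The exponent has to exceed 1/2 by a margin that
`min_mul_exp_le` uses up. -/
theorem gaussBall_mul_sqrt_le :
    gaussBall (0.72 * √(Real.pi * Real.log 2 / 2)) ≤ Real.exp (-0.59) := by
  have h : 0.72 * √(Real.pi * Real.log 2 / 2) ≤ 0.7513 := by
    nlinarith [sqrt_pi_mul_log_two_div_two_lt]
  refine (gaussBall_mono h).trans ((gaussBall_le (by norm_num)).trans ?_)
  have h1 : Real.exp 0.59 ≤ 1.818 := by
    -- The fraction 19/32 lies slightly above 0.59, and the 32nd power reduces the claim to a bound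
    -- on e^19.
    have h2 : Real.exp (19 / 32) ^ 32 ≤ 1.818 ^ 32 := by
      rw [← Real.exp_nat_mul]
      calc Real.exp ((32 : ℕ) * (19 / 32)) = Real.exp 1 ^ 19 := by
            rw [← Real.exp_nat_mul]; norm_num
        _ ≤ 2.7182818286 ^ 19 := by gcongr; exact Real.exp_one_lt_d9.le
        _ ≤ _ := by norm_num
    calc Real.exp 0.59 ≤ Real.exp (19 / 32) := Real.exp_le_exp.2 (by norm_num)
      _ ≤ _ := le_of_pow_le_pow_left₀ (by norm_num) (by norm_num) h2
  rw [Real.exp_neg]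
  refine le_trans (b := (1.818 : ℝ)⁻¹) (by norm_num) ?_
  gcongr

theorem gaussBall_pow_le {r q L κ : ℝ} {M : ℕ} (hr : gaussBall r ≤ Real.exp (-q)) (hq : 0 ≤ q)
    (hM : κ * L ≤ M) : gaussBall r ^ M ≤ Real.exp (-(q * (κ * L))) := by
  calc gaussBall r ^ M ≤ Real.exp (-q) ^ M := pow_le_pow_left₀ (gaussBall_nonneg r) hr M
    _ = Real.exp (-(q * M)) := by rw [← Real.exp_nat_mul]; ring_nf
    _ ≤ _ := Real.exp_le_exp.2 (by nlinarith)

/-- From log(1 + u) ≥ u / (1 + u) with u = ρ/z, the logarithm is at least ρ/(z + ρ) ≥ 1/(2z). -/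
theorem le_of_sub_one_mul_log_le {N ρ z Φ : ℝ} (hρ : 1 ≤ ρ) (hz : 1 ≤ z) (hΦ : 0 ≤ Φ)
    (h : (N - 1) * Real.log (1 + ρ / z) ≤ Φ) : N ≤ 1 + 2 * z * Φ := by
  rcases le_total N 1 with hN | hN
  · nlinarith [mul_nonneg (by linarith : 0 ≤ z) hΦ]
  have hρz : 0 < ρ / z := by positivity
  have h1 := Real.one_sub_inv_le_log_of_pos (by linarith : 0 < 1 + ρ / z)
  have h2 : (2 * z)⁻¹ ≤ 1 - (1 + ρ / z)⁻¹ := by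
    have e : 1 - (1 + ρ / z)⁻¹ = ρ / (z + ρ) := by
      have : z + ρ ≠ 0 := by linarith
      field_simp
      ring
    rw [e, inv_eq_one_div, div_le_div_iff₀ (by positivity) (by positivity)]
    nlinarith
  have h3 : (N - 1) * (2 * z)⁻¹ ≤ Φ :=
    le_trans (mul_le_mul_of_nonneg_left (h2.trans h1) (by linarith)) h
  rw [← div_eq_mul_inv, div_le_iff₀ (by positivity)] at h3
  linarith

theorem log_le_two_mul_logPlus {y : ℝ} (hy : 0 < y) : Real.log (1 + y) ≤ 2 * logPlus y := by
  have h1 : 1 ≤ logPlus y := le_max_left _ _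
  have h2 : Real.log y ≤ logPlus y := le_max_right _ _
  rcases le_total y 1 with h | h
  · have := Real.log_le_sub_one_of_pos (by linarith : 0 < 1 + y)
    linarith
  · calc Real.log (1 + y) ≤ Real.log (2 * y) := Real.log_le_log (by linarith) (by linarith)
      _ = Real.log 2 + Real.log y := Real.log_mul (by norm_num) hy.ne'
      _ ≤ _ := by linarith [Real.log_two_lt_d9]

theorem log_le_three_mul_logPlus {y w : ℝ} (hy : 1 ≤ y) (hw : 0 < w) :
    Real.log (1 + y * w ^ 2) ≤ 3 * logPlus (y * w) := by
  have h1 : 1 ≤ logPlus (y * w) := le_max_left _ _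
  have h2 : Real.log (y * w) ≤ logPlus (y * w) := le_max_right _ _
  have hyw : 0 < y * w := by positivity
  have h3 : y * w ^ 2 ≤ (y * w) ^ 2 := by nlinarith [sq_nonneg w]
  rcases le_total (y * w) 1 with h | h
  · have h4 : (y * w) ^ 2 ≤ 1 := by nlinarith
    have := Real.log_le_sub_one_of_pos (by positivity : 0 < 1 + y * w ^ 2)
    linarith
  · calc Real.log (1 + y * w ^ 2) ≤ Real.log (2 * (y * w) ^ 2) :=
          Real.log_le_log (by positivity) (by nlinarith)
      _ = Real.log 2 + 2 * Real.log (y * w) := by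
          rw [Real.log_mul (by norm_num) (by positivity), Real.log_pow]; norm_num
      _ ≤ _ := by linarith [Real.log_two_lt_d9]

theorem log_four_add_le {c g : ℝ} (hc : 0 ≤ c) (hg : 12000000 * (1 + c) ≤ g) :
    Real.log 2 + Real.log (1 + c * g ^ 2) ≤ 0.01 * g := by
  have hg1 : 1 ≤ g := by nlinarith
  rw [← Real.log_mul (by norm_num) (by positivity), Real.log_le_iff_le_exp (by positivity)]
  -- The cubic term (0.01 g)³/6 of the exponential already exceeds 2(1 + c)g² once g ≥ 12000000 (1 +
  -- c).
  have h := Real.pow_div_factorial_le_exp (0.01 * g) (by positivity) 3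
  refine le_trans ?_ h
  have h2 : 1 + c * g ^ 2 ≤ (1 + c) * g ^ 2 := by nlinarith
  have h3 : (12000000 * (1 + c)) * g ^ 2 ≤ g * g ^ 2 := by gcongr
  norm_num [Nat.factorial]
  nlinarith

/-- The number of re-randomizations among few actions is negligible against the failure
probability of the ensemble. -/
theorem min_mul_exp_le {a τ e c Lr : ℝ} {K : ℝ} (ha : 0 ≤ a) (heτ : 4 * e ≤ τ)
    (hc : 0 ≤ c) (hτ : 12000000 * (1 + c) ≤ τ) (hK0 : 0 ≤ K) (hKT : K ≤ Real.exp τ)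
    (hKA : K ≤ Real.exp a * (1 + c * (a + τ) ^ 2)) (hLr : Lr = a + τ + e) :
    K * Real.exp (-(0.59 * Lr)) ≤ Real.exp (-e) / 2 := by
  rcases hK0.eq_or_lt with h0 | hK
  · rw [← h0, zero_mul]; positivity
  have hτ0 : 0 ≤ τ := by nlinarith
  have hY : 0 < 1 + c * (a + τ) ^ 2 := by positivity
  have h1 : Real.log K ≤ τ := (Real.log_le_iff_le_exp hK).2 hKT
  have h2 : Real.log K ≤ a + Real.log (1 + c * (a + τ) ^ 2) := by
    rw [Real.log_le_iff_le_exp hK, Real.exp_add, Real.exp_log hY]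
    exact hKA
  have h3 := log_four_add_le hc (hτ.trans (by linarith : τ ≤ a + τ))
  have h4 : 0 ≤ Real.log (1 + c * (a + τ) ^ 2) :=
    Real.log_nonneg (by have := mul_nonneg hc (sq_nonneg (a + τ)); linarith)
  have e1 : K * Real.exp (-(0.59 * Lr)) = Real.exp (Real.log K - 0.59 * Lr) := by
    rw [sub_eq_add_neg, Real.exp_add, Real.exp_log hK]
  have e2 : Real.exp (-e) / 2 = Real.exp (-e - Real.log 2) := by
    rw [Real.exp_sub, Real.exp_log (by norm_num)]
  rw [e1, e2, Real.exp_le_exp, hLr]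
  -- A weighted mean of the two bounds on log K, for instance with weights 0.45 and 0.55, suffices:
  -- with e ≤ τ/4 and the logarithmic term below 0.01 (a + τ), all coefficients stay under 0.59.
  linarith

end Numerics

/-! ### Collecting constants -/

section Bounds

/-- Here `la` is log A, `ℓ` is log(T/δ), `X` is dΛ, `zz` is z² and `β₀²` is γ. Since `la` and `ℓ`
are at least 1/2, sums of them are at most 4 la ℓ. Under the root, β₀² = O(σ²Xℓ) meets N + 2 zz E =
O(la ℓ X), which produces X ℓ √la. -/
theorem regret_bound_real {σ t la ℓ X E N β₀ zz Cz G C₁ : ℝ} (hσ : 0 < σ) (ht : 0 ≤ t)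
    (hla : 1 / 2 ≤ la) (hℓ : 1 / 2 ≤ ℓ) (hX : 1 ≤ X) (hE0 : 0 ≤ E) (hE : E ≤ 3 * X)
    (hzz : zz ≤ Cz * (la + ℓ)) (hCz : 0 ≤ Cz) (hN : N ≤ 1 + 2 * zz * E)
    (hβ0 : 0 ≤ β₀) (hβ : β₀ ≤ σ + √2 * σ * √(E + ℓ)) (hG : 0 ≤ G) (hC₁ : 0 ≤ C₁) :
    2 * (σ * √t) * (G * (2 * E)) + C₁ * √(t * (N * β₀ ^ 2 + β₀ ^ 2 * zz * (2 * E))) ≤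
      (48 * G + C₁ * √(128 * (1 + 12 * Cz))) * (σ * X * √(t * la) * ℓ) := by
  have hs : √t / 2 ≤ √(t * la) := by
    rw [Real.sqrt_mul ht]
    have : 1 / 2 ≤ √la := Real.le_sqrt_of_sq_le (by norm_num; linarith)
    nlinarith [Real.sqrt_nonneg t]
  have hℓX : 1 / 2 ≤ ℓ * X := by nlinarith
  have h1 : 2 * (σ * √t) * (G * (2 * E)) ≤ 48 * G * (σ * X * √(t * la) * ℓ) := by
    have h2 : √t / 2 * (1 / 2) ≤ √(t * la) * ℓ := by gcongr
    have h3 : σ * G * (√t * E) ≤ σ * G * (√t * (3 * X)) := by gcongr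
    have h4 : σ * G * X * (√t / 2 * (1 / 2)) ≤ σ * G * X * (√(t * la) * ℓ) := by gcongr
    nlinarith
  have hβ2 : β₀ ^ 2 ≤ 32 * σ ^ 2 * (X * ℓ) := by
    have h2 : (√2 * √(E + ℓ)) ^ 2 = 2 * (E + ℓ) := by
      rw [mul_pow, Real.sq_sqrt (by norm_num), Real.sq_sqrt (by linarith)]
    calc β₀ ^ 2 ≤ (σ + √2 * σ * √(E + ℓ)) ^ 2 := by gcongr
      _ = σ ^ 2 * (1 + √2 * √(E + ℓ)) ^ 2 := by ring
      _ ≤ σ ^ 2 * (2 * (1 + (√2 * √(E + ℓ)) ^ 2)) := by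
          gcongr
          nlinarith [sq_nonneg (1 - √2 * √(E + ℓ))]
      _ = σ ^ 2 * (2 * (1 + 2 * (E + ℓ))) := by rw [h2]
      _ ≤ σ ^ 2 * (32 * (X * ℓ)) := mul_le_mul_of_nonneg_left (by nlinarith) (sq_nonneg σ)
      _ = _ := by ring
  have hfac : N + zz * (2 * E) ≤ 4 * (1 + 12 * Cz) * (la * ℓ * X) := by
    have h2 : zz * E ≤ Cz * (la + ℓ) * (3 * X) := by gcongr
    have h3 : la + ℓ ≤ 4 * (la * ℓ) := by nlinarith
    have h4 : Cz * (la + ℓ) * (3 * X) ≤ Cz * (4 * (la * ℓ)) * (3 * X) := by gcongr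
    have h5 : 1 ≤ 4 * (la * ℓ * X) := by nlinarith [mul_le_mul hla hℓX (by norm_num) (by linarith)]
    nlinarith
  have h2 : √(t * (N * β₀ ^ 2 + β₀ ^ 2 * zz * (2 * E))) ≤
      √(128 * (1 + 12 * Cz)) * (σ * X * √(t * la) * ℓ) := by
    refine Real.sqrt_le_iff.2 ⟨by positivity, ?_⟩
    have e : (√(128 * (1 + 12 * Cz)) * (σ * X * √(t * la) * ℓ)) ^ 2 =
        128 * (1 + 12 * Cz) * (σ ^ 2 * X ^ 2 * (t * la) * ℓ ^ 2) := by
      rw [mul_pow, Real.sq_sqrt (by positivity), mul_pow, mul_pow, mul_pow,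
        Real.sq_sqrt (by positivity)]
    rw [e]
    calc _ = t * (β₀ ^ 2 * (N + zz * (2 * E))) := by ring
      _ ≤ t * (β₀ ^ 2 * (4 * (1 + 12 * Cz) * (la * ℓ * X))) := by gcongr
      _ ≤ t * (32 * σ ^ 2 * (X * ℓ) * (4 * (1 + 12 * Cz) * (la * ℓ * X))) := by gcongr
      _ = _ := by ring
  calc _ ≤ 48 * G * (σ * X * √(t * la) * ℓ) +
        C₁ * (√(128 * (1 + 12 * Cz)) * (σ * X * √(t * la) * ℓ)) := by gcongr
    _ = _ := by ring

theorem trivial_regret_real {σ t la ℓ X C : ℝ} (hσ : 0 < σ) (ht : 0 ≤ t)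
    (hla : 1 / 2 ≤ la) (hℓ : 1 / 2 ≤ ℓ) (hX : 0 ≤ X) (hC : 0 ≤ C) (htX : t ≤ C * X) :
    t * (2 * (σ * √t)) ≤ 8 * C * (σ * X * √(t * la) * ℓ) := by
  have hs : √t / 2 ≤ √(t * la) := by
    rw [Real.sqrt_mul ht]
    have : 1 / 2 ≤ √la := Real.le_sqrt_of_sq_le (by norm_num; linarith)
    nlinarith [Real.sqrt_nonneg t]
  calc t * (2 * (σ * √t)) ≤ C * X * (2 * (σ * √t)) := by gcongr
    _ = 8 * C * (σ * X * (√t / 2) * (1 / 2)) := by ring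
    _ ≤ _ := by gcongr

/-- The ensemble size is at most linear in D, so it adds only a constant factor to the logarithm;
additive constants are absorbed by log D ≥ log 2. -/
theorem two_mul_log_le {κ D M : ℝ} (hκ : 1 ≤ κ) (hD : 2 ≤ D) (hM0 : 0 < M)
    (hM : M ≤ κ * Real.log D + 1) :
    2 * Real.log (32 * D * M) ≤
      2 * (Real.log (32 * (κ + 1)) / Real.log 2 + 2) * Real.log D := by
  have hlogD : Real.log 2 ≤ Real.log D := Real.log_le_log (by norm_num) hD
  have h2 : 0 < Real.log 2 := Real.log_pos (by norm_num)
  have hMD : M ≤ (κ + 1) * D := by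
    have := Real.log_le_sub_one_of_pos (by linarith : 0 < D)
    nlinarith
  have h1 : Real.log (32 * D * M) ≤ Real.log (32 * (κ + 1)) + 2 * Real.log D := by
    calc _ ≤ Real.log (32 * (κ + 1) * D ^ 2) :=
          Real.log_le_log (by positivity) (by nlinarith)
      _ = _ := by
          rw [Real.log_mul (by positivity) (by positivity), Real.log_pow]; norm_num
  have h3 : 0 ≤ Real.log (32 * (κ + 1)) := Real.log_nonneg (by linarith)
  have h4 : Real.log (32 * (κ + 1)) ≤ Real.log (32 * (κ + 1)) / Real.log 2 * Real.log D := by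
    rw [div_mul_eq_mul_div, le_div_iff₀ h2]
    gcongr
  linarith

theorem ofReal_one_sub_le_measure {Ω : Type*} [MeasurableSpace Ω] {P : Measure Ω}
    [IsProbabilityMeasure P] {δ : ℝ} {S F : Set Ω} (hδ : 0 ≤ δ) (hF : P F ≤ ENNReal.ofReal δ)
    (h : ∀ ω, ω ∉ F → ω ∈ S) : ENNReal.ofReal (1 - δ) ≤ P S := by
  have h1 : (1 : ENNReal) ≤ P S + P F := by
    rw [← measure_univ (μ := P)]
    refine (measure_mono fun ω _ => ?_).trans (measure_union_le S F)
    by_cases hω : ω ∈ F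
    · exact Or.inr hω
    · exact Or.inl (h ω hω)
  rw [ENNReal.ofReal_sub _ hδ, ENNReal.ofReal_one, tsub_le_iff_right]
  exact h1.trans (by gcongr)

end Bounds

/-! ### The failure event -/

namespace LazyACBRun

variable {Ω : Type*} [mΩ : MeasurableSpace Ω] {P : Measure Ω} {d A : ℕ}
  {x : Fin A → EuclideanSpace ℝ (Fin d)} {θstar : EuclideanSpace ℝ (Fin d)}
  {σ : ℝ} {M : ℕ} {lam β γ : ℝ} {T : ℕ} (R : LazyACBRun P x θstar σ M lam β γ T)

/-- The event that some prediction of the ensemble exceeds `z` standard deviations. -/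
def overshoot (z : ℝ) : Set Ω :=
  {ω | ∃ t ∈ Finset.Icc 1 T, ∃ b : Fin A, ∃ j,
    z * √(invNormSq (R.design t ω) (x b).ofLp) < |R.pred t j (x b).ofLp ω|}

theorem measure_overshoot_le [IsProbabilityMeasure P] (hlam : 0 < lam) {δ : ℝ} (hδ : 0 < δ) (hδ1 : δ < 1) (hA : 1 ≤ A)
    (hT : 2 ≤ T) (hM : 0 < M) :
    P (R.overshoot √(2 * Real.log (32 * (A * T / δ) * M))) ≤ ENNReal.ofReal (δ / 16) := by
  have hA' : (1 : ℝ) ≤ A := by exact_mod_cast hA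
  have hT' : (2 : ℝ) ≤ T := by exact_mod_cast hT
  have hM' : (1 : ℝ) ≤ M := by exact_mod_cast hM
  have hD : 1 ≤ A * T / δ := by rw [le_div_iff₀ hδ]; nlinarith
  have hpos : 0 < 32 * (A * T / δ) * M := by positivity
  have hlog : 0 ≤ Real.log (32 * (A * T / δ) * M) := Real.log_nonneg (by nlinarith)
  refine (R.measure_exists_pred_gt_le hlam (Real.sqrt_nonneg _)).trans (ENNReal.ofReal_le_ofReal ?_)
  rw [Real.sq_sqrt (by positivity), show -(2 * Real.log (32 * (A * T / δ) * M)) / 2 =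
    -Real.log (32 * (A * T / δ) * M) by ring, Real.exp_neg, Real.exp_log hpos]
  apply le_of_eq
  field_simp
  norm_num

theorem pred_le_of_notMem_overshoot {z : ℝ} {ω : Ω} (h : ω ∉ R.overshoot z) :
    ∀ t ∈ Finset.Icc 1 T, ∀ b j,
      |R.pred t j (x b).ofLp ω| ≤ z * √(invNormSq (R.design t ω) (x b).ofLp) := by
  intro t ht b j
  by_contra h'
  exact h ⟨t, ht, b, j, not_le.1 h'⟩

/-- Outside an event of probability at most `δ`, the reward estimates are accurate, the ensemble
predictions have the right order of magnitude, and the best action is predicted optimistically in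
the first `K` re-randomizations. -/
theorem exists_bad_event [IsProbabilityMeasure P] (hlam : 0 < lam) (hσ : 0 < σ) {δ κ : ℝ} (hκ : 1 ≤ κ) (hδ : 0 < δ)
    (hδ1 : δ < 1) (hA : 1 ≤ A) (hT : 2 ≤ T) (hM0 : 0 < M) (hM : κ * Real.log (A * T / δ) ≤ M)
    (b₀ : Fin A) {K : ℕ} {r : ℝ} (hK : K * gaussBall r ^ M ≤ δ / 2) :
    ∃ F : Set Ω, P F ≤ ENNReal.ofReal δ ∧ ∀ ω ∉ F,
      ω ∉ R.overshoot √(2 * Real.log (32 * (A * T / δ) * M)) ∧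
      (∀ t ∈ Finset.Icc 1 T, ∀ b, ∃ j,
        Real.exp (-4) * √(invNormSq (R.design t ω) (x b).ofLp) ≤ |R.pred t j (x b).ofLp ω|) ∧
      (∀ t ∈ Finset.Icc 1 T, R.counter t ω = 0 → R.resamplesBefore t ω < K → ∃ j,
        r * √(invNormSq (R.design t ω) (x b₀).ofLp) ≤ |R.pred t j (x b₀).ofLp ω|) ∧
      ∀ t ∈ Finset.Icc 1 T,
        invNormSq (R.design t ω) (∑ i ∈ Finset.Ico 1 t, R.ε i ω • (x (R.act i ω)).ofLp) ≤
          σ ^ 2 * (logDetRatio lam (R.design t ω) + 2 * Real.log (4 / δ)) := by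
  have hA' : (1 : ℝ) ≤ A := by exact_mod_cast hA
  have hT' : (2 : ℝ) ≤ T := by exact_mod_cast hT
  have hD : 2 ≤ A * T / δ := by rw [le_div_iff₀ hδ]; nlinarith
  have h1 := R.measure_overshoot_le hlam hδ hδ1 hA hT hM0
  have h2 := R.measure_exists_pred_lt_le hlam hM0 (Real.exp (-4))
  have h3 := R.measure_exists_resample_pred_lt_le hlam hM0 K (x b₀).ofLp r
  have h4 := R.measure_exists_noise_ge_le hlam hσ (by omega) (Real.log (4 / δ))
  set F₂ := {ω | ∃ t ∈ Finset.Icc 1 T, ∃ b : Fin A,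
      ∀ j, |R.pred t j (x b).ofLp ω| < Real.exp (-4) * √(invNormSq (R.design t ω) (x b).ofLp)}
  set F₃ := {ω | ∃ t ∈ Finset.Icc 1 T, (R.counter t ω = 0 ∧ R.resamplesBefore t ω < K) ∧
      ∀ j, |R.pred t j (x b₀).ofLp ω| < r * √(invNormSq (R.design t ω) (x b₀).ofLp)}
  set F₄ := {ω | ∃ t ∈ Finset.Icc 1 T,
      σ ^ 2 * (logDetRatio lam (R.design t ω) + 2 * Real.log (4 / δ)) ≤
      invNormSq (R.design t ω) (∑ i ∈ Finset.Ico 1 t, R.ε i ω • (x (R.act i ω)).ofLp)}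
  -- The level exp(-4) makes each failure probability at most (AT/δ)^(-4), which leaves three spare
  -- powers of AT/δ ≥ 2 after the union bound.
  have e2 : T * A * gaussBall (Real.exp (-4)) ^ M ≤ δ / 8 := by
    have hL : Real.log (A * T / δ) ≤ κ * Real.log (A * T / δ) :=
      le_mul_of_one_le_left (Real.log_nonneg (by linarith)) hκ
    have h := gaussBall_pow_le (M := M) (r := Real.exp (-4)) (q := 4) (κ := 1)
      (L := Real.log (A * T / δ))
      (gaussBall_le_self (Real.exp_pos _).le) (by norm_num) (by linarith)
    have h' : Real.exp (-(4 * (1 * Real.log (A * T / δ)))) = ((A * T / δ) ^ 4)⁻¹ := by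
      rw [Real.exp_neg, one_mul, mul_comm, Real.exp_mul, Real.exp_log (by positivity)]
      norm_cast
    rw [h'] at h
    calc _ ≤ T * A * ((A * T / δ) ^ 4)⁻¹ := by gcongr
      _ = δ * ((A * T / δ) ^ 3)⁻¹ := by field_simp
      _ ≤ δ * (2 ^ 3)⁻¹ := by gcongr
      _ = δ / 8 := by ring
  have e4 : Real.exp (-Real.log (4 / δ)) = δ / 4 := by
    rw [Real.exp_neg, Real.exp_log (by positivity), inv_div]
  refine ⟨R.overshoot √(2 * Real.log (32 * (A * T / δ) * M)) ∪ F₂ ∪ F₃ ∪ F₄, ?_, ?_⟩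
  · calc _ ≤ P (R.overshoot √(2 * Real.log (32 * (A * T / δ) * M))) + P F₂ + P F₃ + P F₄ :=
          (measure_union_le _ _).trans (add_le_add_left ((measure_union_le _ _).trans
            (add_le_add_left (measure_union_le _ _) _)) _)
      _ ≤ ENNReal.ofReal (δ / 16) + ENNReal.ofReal (δ / 8) + ENNReal.ofReal (δ / 2) +
          ENNReal.ofReal (δ / 4) := by
          gcongr
          · exact h2.trans (ENNReal.ofReal_le_ofReal e2)
          · exact h3.trans (ENNReal.ofReal_le_ofReal hK)
          · exact h4.trans_eq (by rw [e4])
      _ = ENNReal.ofReal (δ / 16 + δ / 8 + δ / 2 + δ / 4) := by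
          rw [ENNReal.ofReal_add (by positivity) (by positivity),
            ENNReal.ofReal_add (by positivity) (by positivity),
            ENNReal.ofReal_add (by positivity) (by positivity)]
      -- The four shares sum to 15δ/16.
      _ ≤ _ := ENNReal.ofReal_le_ofReal (by linarith)
  · intro ω hω
    simp only [Set.mem_union, not_or] at hω
    obtain ⟨⟨⟨hω1, hω2⟩, hω3⟩, hω4⟩ := hω
    refine ⟨hω1, ?_, ?_, ?_⟩
    · intro t ht b
      by_contra! h
      exact hω2 ⟨t, ht, b, h⟩
    · intro t ht h0 hlt
      by_contra! h
      exact hω3 ⟨t, ht, ⟨h0, hlt⟩, h⟩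
    · intro t ht
      by_contra! h
      exact hω4 ⟨t, ht, h.le⟩

end LazyACBRun

/-! ### Constants and effective dimension -/

/-- The factor between the squared width of the ensemble and `log (A T / δ)`. -/
noncomputable def widthConst (κ : ℝ) : ℝ := 2 * (Real.log (32 * (κ + 1)) / Real.log 2 + 2)

/-- The number of rounds from which on the ensemble of size `log (A T / δ)` suffices. -/
noncomputable def horizonConst (κ : ℝ) : ℝ := Real.exp (12000000 * (1 + 7.5 * widthConst κ))

/-- The factor between the regret and its rate, up to the contribution of small horizons. -/
noncomputable def regretConst (κ : ℝ) : ℝ :=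
  48 * (1.1 * Real.exp 8 + 1) + (1 + 1.05 * Real.exp 4) * √(128 * (1 + 12 * widthConst κ))

theorem widthConst_pos {κ : ℝ} (hκ : 1 ≤ κ) : 0 < widthConst κ := by
  have h1 : 0 ≤ Real.log (32 * (κ + 1)) := Real.log_nonneg (by linarith)
  have h2 : 0 < Real.log 2 := Real.log_pos (by norm_num)
  rw [widthConst]
  positivity

theorem regretConst_pos (κ : ℝ) : 0 < regretConst κ := by
  rw [regretConst]
  positivity

/-- The effective dimension that appears in the bounds. -/
theorem dimension_le {d T : ℕ} {σ W B lam Λ : ℝ} (hd : 1 ≤ d) (hT : 2 ≤ T) (hσ : 0 < σ)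
    (hW : 0 < W) (hB : 0 < B) (hlam : lam = σ ^ 2 / W ^ 2)
    (hΛ : Λ = logPlus (T * B * W ^ 2 / (σ ^ 2 * d)) ∨
      (1 ≤ B ∧ Λ = logPlus (T * B * W / (σ * d)))) :
    1 ≤ Λ ∧ (d * Real.log (1 + T * B / (lam * d)) ≤ 3 * (d * Λ) ∨ (T : ℝ) ≤ d * Λ) := by
  have hd' : (1 : ℝ) ≤ d := by exact_mod_cast hd
  have hT' : (2 : ℝ) ≤ T := by exact_mod_cast hT
  have hΛ1 : 1 ≤ Λ := by
    rcases hΛ with h | ⟨-, h⟩ <;> rw [h] <;> exact le_max_left _ _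
  refine ⟨hΛ1, ?_⟩
  have e : T * B / (lam * d) = T * B * W ^ 2 / (σ ^ 2 * d) := by
    rw [hlam]; field_simp
  rcases hΛ with h | ⟨hB1, h⟩
  · left
    rw [e]
    have := log_le_two_mul_logPlus (y := T * B * W ^ 2 / (σ ^ 2 * d)) (by positivity)
    rw [← h] at this
    nlinarith
  · rcases le_total (d : ℝ) (T * B) with h' | h'
    · left
      have h1 := log_le_three_mul_logPlus (y := T * B / d) (w := W / σ)
        (by rwa [le_div_iff₀ (by positivity), one_mul]) (by positivity)
      have e1 : T * B / d * (W / σ) = T * B * W / (σ * d) := by field_simp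
      have e2 : T * B / d * (W / σ) ^ 2 = T * B / (lam * d) := by rw [hlam]; field_simp
      rw [e1, e2, ← h] at h1
      nlinarith
    -- Here d ≥ TB, and B ≥ 1 gives T ≤ d; this is the only use of B ≥ 1.
    · right
      nlinarith

theorem resampleCount_real_bound {N T C ℓ X E z : ℝ} (hX : 1 ≤ X) (hℓ : 1 / 2 ≤ ℓ) (hC : 0 ≤ C)
    (hE0 : 0 ≤ E) (hNT : N ≤ T) (hN : N ≤ 1 + 2 * z * E) (hz : z ≤ C * ℓ)
    (h : E ≤ 3 * X ∨ T ≤ X) : N ≤ (2 + 6 * C) * (X * ℓ) := by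
  have hXℓ : 1 / 2 * X ≤ X * ℓ := by nlinarith
  have hCX : 0 ≤ C * (X * ℓ) := by positivity
  rcases h with h | h
  · have h1 : z * E ≤ C * ℓ * (3 * X) := by gcongr
    nlinarith
  · nlinarith

/-! ### Deterministic bounds on the good event -/

namespace LazyACBRun

variable {Ω : Type*} [mΩ : MeasurableSpace Ω] {P : Measure Ω} {d A : ℕ}
  {x : Fin A → EuclideanSpace ℝ (Fin d)} {θstar : EuclideanSpace ℝ (Fin d)}
  {σ : ℝ} {M : ℕ} {lam β γ : ℝ} {T : ℕ} (R : LazyACBRun P x θstar σ M lam β γ T)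

/-- The choice of γ cancels β: the potential per phase is (π log 2 / 2)/z², with numerator above 1.
The bound in d gives the claim, the bound in A feeds the union bound for optimism. -/
theorem resampleCount_le_of_notMem_overshoot {B z : ℝ} (hd : 0 < d) (hlam : 0 < lam) (hT : 1 ≤ T)
    (hβ : 0 < β) (hγ : γ = β ^ 2 * Real.pi * Real.log 2 / 2) (hz : 1 ≤ z) (hB0 : 0 ≤ B)
    (hB : ∀ b, ‖x b‖ ^ 2 ≤ B) {ω : Ω} (h : ω ∉ R.overshoot z) :
    (R.resampleCount ω : ℝ) ≤ 1 + 2 * z ^ 2 * (d * Real.log (1 + T * B / (lam * d))) ∧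
      (R.resampleCount ω : ℝ) ≤ 1 + 2 * z ^ 2 * (A * Real.log (1 + T * (B / lam))) := by
  have hγ' : γ = β ^ 2 * (Real.pi * Real.log 2 / 2) := by rw [hγ]; ring
  have hγ0 : 0 < γ := by
    rw [hγ']; have := one_lt_pi_mul_log_two_div_two; positivity
  have e : γ / (β ^ 2 * z ^ 2) = (Real.pi * Real.log 2 / 2) / z ^ 2 := by
    rw [hγ']; field_simp
  have hz2 : 1 ≤ z ^ 2 := one_le_pow₀ hz
  have hup := R.pred_le_of_notMem_overshoot h
  have h1 := R.resampleCount_sub_one_mul_le_logDet hd hlam hT hβ hγ0 (by linarith) hB0 hB hup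
  have h2 := R.resampleCount_sub_one_mul_le_card hlam hT hβ hγ0 (by linarith) hB hup
  rw [e] at h1 h2
  have hlog : ∀ y : ℝ, 0 ≤ y → 0 ≤ Real.log (1 + y) := fun y hy => Real.log_nonneg (by linarith)
  refine ⟨le_of_sub_one_mul_log_le one_lt_pi_mul_log_two_div_two.le hz2 ?_ h1,
    le_of_sub_one_mul_log_le one_lt_pi_mul_log_two_div_two.le hz2 ?_ h2⟩
  · exact mul_nonneg (Nat.cast_nonneg _) (hlog _ (by positivity))
  · exact mul_nonneg (Nat.cast_nonneg _) (hlog _ (by positivity))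

/-- The regret bound on the event that all estimates behave. -/
theorem regret_le_of_good [NeZero A] {W B E Cz X la ℓ z r c₀ : ℝ} (hd : 0 < d) (hlam : 0 < lam)
    (hT : 1 ≤ T) (hσ : 0 < σ) (hB0 : 0 ≤ B) (hβ : 0 < β)
    (hγ : γ = β ^ 2 * Real.pi * Real.log 2 / 2) (hz : 1 ≤ z) (hB : ∀ b, ‖x b‖ ^ 2 ≤ B)
    (hθ : ‖θstar‖ ≤ W) (hBW : √B * W ≤ σ * √T) (hlamW : √lam * W = σ)
    (hE : E = d * Real.log (1 + T * B / (lam * d))) (hEX : E ≤ 3 * X) (hX : 1 ≤ X)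
    (hla : 1 / 2 ≤ la) (hℓ : 1 / 2 ≤ ℓ) (hCz : 0 ≤ Cz) (hzC : z ^ 2 ≤ Cz * (la + ℓ))
    (hβ₀ : β * √(Real.pi * Real.log 2 / 2) = σ + √2 * σ * √(E + ℓ))
    (hr0 : 0 ≤ r) (hr1 : r ≤ √(Real.pi * Real.log 2 / 2))
    (hrad : σ + σ * √(E + c₀) ≤ β * r) {b₀ : Fin A}
    (hb₀ : ∀ b, inner ℝ (x b) θstar ≤ inner ℝ (x b₀) θstar) {ω : Ω}
    (hover : ω ∉ R.overshoot z)
    (hlow : ∀ t ∈ Finset.Icc 1 T, ∀ b, ∃ j,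
      Real.exp (-4) * √(invNormSq (R.design t ω) (x b).ofLp) ≤ |R.pred t j (x b).ofLp ω|)
    (hopt : ∀ t ∈ Finset.Icc 1 T, R.counter t ω = 0 → ∃ j,
      r * √(invNormSq (R.design t ω) (x b₀).ofLp) ≤ |R.pred t j (x b₀).ofLp ω|)
    (hnoise : ∀ t ∈ Finset.Icc 1 T,
      invNormSq (R.design t ω) (∑ i ∈ Finset.Ico 1 t, R.ε i ω • (x (R.act i ω)).ofLp) ≤
        σ ^ 2 * (logDetRatio lam (R.design t ω) + c₀)) :
    R.regret ω ≤ (48 * (1.1 * Real.exp 8 + 1) + (1 + 1.05 * Real.exp 4) * √(128 * (1 + 12 * Cz))) *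
      (σ * X * √(T * la) * ℓ) := by
  set z₀ := √(Real.pi * Real.log 2 / 2) with hz₀
  have hz₀1 := one_lt_pi_mul_log_two_div_two
  have hz₀2 : z₀ ^ 2 = Real.pi * Real.log 2 / 2 := Real.sq_sqrt (by linarith)
  have hz₀3 : z₀ < 1.04346 := sqrt_pi_mul_log_two_div_two_lt
  have hz₀0 : 0 ≤ z₀ := Real.sqrt_nonneg _
  have hγ' : γ = (β * z₀) ^ 2 := by rw [hγ, mul_pow, hz₀2]; ring
  have hγ0 : 0 < γ := by rw [hγ', mul_pow, hz₀2]; positivity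
  have hE0 : 0 ≤ E := by
    rw [hE]
    exact mul_nonneg (Nat.cast_nonneg _) (Real.log_nonneg (by
      have : 0 ≤ T * B / (lam * d) := by positivity
      linarith))
  have hlow' : ∀ t ∈ Finset.Icc 1 T, β * (Real.exp (-4) * √(R.width t ω)) ≤ R.bonus t ω := by
    intro t ht
    obtain ⟨j, hj⟩ := hlow t ht (R.act t ω)
    rw [bonus]
    gcongr
    exact hj.trans (le_ciSup (f := fun j => |R.pred t j (x (R.act t ω)).ofLp ω|)
      (Set.finite_range _).bddAbove j)
  have hup : ∀ t ∈ Finset.Icc 1 T, |R.bonus t ω| ≤ β * (z * √(R.width t ω)) := fun t ht =>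
    R.abs_bonus_le hβ (by linarith) fun j => R.pred_le_of_notMem_overshoot hover t ht _ j
  have hgap : ∀ t ∈ Finset.Icc 1 T, R.counter t ω = 0 →
      (⨆ b : Fin A, inner ℝ (x b) θstar) - inner ℝ (x (R.act t ω)) θstar ≤
        (1 + r / Real.exp (-4)) * R.bonus t ω := by
    intro t ht h0
    refine R.gap_le_bonus hlam hβ hθ (Real.exp_pos _) ht h0 hb₀ ?_ hr0 hrad (hopt t ht h0)
      (hlow' t ht)
    rw [hlamW]
    have h1 : logDetRatio lam (R.design t ω) ≤ E := by
      rw [hE]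
      exact R.logDetRatio_design_le hd hlam hB0 hB (by have := (Finset.mem_Icc.1 ht).2; omega) ω
    have h2 : √(invNormSq (R.design t ω)
        (∑ i ∈ Finset.Ico 1 t, R.ε i ω • (x (R.act i ω)).ofLp)) ≤ √(σ ^ 2 * (E + c₀)) :=
      Real.sqrt_le_sqrt ((hnoise t ht).trans (by gcongr))
    rw [Real.sqrt_mul (sq_nonneg σ), Real.sqrt_sq hσ.le] at h2
    linarith
  have hC₁ : 1 + r / Real.exp (-4) ≤ 1 + 1.05 * Real.exp 4 := by
    rw [Real.exp_neg, div_inv_eq_mul]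
    gcongr
    linarith
  have hreg := R.regret_le hd hlam hβ hγ0 (by linarith : 0 < z) (Real.exp_pos (-4))
    (by positivity : 0 ≤ 1 + r / Real.exp (-4)) hB0 hB (D := 2 * (σ * √T))
    (fun b => (gap_le hB hθ b).trans (by linarith)) (by positivity) hgap hup hlow'
  rw [← hE] at hreg
  have hN := (R.resampleCount_le_of_notMem_overshoot hd hlam hT hβ hγ hz hB0 hB hover).1
  rw [← hE] at hN
  -- The constant 1.1 dominates π log 2 / 2.
  have hlen : γ / (β ^ 2 * Real.exp (-4) ^ 2) + 1 ≤ 1.1 * Real.exp 8 + 1 := by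
    have e1 : γ / (β ^ 2 * Real.exp (-4) ^ 2) = z₀ ^ 2 * Real.exp 8 := by
      rw [hγ', mul_pow, ← Real.exp_nat_mul, show ((2 : ℕ) : ℝ) * (-4) = -8 by norm_num,
        Real.exp_neg]
      field_simp
    rw [e1]
    gcongr
    nlinarith
  have hβz : β ^ 2 * z ^ 2 ≤ (β * z₀) ^ 2 * z ^ 2 := by
    rw [mul_pow, hz₀2]
    have : 0 ≤ β ^ 2 * z ^ 2 := by positivity
    nlinarith
  refine hreg.trans (le_trans ?_ (regret_bound_real (N := R.resampleCount ω) (β₀ := β * z₀)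
    hσ (Nat.cast_nonneg T) hla hℓ hX hE0 hEX hzC hCz hN (by positivity) hβ₀.le
    (by positivity) (by positivity)))
  rw [← hγ'] at hβz ⊢
  gcongr

end LazyACBRun

/-! ### Choice of the optimism radius -/

theorem add_mul_sqrt_le {σ E ℓ c₀ : ℝ} (hσ : 0 ≤ σ) (hE : 0 ≤ E) (hc : c₀ ≤ 2 * ℓ) :
    σ + σ * √(E + c₀) ≤ σ + √2 * σ * √(E + ℓ) := by
  have : √(E + c₀) ≤ √2 * √(E + ℓ) := by
    rw [← Real.sqrt_mul (by norm_num)]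
    exact Real.sqrt_le_sqrt (by linarith)
  nlinarith

/-- Since 0.72 · √2 > 1, shrinking by 0.72 still covers the confidence radius once the root exceeds
about 15.4; the additive σ is what requires this size. -/
theorem add_mul_sqrt_le_mul {σ E ℓ c₀ : ℝ} (hσ : 0 ≤ σ) (hc : c₀ ≤ ℓ) (hℓ : 240 ≤ E + ℓ) :
    σ + σ * √(E + c₀) ≤ 0.72 * (σ + √2 * σ * √(E + ℓ)) := by
  have h1 : √(E + c₀) ≤ √(E + ℓ) := Real.sqrt_le_sqrt (by linarith)
  have h2 : 15.4 ≤ √(E + ℓ) := Real.le_sqrt_of_sq_le (by norm_num; linarith)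
  have h3 : 1.4142 ≤ √2 := Real.le_sqrt_of_sq_le (by norm_num)
  have h4 : 1 + √(E + c₀) ≤ 0.72 * (1 + √2 * √(E + ℓ)) := by nlinarith
  nlinarith

theorem le_log_of_horizonConst_lt {κ T : ℝ} (hT : horizonConst κ < T) :
    12000000 * (1 + 7.5 * widthConst κ) ≤ Real.log T := by
  rw [horizonConst] at hT
  exact (Real.le_log_iff_exp_le ((Real.exp_pos _).trans hT)).2 hT.le

/-- The constant 7.5 is 2 · 1.25 · 3: the factor 1.25 comes from log(1/δ) ≤ log T / 4, the factor 3
from 1 + T·b ≤ T³. -/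
theorem one_add_two_mul_le {A T z C b a : ℝ} (hC : 0 ≤ C) (hA : 1 ≤ A) (hT : 2 ≤ T)
    (ha : 0 ≤ a) (hb0 : 0 ≤ b) (hb : b ≤ T)
    (hz : z ^ 2 ≤ C * (1.25 * (a + Real.log T))) :
    1 + 2 * z ^ 2 * (A * Real.log (1 + T * b)) ≤ A * (1 + 7.5 * C * (a + Real.log T) ^ 2) := by
  have hb' : 0 ≤ T * b := by positivity
  have hlog0 : 0 ≤ Real.log (1 + T * b) := Real.log_nonneg (by linarith)
  have hlog : Real.log (1 + T * b) ≤ 3 * (a + Real.log T) := by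
    have : Real.log (1 + T * b) ≤ Real.log (T ^ 3) := by
      refine Real.log_le_log (by positivity) ?_
      have : T * b ≤ T * T := by gcongr
      nlinarith
    rw [Real.log_pow] at this
    push_cast at this
    linarith
  have hlogT : 0 ≤ Real.log T := Real.log_nonneg (by linarith)
  generalize Real.log (1 + T * b) = l at *
  generalize Real.log T = τ at *
  have h1 : z ^ 2 * l ≤ C * (1.25 * (a + τ)) * (3 * (a + τ)) := by gcongr
  have h2 : A * (z ^ 2 * l) ≤ A * (C * (1.25 * (a + τ)) * (3 * (a + τ))) := by gcongr
  linarith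

namespace LazyACBRun

variable {Ω : Type*} [mΩ : MeasurableSpace Ω] {P : Measure Ω} {d A : ℕ}
  {x : Fin A → EuclideanSpace ℝ (Fin d)} {θstar : EuclideanSpace ℝ (Fin d)}
  {σ : ℝ} {M : ℕ} {lam β γ : ℝ} {T : ℕ} (R : LazyACBRun P x θstar σ M lam β γ T)

/-- The radius up to which the ensemble is optimistic, with the number of re-randomizations that
the union bound has to cover. -/
theorem exists_radius {κ δ B z E : ℝ} (hκ : 1 ≤ κ) (hd : 0 < d) (hA : 2 ≤ A) (hδ : 0 < δ)
    (hδ1 : δ < 1) (hT : horizonConst κ < T) (hσ : 0 < σ) (hlam : 0 < lam) (hβ : 0 < β)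
    (hγ : γ = β ^ 2 * Real.pi * Real.log 2 / 2) (hz : 1 ≤ z)
    (hzC : z ^ 2 ≤ widthConst κ * (Real.log A + Real.log (T / δ)))
    (hB0 : 0 ≤ B) (hB : ∀ b, ‖x b‖ ^ 2 ≤ B) (hBT : B / lam ≤ T)
    (hM : κ * Real.log (A * T / δ) ≤ M) (hE : 0 ≤ E)
    (hβ₀ : β * √(Real.pi * Real.log 2 / 2) = σ + √2 * σ * √(E + Real.log (T / δ)))
    (hcase : 1 ≤ δ ^ 4 * T ∨ 2 / Real.log 2 ≤ κ) :
    ∃ (K : ℕ) (r : ℝ), 0 ≤ r ∧ r ≤ √(Real.pi * Real.log 2 / 2) ∧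
      σ + σ * √(E + 2 * Real.log (4 / δ)) ≤ β * r ∧ K * gaussBall r ^ M ≤ δ / 2 ∧
      ∀ ω ∉ R.overshoot z, ∀ t ∈ Finset.Icc 1 T, R.counter t ω = 0 →
        R.resamplesBefore t ω < K := by
  have hCz := widthConst_pos hκ
  have hτ := le_log_of_horizonConst_lt hT
  have hT0 : (0 : ℝ) < T := (Real.exp_pos _).trans hT
  have hA' : (2 : ℝ) ≤ A := by exact_mod_cast hA
  have hT1 : (4 : ℝ) ≤ T := by
    have := Real.log_le_sub_one_of_pos hT0
    nlinarith
  have hT1' : 1 ≤ T := by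
    have : (1 : ℝ) ≤ T := by linarith
    exact_mod_cast this
  have hℓ : Real.log (T / δ) = Real.log T - Real.log δ := Real.log_div hT0.ne' hδ.ne'
  have hL : Real.log (A * T / δ) = Real.log A + Real.log T - Real.log δ := by
    rw [Real.log_div (by positivity) hδ.ne', Real.log_mul (by positivity) hT0.ne']
  have hlogδ : Real.log δ < 0 := Real.log_neg hδ hδ1
  have hlogA : 0 < Real.log A := Real.log_pos (by linarith)
  have h4 : Real.log (4 / δ) = Real.log 4 - Real.log δ := Real.log_div (by norm_num) hδ.ne'
  have hlog4 : Real.log 4 ≤ Real.log T := Real.log_le_log (by norm_num) hT1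
  have hz₀ : 0 ≤ √(Real.pi * Real.log 2 / 2) := Real.sqrt_nonneg _
  by_cases hκ2 : 2 / Real.log 2 ≤ κ
  -- Large ensemble: every round may be a re-randomization. The failure probability is at most
  -- δ/(AT), and A ≥ 2 leaves δ/2.
  · refine ⟨T, √(Real.pi * Real.log 2 / 2), hz₀, le_rfl, ?_, ?_, ?_⟩
    · rw [hβ₀]
      exact add_mul_sqrt_le hσ.le hE (by rw [h4, hℓ]; linarith)
    · have hlog2 : 0 < Real.log 2 := Real.log_pos (by norm_num)
      have h := gaussBall_pow_le gaussBall_sqrt_le (by positivity) hM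
      have h1 : Real.exp (-(Real.log 2 / 2 * (κ * Real.log (A * T / δ)))) ≤ δ / (A * T) := by
        rw [show δ / (A * T) = Real.exp (-Real.log (A * T / δ)) by
          rw [Real.exp_neg, Real.exp_log (by positivity), inv_div]]
        refine Real.exp_le_exp.2 (neg_le_neg ?_)
        rw [div_le_iff₀ hlog2] at hκ2
        have hL0 : 0 ≤ Real.log (A * T / δ) := by rw [hL]; nlinarith
        nlinarith
      calc T * gaussBall √(Real.pi * Real.log 2 / 2) ^ M ≤ T * (δ / (A * T)) := by
            gcongr; exact h.trans h1
        _ = δ / A := by field_simp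
        _ ≤ δ / 2 := by gcongr
    · intro ω _ t ht h0
      exact (R.resamplesBefore_lt_resampleCount ht h0).trans_le (R.resampleCount_le ω)
  · have hδT := hcase.resolve_right hκ2
    -- This is δ ≥ T^(-1/4). For large T it makes 2 log(4/δ) at most log(T/δ), so the √2 in β
    -- becomes slack.
    have he : 4 * -Real.log δ ≤ Real.log T := by
      have := Real.log_nonneg hδT
      rw [Real.log_mul (by positivity) hT0.ne', Real.log_pow] at this
      push_cast at this
      linarith
    have hlogT : 0 ≤ Real.log T := by nlinarith
    set Q := 1 + 2 * z ^ 2 * (A * Real.log (1 + T * (B / lam))) with hQ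
    have hlogB0 : 0 ≤ Real.log (1 + T * (B / lam)) := Real.log_nonneg (by
      have : 0 ≤ T * (B / lam) := by positivity
      linarith)
    have hQ0 : 0 ≤ Q := by positivity
    have hQle : Q ≤ A * (1 + 7.5 * widthConst κ * (Real.log A + Real.log T) ^ 2) :=
      one_add_two_mul_le hCz.le (by linarith) (by linarith) hlogA.le (by positivity) hBT
        (hzC.trans (by gcongr; rw [hℓ]; linarith))
    -- Small ensemble: the union covers only as many re-randomizations as can occur without
    -- overshoot, by either of the bounds T and Q.
    refine ⟨min T ⌊Q⌋₊, 0.72 * √(Real.pi * Real.log 2 / 2), by positivity, by linarith, ?_, ?_, ?_⟩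
    · rw [mul_left_comm, hβ₀]
      have hlog4' : Real.log 4 ≤ 3 := by
        have := Real.log_le_sub_one_of_pos (by norm_num : (0 : ℝ) < 4)
        linarith
      refine add_mul_sqrt_le_mul hσ.le ?_ ?_
      · rw [h4, hℓ]; linarith
      · rw [hℓ]; linarith
    · have h := gaussBall_pow_le (κ := 1) (M := M) gaussBall_mul_sqrt_le (by norm_num)
        (L := Real.log (A * T / δ)) (le_trans (mul_le_mul_of_nonneg_right hκ
          (by rw [hL]; linarith)) hM)
      rw [one_mul] at h
      have h1 := min_mul_exp_le (a := Real.log A) (τ := Real.log T) (e := -Real.log δ)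
        (c := 7.5 * widthConst κ) (Lr := Real.log (A * T / δ)) (K := (min T ⌊Q⌋₊ : ℕ)) hlogA.le he
        (by positivity) hτ (Nat.cast_nonneg _)
        (by rw [Real.exp_log hT0]; exact_mod_cast min_le_left _ _)
        (by
          rw [Real.exp_log (by linarith)]
          refine le_trans ?_ hQle
          refine le_trans ?_ (Nat.floor_le hQ0)
          exact_mod_cast min_le_right _ _)
        (by rw [hL]; ring)
      rw [neg_neg, Real.exp_log hδ] at h1
      exact (mul_le_mul_of_nonneg_left h (Nat.cast_nonneg _)).trans h1
    · intro ω hω t ht h0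
      refine (R.resamplesBefore_lt_resampleCount ht h0).trans_le
        (le_min (R.resampleCount_le ω) (Nat.le_floor ?_))
      exact (R.resampleCount_le_of_notMem_overshoot hd hlam hT1' hβ hγ hz hB0 hB hω).2

end LazyACBRun

/-! ### Regret for long and for short horizons -/

namespace LazyACBRun

variable {Ω : Type*} [mΩ : MeasurableSpace Ω] {P : Measure Ω} {d A : ℕ}
  {x : Fin A → EuclideanSpace ℝ (Fin d)} {θstar : EuclideanSpace ℝ (Fin d)}
  {σ : ℝ} {M : ℕ} {lam β γ : ℝ} {T : ℕ} (R : LazyACBRun P x θstar σ M lam β γ T)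

theorem exists_regret_event [IsProbabilityMeasure P] {κ δ W B z E X : ℝ} (hκ : 1 ≤ κ) (hd : 0 < d)
    (hA : 2 ≤ A) (hδ : 0 < δ) (hδ1 : δ < 1) (hT2 : 2 ≤ T) (hT : horizonConst κ < T) (hσ : 0 < σ)
    (hlam : 0 < lam) (hβ : 0 < β) (hγ : γ = β ^ 2 * Real.pi * Real.log 2 / 2)
    (hz : z = √(2 * Real.log (32 * (A * T / δ) * M))) (hz1 : 1 ≤ z)
    (hzC : z ^ 2 ≤ widthConst κ * (Real.log A + Real.log (T / δ)))
    (hB0 : 0 ≤ B) (hB : ∀ b, ‖x b‖ ^ 2 ≤ B) (hBT : B / lam ≤ T) (hθ : ‖θstar‖ ≤ W)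
    (hBW : √B * W ≤ σ * √T) (hlamW : √lam * W = σ) (hM0 : 0 < M)
    (hM : κ * Real.log (A * T / δ) ≤ M) (hE : E = d * Real.log (1 + T * B / (lam * d)))
    (hE0 : 0 ≤ E) (hEX : E ≤ 3 * X) (hX : 1 ≤ X)
    (hβ₀ : β * √(Real.pi * Real.log 2 / 2) = σ + √2 * σ * √(E + Real.log (T / δ)))
    (hcase : 1 ≤ δ ^ 4 * T ∨ 2 / Real.log 2 ≤ κ) :
    ∃ F : Set Ω, P F ≤ ENNReal.ofReal δ ∧ ∀ ω ∉ F, ω ∉ R.overshoot z ∧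
      R.regret ω ≤ regretConst κ * (σ * X * √(T * Real.log A) * Real.log (T / δ)) := by
  have : NeZero A := ⟨by omega⟩
  have hA' : (2 : ℝ) ≤ A := by exact_mod_cast hA
  have hT' : (2 : ℝ) ≤ T := by exact_mod_cast hT2
  have hlog2 : 1 / 2 ≤ Real.log 2 := by linarith [Real.log_two_gt_d9]
  have hla : 1 / 2 ≤ Real.log A := hlog2.trans (Real.log_le_log (by norm_num) hA')
  have hℓ : 1 / 2 ≤ Real.log (T / δ) := hlog2.trans (Real.log_le_log (by norm_num)
    (by rw [le_div_iff₀ hδ]; nlinarith))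
  obtain ⟨b₀, hb₀⟩ := Finite.exists_max fun b : Fin A => (inner ℝ (x b) θstar : ℝ)
  obtain ⟨K, r, hr0, hr1, hrad, hK, hKbefore⟩ := R.exists_radius hκ hd hA hδ hδ1 hT hσ hlam hβ hγ
    hz1 hzC hB0 hB hBT hM hE0 hβ₀ hcase
  obtain ⟨F, hF, hgood⟩ := R.exists_bad_event hlam hσ hκ hδ hδ1 (by omega) hT2 hM0 hM b₀ hK
  rw [← hz] at hgood
  refine ⟨F, hF, fun ω hω => ⟨(hgood ω hω).1, ?_⟩⟩
  obtain ⟨hover, hlow, hopt, hnoise⟩ := hgood ω hω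
  exact R.regret_le_of_good hd hlam (by omega) hσ hB0 hβ hγ hz1 hB hθ hBW hlamW hE hEX hX hla hℓ
    (widthConst_pos hκ).le hzC hβ₀ hr0 hr1 hrad hb₀ hover hlow
    (fun t ht h0 => hopt t ht h0 (hKbefore ω hover t ht h0)) hnoise

/-- The regret bound for horizons that are short compared with the dimension, and for a single
action. -/
theorem regret_le_of_short {W B X C δ : ℝ} (hA : 1 ≤ A) (hδ : 0 < δ)
    (hδ1 : δ < 1) (hT2 : 2 ≤ T) (hσ : 0 < σ) (hB : ∀ b, ‖x b‖ ^ 2 ≤ B) (hθ : ‖θstar‖ ≤ W)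
    (hBW : √B * W ≤ σ * √T) (hX : 0 ≤ X) (hC : 0 ≤ C) (h : A = 1 ∨ T ≤ C * X) (ω : Ω) :
    R.regret ω ≤ 8 * C * (σ * X * √(T * Real.log A) * Real.log (T / δ)) := by
  have hT' : (2 : ℝ) ≤ T := by exact_mod_cast hT2
  have hlog2 : 1 / 2 ≤ Real.log 2 := by linarith [Real.log_two_gt_d9]
  have hℓ : 1 / 2 ≤ Real.log (T / δ) := hlog2.trans (Real.log_le_log (by norm_num)
    (by rw [le_div_iff₀ hδ]; nlinarith))
  by_cases hA1 : A = 1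
  · subst hA1
    rw [R.regret_eq_zero_of_subsingleton]
    positivity
  have : NeZero A := ⟨by omega⟩
  have hA' : (2 : ℝ) ≤ A := by exact_mod_cast (by omega : 2 ≤ A)
  have hla : 1 / 2 ≤ Real.log A := hlog2.trans (Real.log_le_log (by norm_num) hA')
  exact (R.regret_le_mul (D := 2 * (σ * √T)) (fun b => (gap_le hB hθ b).trans (by linarith)) ω).trans
    (trivial_regret_real hσ (Nat.cast_nonneg T) hla hℓ hX hC (h.resolve_left hA1))

end LazyACBRun

end LazyACB

/-! ### The main theorem -/

set_option maxHeartbeats 400000 in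
theorem mainTheorem1 (κ : ℝ) (hκ : 1 ≤ κ) :
    ∃ C : ℝ, 0 < C ∧
      ∀ (d A T : ℕ), 1 ≤ d → 1 ≤ A → 2 ≤ T →
      ∀ (σ W B δ lam β γ : ℝ), 0 < σ → 0 < W → 0 < B → 0 < δ → δ < 1 →
      lam = σ ^ 2 / W ^ 2 →
      β = (Real.sqrt lam * W + Real.sqrt 2 * σ *
          Real.sqrt (d * Real.log (1 + T * B / (lam * d)) + Real.log (T / δ))) *
            Real.sqrt (2 / (Real.pi * Real.log 2)) →
      γ = β ^ 2 * Real.pi * Real.log 2 / 2 →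
      ∀ (x : Fin A → EuclideanSpace ℝ (Fin d)) (θstar : EuclideanSpace ℝ (Fin d)),
      (∀ b, ‖x b‖ ^ 2 ≤ B) → ‖θstar‖ ≤ W →
      ∀ (Ω : Type*) [MeasurableSpace Ω] (P : Measure Ω) [IsProbabilityMeasure P]
        (R : LazyACBRun P x θstar σ ⌈κ * Real.log (A * T / δ)⌉₊ lam β γ T) (Λ : ℝ),
      (Λ = logPlus (T * B * W ^ 2 / (σ ^ 2 * d)) ∨
        (1 ≤ B ∧ Λ = logPlus (T * B * W / (σ * d)))) →
      ENNReal.ofReal (1 - δ) ≤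
        P {ω | (B * W ^ 2 ≤ σ ^ 2 * T → (1 ≤ δ ^ 4 * T ∨ 2 / Real.log 2 ≤ κ) →
              R.regret ω ≤
                C * (σ * d * Real.sqrt (T * Real.log A)) * Real.log (T / δ) * Λ) ∧
            (R.resampleCount ω : ℝ) ≤ C * (d * Λ * Real.log (A * T / δ))} := by
  have hCz := widthConst_pos hκ
  have hCr := regretConst_pos κ
  have hH : 0 < horizonConst κ := Real.exp_pos _
  -- The summands serve, in this order, the re-randomization count, the regret for long horizons,
  -- and the trivial regret bound for short ones.
  refine ⟨2 + 6 * widthConst κ + regretConst κ + 8 * (horizonConst κ + 1), by positivity, ?_⟩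
  intro d A T hd hA hT σ W B δ lam β γ hσ hW hB0 hδ hδ1 hlam hβ hγ x θstar hB hθ Ω _ P _ R Λ hΛ
  set C := 2 + 6 * widthConst κ + regretConst κ + 8 * (horizonConst κ + 1) with hC
  obtain ⟨hΛ1, hdim⟩ := dimension_le hd hT hσ hW hB0 hlam hΛ
  have hd' : (1 : ℝ) ≤ d := by exact_mod_cast hd
  have hA' : (1 : ℝ) ≤ A := by exact_mod_cast hA
  have hT' : (2 : ℝ) ≤ T := by exact_mod_cast hT
  have hX : 1 ≤ d * Λ := by nlinarith
  have hlam0 : 0 < lam := by rw [hlam]; positivity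
  have hlamW : √lam * W = σ := by
    rw [hlam, Real.sqrt_div' _ (sq_nonneg W), Real.sqrt_sq hσ.le, Real.sqrt_sq hW.le,
      div_mul_cancel₀ _ hW.ne']
  have hlog2 : 1 / 2 ≤ Real.log 2 := by linarith [Real.log_two_gt_d9]
  have hTδ : 2 ≤ T / δ := by rw [le_div_iff₀ hδ]; nlinarith
  have hℓ : 1 / 2 ≤ Real.log (T / δ) := hlog2.trans (Real.log_le_log (by norm_num) hTδ)
  have hD : 2 ≤ A * T / δ := by rw [mul_div_assoc]; nlinarith
  have hlogD2 : 1 / 2 ≤ Real.log (A * T / δ) := hlog2.trans (Real.log_le_log (by norm_num) hD)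
  have hlogD : Real.log (A * T / δ) = Real.log A + Real.log (T / δ) := by
    rw [mul_div_assoc, Real.log_mul (by positivity) (by positivity)]
  set E := d * Real.log (1 + T * B / (lam * d)) with hE
  have hE0 : 0 ≤ E := mul_nonneg (Nat.cast_nonneg _) (Real.log_nonneg (by
    have : 0 ≤ T * B / (lam * d) := by positivity
    linarith))
  have hpl := one_lt_pi_mul_log_two_div_two
  have hβ₀ : β * √(Real.pi * Real.log 2 / 2) = σ + √2 * σ * √(E + Real.log (T / δ)) := by
    rw [hβ, hlamW, mul_assoc, ← Real.sqrt_mul (by positivity), div_mul_div_cancel₀ (by positivity),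
      div_self (by norm_num), Real.sqrt_one, mul_one]
  have hβ0 : 0 < β := by
    rw [hβ, hlamW]
    have : 0 < 2 / (Real.pi * Real.log 2) := by positivity
    positivity
  have hM0 : 0 < κ * Real.log (A * T / δ) := by positivity
  have hM : κ * Real.log (A * T / δ) ≤ ⌈κ * Real.log (A * T / δ)⌉₊ := Nat.le_ceil _
  have hM1 : (⌈κ * Real.log (A * T / δ)⌉₊ : ℝ) ≤ κ * Real.log (A * T / δ) + 1 :=
    (Nat.ceil_lt_add_one hM0.le).le
  replace hM0 : 0 < ⌈κ * Real.log (A * T / δ)⌉₊ := Nat.ceil_pos.2 hM0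
  generalize ⌈κ * Real.log (A * T / δ)⌉₊ = M at *
  have hM' : (1 : ℝ) ≤ M := by exact_mod_cast hM0
  obtain ⟨z, hz⟩ : ∃ z, z = √(2 * Real.log (32 * (A * T / δ) * M)) := ⟨_, rfl⟩
  have hz0 : 1 ≤ 2 * Real.log (32 * (A * T / δ) * M) := by
    have : Real.log 2 ≤ Real.log (32 * (A * T / δ) * M) :=
      Real.log_le_log (by norm_num) (by nlinarith)
    linarith
  have hz1 : 1 ≤ z := by rw [hz]; exact Real.one_le_sqrt.2 hz0
  have hzC : z ^ 2 ≤ widthConst κ * Real.log (A * T / δ) := by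
    rw [hz, Real.sq_sqrt (by linarith), widthConst]
    exact two_mul_log_le hκ hD (by linarith) hM1
  have hcount : ∀ ω ∉ R.overshoot z,
      (R.resampleCount ω : ℝ) ≤ C * (d * Λ * Real.log (A * T / δ)) := by
    intro ω hω
    have h1 := (R.resampleCount_le_of_notMem_overshoot hd hlam0 (by omega) hβ0 hγ hz1 hB0.le hB
      hω).1
    refine (resampleCount_real_bound hX hlogD2 hCz.le hE0
      (by exact_mod_cast R.resampleCount_le ω) h1 hzC hdim).trans ?_
    gcongr
    rw [hC]
    linarith
  have hover : P (R.overshoot z) ≤ ENNReal.ofReal δ := by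
    rw [hz]
    exact (R.measure_overshoot_le hlam0 hδ hδ1 hA hT hM0).trans
      (ENNReal.ofReal_le_ofReal (by linarith))
  have hrate : ∀ c ≤ C, c * (σ * (d * Λ) * √(T * Real.log A) * Real.log (T / δ)) ≤
      C * (σ * d * √(T * Real.log A)) * Real.log (T / δ) * Λ := by
    intro c hc
    calc _ ≤ C * (σ * (d * Λ) * √(T * Real.log A) * Real.log (T / δ)) := by gcongr
      _ = _ := by ring
  by_cases hcond : B * W ^ 2 ≤ σ ^ 2 * T ∧ (1 ≤ δ ^ 4 * T ∨ 2 / Real.log 2 ≤ κ)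
  swap
  -- Without the hypotheses of the regret bound only the count is claimed, and excluding the
  -- overshoot event suffices.
  · exact ofReal_one_sub_le_measure hδ.le hover fun ω hω =>
      ⟨fun h1 h2 => absurd ⟨h1, h2⟩ hcond, hcount ω hω⟩
  obtain ⟨hBWT, hcase⟩ := hcond
  have hBW : √B * W ≤ σ * √T := by
    have h := Real.sqrt_le_sqrt hBWT
    rwa [Real.sqrt_mul hB0.le, Real.sqrt_sq hW.le, Real.sqrt_mul (sq_nonneg σ),
      Real.sqrt_sq hσ.le] at h
  -- The negation gives both T > `horizonConst κ` and T > dΛ; the latter excludes the second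
  -- alternative of `hdim`.
  by_cases hshort : A = 1 ∨ (T : ℝ) ≤ (horizonConst κ + 1) * (d * Λ)
  · exact ofReal_one_sub_le_measure hδ.le hover fun ω hω => ⟨fun _ _ =>
      (R.regret_le_of_short hA hδ hδ1 hT hσ hB hθ hBW (by linarith) (by positivity) hshort ω).trans
        (hrate _ (by rw [hC]; linarith)), hcount ω hω⟩
  push Not at hshort
  have hBT : B / lam ≤ T := by
    rw [hlam, div_div_eq_mul_div, div_le_iff₀ (by positivity)]
    linarith
  obtain ⟨F, hF, hgood⟩ := R.exists_regret_event hκ hd (by omega) hδ hδ1 hT (by nlinarith) hσ hlam0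
    hβ0 hγ hz hz1 (by rwa [← hlogD]) hB0.le hB hBT hθ hBW hlamW hM0 hM hE hE0
    (hdim.resolve_right (by nlinarith)) hX hβ₀ hcase
  exact ofReal_one_sub_le_measure hδ.le hF fun ω hω => ⟨fun _ _ => (hgood ω hω).2.trans
    (hrate _ (by rw [hC]; linarith)), hcount ω (hgood ω hω).1⟩
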